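/- Let $g\ge 0$ and let $\tau$ be a symmetric complex $g\times g$ matrix with positive definite imaginary part. Let $\theta(z)=\sum_{n\in\mathbb Z^g}\exp\big(\pi i\,n^t(\tau n+2z)\big)$, $z\in\mathbb C^g$, be the Riemann theta function, and for $\varepsilon\in\{0,\tfrac12\}^g$ let $$\Theta[\varepsilon](z)=\sum_{n\in\mathbb Z^g}\exp\big(\pi i\,(n+\varepsilon)^t(2\tau(n+\varepsilon)+4z)\big),\qquad \mathrm{Kum}(z)=\big(\Theta[\varepsilon](z)\big)_{\varepsilon}\in\mathbb C^{2^g}.$$ For $v\in\mathbb C^g$ let $\partial_v=D_v$ be the derivative in the direction $v$. Let $U,V,D\in\mathbb C^g$ and $p,E\in\mathbb C$, and for $Z\in\mathbb C^g$ put $$u(x,y)=2\,\partial_x^2\ln\theta(Ux+Vy+Z),\qquad \psi(x,y)=\frac{\theta(Ux+Vy+D+Z)}{\theta(Ux+Vy+Z)}\,e^{px+Ey}.$$ Consider the conditions (L) for every $Z\in\mathbb C^g$, $(\partial_x^2+u)\psi=\partial_y\psi$ at all $(x,y)\in\mathbb C^2$ with $\theta(Ux+Vy+Z)\neq0$; (K)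 $\big(\partial_V+\partial_U^2-2p\,\partial_U+(p^2-E)\big)\mathrm{Kum}(q/2)=0$, where $q=-D$. Then (L) and (K) are equivalent. Moreover, either one of them implies both of the following, where $D_1=D_U$ and $D_2=D_V$. (T) At every $z\in\mathbb C^g$ with $\theta(z)=0$, $$\big((D_2\theta)^2-(D_1^2\theta)^2\big)D_1^2\theta+2\big(D_1^2\theta\,D_1^3\theta-D_2\theta\,D_1D_2\theta\big)D_1\theta+\big(D_2^2\theta-D_1^4\theta\big)(D_1\theta)^2=0 .$$ (Motion of zeros) Let $Z\in\mathbb C^g$, and let $\tilde x$ be a holomorphic function near $y_0\in\mathbb C$ with $\theta(\tilde x(y)U+yV+Z)=0$ for $y$ near $y_0$ and $D_1\theta(\tilde x(y_0)U+y_0V+Z)\ne0$. Then, as $x\to\tilde x(y_0)$, the potential has an expansion $$u(x,y_0)=-\frac{2}{(x-\tilde x(y_0))^2}+v+w\,(x-\tilde x(y_0))+o(x-\tilde x(y_0))$$ with $v,w\in\mathbb C$, and $\ddot{\tilde x}(y_0)=-2w$. -/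

import Mathlib

open scoped Matrix Topology
open Filter Asymptotics

noncomputable section

namespace FlexTheta

/-- The Siegel space: symmetric complex matrices with positive definite imaginary part. -/
def siegelSpace (g : ℕ) : Set (Matrix (Fin g) (Fin g) ℂ) :=
  {τ | τ.IsSymm ∧ (τ.map Complex.im).PosDef}

/-- The theta function with characteristics `ε`, `δ`:
`∑ n ∈ ℤ^g, exp (π i (n + ε)ᵗ (τ (n + ε) + 2 (z + δ)))`. -/
def thetaChar {g : ℕ} (ε δ : Fin g → ℂ) (τ : Matrix (Fin g) (Fin g) ℂ) (z : Fin g → ℂ) : ℂ :=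
  ∑' n : Fin g → ℤ,
    Complex.exp (Real.pi * Complex.I *
      (((fun j => (n j : ℂ)) + ε) ⬝ᵥ
        (τ *ᵥ ((fun j => (n j : ℂ)) + ε) + (2 : ℂ) • (z + δ))))

/-- The Riemann theta function `∑ n ∈ ℤ^g, exp (π i nᵗ (τ n + 2 z))`. -/
def theta {g : ℕ} (τ : Matrix (Fin g) (Fin g) ℂ) (z : Fin g → ℂ) : ℂ :=
  ∑' n : Fin g → ℤ,
    Complex.exp (Real.pi * Complex.I *
      ((fun j => (n j : ℂ)) ⬝ᵥ (τ *ᵥ (fun j => (n j : ℂ)) + (2 : ℂ) • z)))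

/-- The Kummer map, lifted to `ℂ ^ (2 ^ g)`: its coordinates are the theta functions of the second
order `Θ[ε](τ, z) = θ[ε, 0](2 τ, 2 z)`, where `ε = e / 2` and `e` runs over `{0, 1}^g`. -/
def kummer {g : ℕ} (τ : Matrix (Fin g) (Fin g) ℂ) (z : Fin g → ℂ) : (Fin g → Fin 2) → ℂ :=
  fun e => thetaChar (fun j => (((e j : ℕ) : ℂ)) / 2) 0 ((2 : ℂ) • τ) ((2 : ℂ) • z)

/-- The directional derivative `∂_v f`, as a function on `ℂ^g`. -/
def dirDeriv {g : ℕ} {F : Type*} [NormedAddCommGroup F] [NormedSpace ℂ F]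
    (v : Fin g → ℂ) (f : (Fin g → ℂ) → F) : (Fin g → ℂ) → F :=
  fun z => lineDeriv ℂ f z v

/-- The flex condition on the Kummer image at `q / 2`:
`(∂_V + ∂_U² - 2 p ∂_U + (p² - E)) Kum (q / 2) = 0`. -/
def FlexEquation {g : ℕ} (τ : Matrix (Fin g) (Fin g) ℂ) (U V q : Fin g → ℂ) (p E : ℂ) : Prop :=
  dirDeriv V (kummer τ) ((1 / 2 : ℂ) • q)
    + dirDeriv U (dirDeriv U (kummer τ)) ((1 / 2 : ℂ) • q)
    - (2 * p) • dirDeriv U (kummer τ) ((1 / 2 : ℂ) • q)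
    + (p ^ 2 - E) • kummer τ ((1 / 2 : ℂ) • q) = 0

/-- The potential `u (x, y) = 2 ∂_x² ln θ(x U + y V + Z)`, with `∂_x ln` the logarithmic
derivative. -/
def potential {g : ℕ} (τ : Matrix (Fin g) (Fin g) ℂ) (U V Z : Fin g → ℂ) (x y : ℂ) : ℂ :=
  2 * deriv (logDeriv fun s : ℂ => theta τ (s • U + y • V + Z)) x

/-- `ψ (x, y) = θ(x U + y V + D + Z) / θ(x U + y V + Z) * exp (p x + E y)`. -/
def psi {g : ℕ} (τ : Matrix (Fin g) (Fin g) ℂ) (U V D Z : Fin g → ℂ) (p E x y : ℂ) : ℂ :=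
  theta τ (x • U + y • V + D + Z) / theta τ (x • U + y • V + Z) * Complex.exp (p * x + E * y)

/-- The linear equation `(∂_x² + u) ψ = ∂_y ψ`, for all translations `Z`, wherever the denominator
`θ(x U + y V + Z)` of `u` and `ψ` does not vanish. -/
def LinearEquation {g : ℕ} (τ : Matrix (Fin g) (Fin g) ℂ) (U V D : Fin g → ℂ) (p E : ℂ) : Prop :=
  ∀ (Z : Fin g → ℂ) (x y : ℂ), theta τ (x • U + y • V + Z) ≠ 0 →
    iteratedDeriv 2 (fun s => psi τ U V D Z p E s y) x
      + potential τ U V Z x y * psi τ U V D Z p E x y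
      = deriv (fun t => psi τ U V D Z p E x t) y

/-- The cubic relation on the theta divisor, in the derivatives `D₁ = D_U`, `D₂ = D_V` of `θ`. -/
def ThetaDivisorRelation {g : ℕ} (τ : Matrix (Fin g) (Fin g) ℂ) (U V : Fin g → ℂ) : Prop :=
  ∀ z : Fin g → ℂ, theta τ z = 0 →
    ((dirDeriv V (theta τ) z) ^ 2 - (dirDeriv U (dirDeriv U (theta τ)) z) ^ 2)
        * dirDeriv U (dirDeriv U (theta τ)) z
      + 2 * (dirDeriv U (dirDeriv U (theta τ)) z
              * dirDeriv U (dirDeriv U (dirDeriv U (theta τ))) z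
            - dirDeriv V (theta τ) z * dirDeriv U (dirDeriv V (theta τ)) z)
          * dirDeriv U (theta τ) z
      + (dirDeriv V (dirDeriv V (theta τ)) z
            - dirDeriv U (dirDeriv U (dirDeriv U (dirDeriv U (theta τ)))) z)
          * (dirDeriv U (theta τ) z) ^ 2 = 0

/-- The equation of motion `ξ'' = -2 w` of the simple zeros `x = ξ(y)` of `θ(x U + y V + Z)`, where
`u = -2 / (x - ξ)² + v + w (x - ξ) + ⋯` is the expansion of the potential at `ξ`. -/
def ZeroDynamics {g : ℕ} (τ : Matrix (Fin g) (Fin g) ℂ) (U V : Fin g → ℂ) : Prop :=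
  ∀ (Z : Fin g → ℂ) (ξ : ℂ → ℂ) (y₀ : ℂ), AnalyticAt ℂ ξ y₀ →
    (∀ᶠ y in 𝓝 y₀, theta τ (ξ y • U + y • V + Z) = 0) →
    dirDeriv U (theta τ) (ξ y₀ • U + y₀ • V + Z) ≠ 0 →
    ∃ v w : ℂ,
      ((fun x => potential τ U V Z x y₀
          - (-2 / (x - ξ y₀) ^ 2 + v + w * (x - ξ y₀))) =o[𝓝[≠] (ξ y₀)] fun x => x - ξ y₀) ∧
      iteratedDeriv 2 ξ y₀ = -2 * w

end FlexTheta

end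

/-! Conditions (L) and (K) are two readings of one bilinear identity. With `f = θ` and `h = θ(· +
D)`, the linear equation multiplied by `f²` and divided by the exponential becomes `HirotaEquation`;
the factor 2 in `u = 2 ∂ₓ² ln θ` is what cancels the terms with `f` left in the denominator. Since
`θ ≠ 0` is a dense condition, the identity then holds everywhere
(`linearEquation_iff_hirotaEquation`). With `b = D / 2`, the Hirota form is a differential operator
in `b` applied to `θ(a + b) θ(a - b) = ∑ Kum_ε(a) Kum_ε(b)`. The functions `Kum_ε` are linearly
independent, so the form vanishes for all `a` exactly when the operator kills `Kum` at `b`; as `Kum`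
is even, this is (K) (`hirotaEquation_iff_kummer`).

For (T), differentiate the Hirota equation at a zero of `f` and eliminate the derivatives of `h`:
what remains is `h` times the cubic expression (`HirotaEquation.mul_cubic_eq_zero`). If the cubic is
nonzero at a point of the theta divisor, then `h` vanishes on the divisor nearby. Where moreover
`D₁θ ≠ 0`, the Hirota equation forces `dh = 0` there, so `θ` is singular along a smooth
hypersurface, a translate of the divisor. Where instead `D₁θ = 0`, the divisor coincides locally
with the smooth hypersurface `D₁θ = 0`, and `dθ = 0` along it. Both cases contradict the reducedness
of the theta divisor (`theta_divisor_reduced`).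

Reducedness takes up most of the work. Choose an integral direction `w`, transverse to the supposed
hypersurface, such that `θ` vanishes identically on no line of direction `w`. On such a line `θ` is
a function of `q = exp(2πit)`; sum `q / (1 - q)²` over its multiple zeros. The set of multiple zeros
is invariant under lattice translations of the base point `z`. Since `θ(z)` is the value at `q = 1`,
a double zero at `q` near `1` makes it `O(|1 - q|²)`, which cancels the double pole. Hence `θ` times
the sum extends to an entire function with the automorphy of `θ`, which is a multiple of `θ`
(`exists_eq_const_mul_theta`), and the sum is generically constant (`exists_koebeSum_eq_const`). If
`dθ` vanished along a hypersurface of the divisor, one term would blow up near it while the others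
stay bounded.

The motion of zeros follows from (T): two differentiations of `θ(x̃ U + y V + Z) = 0` give the
second derivative of `x̃`, and (T) identifies it with the third logarithmic derivative that defines
`w`. -/

namespace FlexTheta

/-! ### Holomorphic functions on normed spaces: Cauchy estimates and smoothness. -/

section SeveralComplexVariables

open Metric Set

variable {E : Type*} [NormedAddCommGroup E] [NormedSpace ℂ E]

/-- The one-variable Cauchy estimate on the discs `s ↦ z + s • v` gives `M / R` for every `R < r /
‖v‖`; then `R` tends to that bound. -/
theorem norm_fderiv_le_of_forall_ball {F : E → ℂ} {z : E} {r M : ℝ} (hr : 0 < r)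
    (hF : DifferentiableOn ℂ F (ball z r)) (hM : ∀ y ∈ ball z r, ‖F y‖ ≤ M) :
    ‖fderiv ℂ F z‖ ≤ M / r := by
  have hM0 : 0 ≤ M := (norm_nonneg _).trans (hM z (mem_ball_self hr))
  refine ContinuousLinearMap.opNorm_le_bound _ (div_nonneg hM0 hr.le) fun v => ?_
  rcases eq_or_ne v 0 with rfl | hv
  · simp
  have hv' : 0 < ‖v‖ := norm_pos_iff.2 hv
  have hz : DifferentiableAt ℂ F z := hF.differentiableAt (isOpen_ball.mem_nhds (mem_ball_self hr))
  have key : ∀ R : ℝ, 0 < R → R * ‖v‖ < r → ‖fderiv ℂ F z v‖ ≤ M / R := by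
    intro R hR hRr
    have hmem : ∀ s ∈ closedBall (0 : ℂ) R, z + s • v ∈ ball z r := by
      intro s hs
      rw [mem_closedBall_zero_iff] at hs
      rw [mem_ball_iff_norm, add_sub_cancel_left, norm_smul]
      exact (mul_le_mul_of_nonneg_right hs hv'.le).trans_lt hRr
    have hd : DifferentiableOn ℂ (fun s : ℂ => F (z + s • v)) (closedBall 0 R) := by
      refine hF.comp (by fun_prop) hmem
    have h1 := Complex.norm_deriv_le_of_forall_mem_sphere_norm_le (f := fun s : ℂ => F (z + s • v))
      (c := 0) (C := M) hR (hd.diffContOnCl_ball le_rfl)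
      (fun s hs => hM _ (hmem s (sphere_subset_closedBall hs)))
    have h2 : HasDerivAt (fun s : ℂ => F (z + s • v)) (fderiv ℂ F z v) 0 := by
      have := hz.hasFDerivAt.hasLineDerivAt v
      exact this
    rwa [h2.deriv] at h1
  have hlim : Tendsto (fun R : ℝ => M / R) (𝓝[<] (r / ‖v‖)) (𝓝 (M / (r / ‖v‖))) :=
    ((tendsto_const_nhds.div tendsto_id (by positivity)).mono_left nhdsWithin_le_nhds)
  have hle : ‖fderiv ℂ F z v‖ ≤ M / (r / ‖v‖) := by
    refine ge_of_tendsto hlim ?_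
    filter_upwards [Ioo_mem_nhdsLT (show 0 < r / ‖v‖ by positivity)] with R hR
    exact key R hR.1 (by rw [← lt_div_iff₀ hv']; exact hR.2)
  calc _ ≤ _ := hle
    _ = M / r * ‖v‖ := by field_simp

/-- The Cauchy estimate is applied to a difference of translates, `F (y + ·) - F (z + ·)`, which is
small because `F` is locally Lipschitz. -/
theorem continuousOn_fderiv_of_differentiableOn {F : E → ℂ} {O : Set E} (hO : IsOpen O)
    (hF : DifferentiableOn ℂ F O) : ContinuousOn (fderiv ℂ F) O := by
  intro z hz
  refine ContinuousAt.continuousWithinAt ?_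
  have hc : ContinuousAt F z := (hF.differentiableAt (hO.mem_nhds hz)).continuousAt
  obtain ⟨r, hr, hball⟩ : ∃ r > 0, ball z r ⊆ O ∩ {y | ‖F y‖ < ‖F z‖ + 1} := by
    refine Metric.mem_nhds_iff.1 (inter_mem (hO.mem_nhds hz) ?_)
    exact (hc.norm).eventually_lt continuousAt_const (by simp)
  set M := ‖F z‖ + 1
  have hd : ∀ y ∈ ball z r, DifferentiableAt ℂ F y := fun y hy =>
    hF.differentiableAt (hO.mem_nhds (hball hy).1)
  have hfd : ∀ y ∈ ball z (r / 2), ‖fderiv ℂ F y‖ ≤ M / (r / 2) := by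
    intro y hy
    have hsub : ball y (r / 2) ⊆ ball z r := by
      refine ball_subset_ball' ?_
      have := mem_ball.1 hy
      linarith
    exact norm_fderiv_le_of_forall_ball (by positivity) (hF.mono fun x hx => (hball (hsub hx)).1)
      (fun x hx => (hball (hsub hx)).2.le)
  have hlip : ∀ y ∈ ball z (r / 2), ∀ x ∈ ball z (r / 2), ‖F y - F x‖ ≤ M / (r / 2) * ‖y - x‖ := by
    intro y hy x hx
    refine (convex_ball z (r / 2)).norm_image_sub_le_of_norm_fderiv_le (𝕜 := ℂ)
      (fun w hw => hd w (ball_subset_ball (by linarith) hw)) hfd hx hy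
  rw [Metric.continuousAt_iff]
  intro ε hε
  have hM : 0 < M := by positivity
  refine ⟨min (r / 4) (ε * (r / 4) / (M / (r / 2)) / 2), by positivity, fun {y} hy => ?_⟩
  have hy1 : dist y z < r / 4 := hy.trans_le (min_le_left _ _)
  have hy2 := hy.trans_le (min_le_right _ _)
  rw [dist_eq_norm] at hy1 hy2
  have hb1 : ∀ x ∈ ball (0 : E) (r / 4), z + x ∈ ball z (r / 2) := by
    intro x hx
    rw [mem_ball_zero_iff] at hx
    rw [mem_ball_iff_norm, add_sub_cancel_left]
    linarith
  have hb2 : ∀ x ∈ ball (0 : E) (r / 4), y + x ∈ ball z (r / 2) := by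
    intro x hx
    rw [mem_ball_zero_iff] at hx
    rw [mem_ball_iff_norm]
    calc ‖y + x - z‖ = ‖(y - z) + x‖ := by congr 1; abel
      _ ≤ ‖y - z‖ + ‖x‖ := norm_add_le _ _
      _ < _ := by linarith
  have hsub2 : ball z (r / 2) ⊆ ball z r := ball_subset_ball (by linarith)
  have hdy : HasFDerivAt (fun x => F (y + x)) (fderiv ℂ F y) 0 := by
    have h0 := (hd (y + 0) (hsub2 (hb2 0 (by simp; positivity)))).hasFDerivAt
    have := h0.comp (0 : E) ((hasFDerivAt_id (0 : E)).const_add y)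
    simpa [Function.comp_def] using this
  have hdz : HasFDerivAt (fun x => F (z + x)) (fderiv ℂ F z) 0 := by
    have h0 := (hd (z + 0) (hsub2 (hb1 0 (by simp; positivity)))).hasFDerivAt
    have := h0.comp (0 : E) ((hasFDerivAt_id (0 : E)).const_add z)
    simpa [Function.comp_def] using this
  have := norm_fderiv_le_of_forall_ball (F := fun x => F (y + x) - F (z + x)) (z := 0)
    (r := r / 4) (M := M / (r / 2) * ‖y - z‖) (by positivity) ?_ ?_
  · rw [(hdy.fun_sub hdz).fderiv] at this
    rw [dist_eq_norm]
    refine this.trans_lt ?_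
    rw [div_lt_iff₀ (by positivity)]
    have h3 : M / (r / 2) * ‖y - z‖ < M / (r / 2) * (ε * (r / 4) / (M / (r / 2))) := by
      refine mul_lt_mul_of_pos_left (hy2.trans ?_) (by positivity)
      exact half_lt_self (by positivity)
    refine h3.trans_eq ?_
    field_simp
  · intro x hx
    exact (((hd _ (hsub2 (hb2 x hx))).comp x (by fun_prop)).sub
      ((hd _ (hsub2 (hb1 x hx))).comp x (by fun_prop))).differentiableWithinAt
  · intro x hx
    have := hlip _ (hb2 x hx) _ (hb1 x hx)
    simpa using this

/-- Differentiation under the integral: the derivative of `K` is continuous, hence bounded near the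
compact circle over `z₀`. -/
theorem differentiableAt_circleIntegral {K : E × ℂ → ℂ} {W : Set (E × ℂ)} (hW : IsOpen W)
    (hK : DifferentiableOn ℂ K W) {z₀ : E} {c : ℂ} {r : ℝ}
    (hz : ∀ t ∈ sphere c |r|, (z₀, t) ∈ W) :
    DifferentiableAt ℂ (fun z => ∮ t in C(c, r), K (z, t)) z₀ := by
  have hcd := continuousOn_fderiv_of_differentiableOn hW hK
  have hcomp : IsCompact (sphere c |r|) := isCompact_sphere _ _
  have hcont : Continuous fun t : ℂ => (z₀, t) := by fun_prop
  obtain ⟨M, hM⟩ := hcomp.exists_bound_of_continuousOn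
    (f := fun t => fderiv ℂ K (z₀, t)) (hcd.comp hcont.continuousOn hz)
  have hev : ∀ᶠ z in 𝓝 z₀, ∀ t ∈ sphere c |r|, (z, t) ∈ W ∧ ‖fderiv ℂ K (z, t)‖ < M + 1 := by
    refine hcomp.eventually_forall_of_forall_eventually fun t ht => ?_
    have h1 : ∀ᶠ p in 𝓝 (z₀, t), p ∈ W := hW.mem_nhds (hz t ht)
    have h2 : ∀ᶠ p in 𝓝 (z₀, t), ‖fderiv ℂ K p‖ < M + 1 :=
      (hcd.continuousAt (hW.mem_nhds (hz t ht))).norm.eventually_lt continuousAt_const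
        ((hM t ht).trans_lt (by linarith))
    filter_upwards [h1, h2] with p h1 h2 using ⟨h1, h2⟩
  have hmem : ∀ θ : ℝ, circleMap c r θ ∈ sphere c |r| := fun θ => circleMap_mem_sphere' c r θ
  set ι : E →L[ℂ] E × ℂ := ContinuousLinearMap.inl ℂ E ℂ
  have hcont2 : ∀ᶠ z in 𝓝 z₀, Continuous fun θ : ℝ => deriv (circleMap c r) θ • K (z, circleMap c r θ) := by
    filter_upwards [hev] with z hz
    have : Continuous fun θ : ℝ => K (z, circleMap c r θ) := by
      refine hK.continuousOn.comp_continuous (by fun_prop) fun θ => (hz _ (hmem θ)).1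
    simp only [deriv_circleMap]
    have h2 : Continuous fun θ : ℝ => circleMap 0 r θ * Complex.I := by fun_prop
    exact h2.smul this
  have h := intervalIntegral.hasFDerivAt_integral_of_dominated_of_fderiv_le (𝕜 := ℂ)
    (μ := MeasureTheory.volume) (a := 0) (b := 2 * Real.pi) (x₀ := z₀)
    (F := fun z θ => deriv (circleMap c r) θ • K (z, circleMap c r θ))
    (F' := fun z θ => deriv (circleMap c r) θ • (fderiv ℂ K (z, circleMap c r θ)).comp ι)
    (bound := fun _ => |r| * ((M + 1) * ‖ι‖)) hev
    (by filter_upwards [hcont2] with z hz using hz.aestronglyMeasurable)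
    (hcont2.self_of_nhds.intervalIntegrable _ _) ?_ ?_ (by simp) ?_
  · exact h.differentiableAt
  · refine Continuous.aestronglyMeasurable ?_
    have : Continuous fun θ : ℝ => fderiv ℂ K (z₀, circleMap c r θ) :=
      hcd.comp_continuous (by fun_prop) fun θ => hz _ (hmem θ)
    have h2 : Continuous fun θ : ℝ => (fderiv ℂ K (z₀, circleMap c r θ)).comp ι :=
      this.clm_comp continuous_const
    simp only [deriv_circleMap]
    fun_prop
  · refine Eventually.of_forall fun θ _ z hz => ?_
    have := hz _ (hmem θ)
    rw [norm_smul, deriv_circleMap]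
    gcongr
    · simp
    · exact (ContinuousLinearMap.opNorm_comp_le _ _).trans
        (mul_le_mul_of_nonneg_right this.2.le (norm_nonneg _))
  · refine Eventually.of_forall fun θ _ z hz => ?_
    have h1 := (hK.differentiableAt (hW.mem_nhds (hz _ (hmem θ)).1)).hasFDerivAt
    have h2 : HasFDerivAt (fun z : E => (z, circleMap c r θ)) ι z := hasFDerivAt_prodMk_left _ _
    exact (h1.comp z h2).const_smul (deriv (circleMap c r) θ)

/-- Cauchy's formula turns the derivative along `v` into a circle integral of `t⁻² F (z + t • v)`,
and such integrals are holomorphic in `z`. -/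
theorem differentiableOn_fderiv_apply {F : E → ℂ} {O : Set E} (hO : IsOpen O)
    (hF : DifferentiableOn ℂ F O) (v : E) : DifferentiableOn ℂ (fun z => fderiv ℂ F z v) O := by
  intro z₀ hz₀
  refine DifferentiableAt.differentiableWithinAt ?_
  set W : Set (E × ℂ) := {p | p.1 + p.2 • v ∈ O ∧ p.2 ≠ 0}
  have hWo : IsOpen {p : E × ℂ | p.1 + p.2 • v ∈ O} := hO.preimage (by fun_prop)
  have hW : IsOpen W := hWo.inter (isOpen_ne_fun continuous_snd continuous_const)
  obtain ⟨r, hr, hrW⟩ : ∃ r > 0, closedBall z₀ r ×ˢ closedBall (0 : ℂ) r ⊆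
      {p : E × ℂ | p.1 + p.2 • v ∈ O} := by
    have : {p : E × ℂ | p.1 + p.2 • v ∈ O} ∈ 𝓝 (z₀, (0 : ℂ)) := hWo.mem_nhds (by simpa using hz₀)
    obtain ⟨r, hr, h⟩ := Metric.nhds_basis_closedBall.mem_iff.1 this
    exact ⟨r, hr, by rwa [closedBall_prod_same]⟩
  have hd : DifferentiableAt ℂ (fun z => ∮ t in C((0 : ℂ), r), (t ^ 2)⁻¹ * F (z + t • v)) z₀ := by
    refine differentiableAt_circleIntegral (K := fun p => (p.2 ^ 2)⁻¹ * F (p.1 + p.2 • v)) hW ?_ ?_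
    · intro p hp
      have h1 : DifferentiableAt ℂ (fun p : E × ℂ => F (p.1 + p.2 • v)) p :=
        (hF.differentiableAt (hO.mem_nhds hp.1)).comp p (by fun_prop)
      have h2 : DifferentiableAt ℂ (fun p : E × ℂ => (p.2 ^ 2)⁻¹) p :=
        DifferentiableAt.inv (by fun_prop) (pow_ne_zero 2 hp.2)
      exact (h2.mul h1).differentiableWithinAt
    · intro t ht
      rw [abs_of_pos hr] at ht
      refine ⟨hrW ⟨mem_closedBall_self hr.le, sphere_subset_closedBall ht⟩, ?_⟩
      exact ne_of_mem_sphere ht hr.ne'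
  have heq : (fun z => fderiv ℂ F z v) =ᶠ[𝓝 z₀]
      fun z => (2 * Real.pi * Complex.I)⁻¹ • ∮ t in C((0 : ℂ), r), (t ^ 2)⁻¹ * F (z + t • v) := by
    filter_upwards [closedBall_mem_nhds z₀ hr] with z hz
    have hmem : ∀ t ∈ closedBall (0 : ℂ) r, z + t • v ∈ O := fun t ht =>
      hrW (show (z, t) ∈ closedBall z₀ r ×ˢ closedBall (0 : ℂ) r from ⟨hz, ht⟩)
    have hdt : ∀ t ∈ closedBall (0 : ℂ) r, DifferentiableAt ℂ (fun t : ℂ => F (z + t • v)) t :=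
      fun t ht => (hF.differentiableAt (hO.mem_nhds (hmem t ht))).comp t (by fun_prop)
    have h1 : HasDerivAt (fun s : ℂ => F (z + s • v)) (fderiv ℂ F z v) 0 := by
      have h0 : z ∈ O := by simpa using hmem 0 (mem_closedBall_self hr.le)
      exact (hF.differentiableAt (hO.mem_nhds h0)).hasFDerivAt.hasLineDerivAt v
    have h2 := Complex.two_pi_I_inv_smul_circleIntegral_sub_sq_inv_smul_of_differentiable
      (U := (fun t : ℂ => z + t • v) ⁻¹' O) (hO.preimage (by fun_prop)) hmem
      (f := fun t => F (z + t • v))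
      (fun t ht => ((hF.differentiableAt (hO.mem_nhds ht)).comp t (by fun_prop)).differentiableWithinAt)
      (mem_ball_self hr)
    rw [h1.deriv] at h2
    rw [← h2]
    simp
  exact (heq.differentiableAt_iff).2 (hd.fun_const_smul _)

theorem contDiff_of_differentiable [FiniteDimensional ℂ E] {F : E → ℂ} (hF : Differentiable ℂ F) :
    ContDiff ℂ (⊤ : ℕ∞) F := by
  rw [contDiff_infty]
  intro n
  induction n generalizing F with
  | zero => exact contDiff_zero.2 hF.continuous
  | succ n ih =>
    rw [Nat.cast_succ, contDiff_succ_iff_fderiv_apply]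
    refine ⟨hF, by simp, fun v => ih ?_⟩
    exact differentiableOn_univ.1 (differentiableOn_fderiv_apply isOpen_univ hF.differentiableOn v)

/-- Cauchy estimates on smaller balls turn the summable bound on the terms into one on their
derivatives. -/
theorem differentiableOn_tsum_of_summable {ι : Type*} {F : ι → E → ℂ} {u : ι → ℝ} {z : E} {r : ℝ}
    (hu : Summable u) (hF : ∀ i, DifferentiableOn ℂ (F i) (ball z r))
    (hb : ∀ i, ∀ y ∈ ball z r, ‖F i y‖ ≤ u i) :
    DifferentiableOn ℂ (fun y => ∑' i, F i y) (ball z r) := by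
  intro x hx
  refine DifferentiableAt.differentiableWithinAt ?_
  obtain ⟨ε, hε, hsub⟩ := Metric.isOpen_iff.1 (isOpen_ball (x := z) (ε := r)) x hx
  have hdiff : ∀ i, ∀ y ∈ ball x (ε / 2), HasFDerivAt (F i) (fderiv ℂ (F i) y) y := by
    intro i y hy
    refine ((hF i).differentiableAt (isOpen_ball.mem_nhds (hsub ?_))).hasFDerivAt
    exact ball_subset_ball (by linarith) hy
  have hbd : ∀ i, ∀ y ∈ ball x (ε / 2), ‖fderiv ℂ (F i) y‖ ≤ u i / (ε / 2) := by
    intro i y hy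
    have hsub2 : ball y (ε / 2) ⊆ ball z r := by
      refine (ball_subset_ball' ?_).trans hsub
      have := mem_ball.1 hy
      linarith
    exact norm_fderiv_le_of_forall_ball (by positivity) ((hF i).mono hsub2)
      (fun w hw => hb i w (hsub2 hw))
  exact (hasFDerivAt_tsum_of_isPreconnected (hu.div_const _) isOpen_ball
    (convex_ball x (ε / 2)).isPreconnected hdiff hbd (mem_ball_self (by positivity))
    (Summable.of_norm_bounded hu fun i => hb i x hx) (mem_ball_self (by positivity))).differentiableAt

end SeveralComplexVariables

/-! ### Removable singularities in several variables, up to meagre sets. -/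

section RiemannExtension

open Metric Set

theorem exists_differentiableOn_extension_of_bounded {U : Set ℂ} (hU : IsOpen U) {φ δ : ℂ → ℂ}
    {M : ℝ} (hδ : ∀ s ∈ U, ∀ᶠ s' in 𝓝[≠] s, δ s' ≠ 0)
    (hφ : ∀ s ∈ U, δ s ≠ 0 → DifferentiableAt ℂ φ s)
    (hM : ∀ s ∈ U, δ s ≠ 0 → ‖φ s‖ ≤ M) :
    ∃ φ' : ℂ → ℂ, DifferentiableOn ℂ φ' U ∧ ∀ s ∈ U, δ s ≠ 0 → φ' s = φ s := by
  have heq : ∀ s ∈ U, δ s ≠ 0 → limUnder (𝓝[≠] s) φ = φ s := fun s hs h =>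
    ((hφ s hs h).continuousAt.tendsto.mono_left nhdsWithin_le_nhds).limUnder_eq
  refine ⟨fun s => limUnder (𝓝[≠] s) φ, fun s hs => ?_, heq⟩
  refine DifferentiableAt.differentiableWithinAt ?_
  have hev : ∀ᶠ s' in 𝓝[≠] s, s' ∈ U ∧ δ s' ≠ 0 :=
    (eventually_nhdsWithin_of_eventually_nhds (hU.mem_nhds hs)).and (hδ s hs)
  obtain ⟨V, hV, hVo, hsV⟩ := _root_.mem_nhds_iff.1 (eventually_nhdsWithin_iff.1 hev)
  have hV' : ∀ s' ∈ V \ {s}, s' ∈ U ∧ δ s' ≠ 0 := fun s' h => hV h.1 h.2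
  have hd := Complex.differentiableOn_update_limUnder_of_bddAbove (f := φ) (hVo.mem_nhds hsV)
    (fun s' h => (hφ s' (hV' s' h).1 (hV' s' h).2).differentiableWithinAt)
    ⟨M, by rintro _ ⟨s', h, rfl⟩; exact hM s' (hV' s' h).1 (hV' s' h).2⟩
  refine (hd.differentiableAt (hVo.mem_nhds hsV)).congr_of_eventuallyEq ?_
  filter_upwards [hVo.mem_nhds hsV] with s' hs'
  rcases eq_or_ne s' s with rfl | hne
  · simp
  · rw [Function.update_of_ne hne]
    exact heq s' (hV' s' ⟨hs', hne⟩).1 (hV' s' ⟨hs', hne⟩).2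

theorem eventually_ne_zero_of_preconnected {U : Set ℂ} (hUo : IsOpen U) (hU : IsPreconnected U)
    {δ : ℂ → ℂ} (hδ : DifferentiableOn ℂ δ U) {s₀ : ℂ} (hs₀ : s₀ ∈ U) (h0 : δ s₀ ≠ 0) :
    ∀ s ∈ U, ∀ᶠ s' in 𝓝[≠] s, δ s' ≠ 0 := by
  intro s hs
  by_contra hcon
  have := (hδ.analyticOnNhd hUo).eqOn_zero_of_preconnected_of_frequently_eq_zero hU hs
    (by simpa only [Filter.Frequently] using hcon)
  exact h0 (this hs₀)

variable {E : Type*} [NormedAddCommGroup E] [NormedSpace ℂ E]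

theorem convex_preimage_line {S : Set E} (hS : Convex ℝ S) (z v : E) :
    Convex ℝ ((fun s : ℂ => z + s • v) ⁻¹' S) := by
  intro a ha b hb p q hp hq hpq
  have := hS ha hb hp hq hpq
  simp only [mem_preimage] at this ⊢
  convert this using 1
  simp only [smul_add, add_smul, smul_assoc]
  rw [add_add_add_comm, ← add_smul, hpq, one_smul]

theorem eqOn_zero_of_convex_of_eventually_eq_zero {F : E → ℂ} {S : Set E} (hSo : IsOpen S)
    (hS : Convex ℝ S) (hF : DifferentiableOn ℂ F S) {z₁ : E} (hz₁ : z₁ ∈ S)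
    (h : ∀ᶠ z in 𝓝 z₁, F z = 0) : ∀ z ∈ S, F z = 0 := by
  intro z hz
  set ℓ : ℂ → E := fun s => z₁ + s • (z - z₁)
  have hℓ : Continuous ℓ := by fun_prop
  have hd : DifferentiableOn ℂ (fun s => F (ℓ s)) (ℓ ⁻¹' S) :=
    hF.comp (by fun_prop) fun _ h => h
  have h0 : ℓ 0 = z₁ := by simp [ℓ]
  have := (hd.analyticOnNhd (hSo.preimage hℓ)).eqOn_zero_of_preconnected_of_eventuallyEq_zero
    (convex_preimage_line hS z₁ (z - z₁)).isPreconnected (z₀ := 0) (by simpa [ℓ] using hz₁) ?_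
  · have h1 := this (x := 1) (by simpa [ℓ] using hz)
    simpa [ℓ] using h1
  · have := hℓ.continuousAt (x := 0)
    rw [ContinuousAt, h0] at this
    exact this.eventually h

/-- On the complex line from `z₀` towards `z₃` the function `Δ` is not identically zero, so a small
circle around `z₀` avoids its zeros, and so do nearby translates of that circle. The Cauchy integral
over the translates is the extension; off the zeros of `Δ`, one-variable removability on the
translated line shows that it recovers `F`. -/
theorem exists_differentiableOn_ball_extension {F Δ : E → ℂ} {z₀ z₃ : E} {r M : ℝ}
    (hΔ : DifferentiableOn ℂ Δ (ball z₀ r)) (hz₃ : z₃ ∈ ball z₀ r) (hΔz₃ : Δ z₃ ≠ 0)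
    (hF : ∀ z ∈ ball z₀ r, Δ z ≠ 0 → DifferentiableAt ℂ F z)
    (hM : ∀ z ∈ ball z₀ r, Δ z ≠ 0 → ‖F z‖ ≤ M) :
    ∃ r' > 0, ∃ F' : E → ℂ, DifferentiableOn ℂ F' (ball z₀ r') ∧
      ∀ z ∈ ball z₀ r', Δ z ≠ 0 → F' z = F z := by
  have hr : 0 < r := (dist_nonneg).trans_lt hz₃
  set e := z₃ - z₀
  have hline : ∀ z : E, Continuous fun s : ℂ => z + s • e := fun z => by fun_prop
  have hdline : ∀ z : E, DifferentiableOn ℂ (fun s : ℂ => Δ (z + s • e))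
      ((fun s : ℂ => z + s • e) ⁻¹' ball z₀ r) := fun z => hΔ.comp (by fun_prop) fun _ h => h
  have hne0 : ∀ᶠ s in 𝓝[≠] (0 : ℂ), Δ (z₀ + s • e) ≠ 0 :=
    eventually_ne_zero_of_preconnected (isOpen_ball.preimage (hline z₀))
      (convex_preimage_line (convex_ball z₀ r) z₀ e).isPreconnected (hdline z₀) (s₀ := 1)
      (by simpa [e] using hz₃) (by simpa [e] using hΔz₃) 0 (by simpa using hr)
  have hopen : IsOpen {p : E × ℂ | p.1 + p.2 • e ∈ ball z₀ r} := isOpen_ball.preimage (by fun_prop)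
  have hWopen : IsOpen {p : E × ℂ | p.1 + p.2 • e ∈ ball z₀ r ∧ Δ (p.1 + p.2 • e) ≠ 0} := by
    have hc : ContinuousOn (fun p : E × ℂ => Δ (p.1 + p.2 • e))
        {p : E × ℂ | p.1 + p.2 • e ∈ ball z₀ r} :=
      hΔ.continuousOn.comp (by fun_prop) fun _ h => h
    exact hc.isOpen_inter_preimage hopen isOpen_ne
  obtain ⟨ε, hε, hε1, hε2⟩ : ∃ ε > 0, closedBall z₀ ε ×ˢ closedBall (0 : ℂ) ε ⊆
      {p : E × ℂ | p.1 + p.2 • e ∈ ball z₀ r} ∧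
      ∀ s ∈ closedBall (0 : ℂ) ε, s ≠ 0 → Δ (z₀ + s • e) ≠ 0 := by
    have h1 : {p : E × ℂ | p.1 + p.2 • e ∈ ball z₀ r} ∈ 𝓝 (z₀, (0 : ℂ)) :=
      hopen.mem_nhds (by simpa using hr)
    obtain ⟨ε₁, hε₁, h1⟩ := Metric.nhds_basis_closedBall.mem_iff.1 h1
    obtain ⟨ε₂, hε₂, h2⟩ := Metric.nhds_basis_closedBall.mem_iff.1 (eventually_nhdsWithin_iff.1 hne0)
    refine ⟨min ε₁ ε₂, lt_min hε₁ hε₂, ?_, fun s hs => h2 (closedBall_subset_closedBall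
      (min_le_right _ _) hs)⟩
    rw [closedBall_prod_same]
    exact (closedBall_subset_closedBall (min_le_left _ _)).trans h1
  have hsph : ∀ᶠ z in 𝓝 z₀, ∀ s ∈ sphere (0 : ℂ) ε,
      z + s • e ∈ ball z₀ r ∧ Δ (z + s • e) ≠ 0 := by
    refine (isCompact_sphere (0 : ℂ) ε).eventually_forall_of_forall_eventually fun s hs => ?_
    refine hWopen.mem_nhds ⟨?_, ?_⟩
    · exact hε1 (show (z₀, s) ∈ closedBall z₀ ε ×ˢ closedBall (0 : ℂ) ε from
        ⟨mem_closedBall_self hε.le, sphere_subset_closedBall hs⟩)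
    · exact hε2 s (sphere_subset_closedBall hs) (ne_of_mem_sphere hs hε.ne')
  obtain ⟨r', hr', hsub⟩ := Metric.mem_nhds_iff.1 (inter_mem hsph (closedBall_mem_nhds z₀ hε))
  refine ⟨r', hr', fun z => (2 * Real.pi * Complex.I)⁻¹ •
    ∮ s in C((0 : ℂ), ε), s⁻¹ * F (z + s • e), ?_, ?_⟩
  · intro z hz
    refine (DifferentiableAt.fun_const_smul ?_ _).differentiableWithinAt
    refine differentiableAt_circleIntegral (K := fun p => p.2⁻¹ * F (p.1 + p.2 • e))
      (hWopen.inter (isOpen_ne_fun (f := fun p : E × ℂ => p.2) (g := fun _ => 0) continuous_snd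
        continuous_const)) ?_ ?_
    · rintro p ⟨hp, hp2⟩
      have h1 : DifferentiableAt ℂ (fun p : E × ℂ => F (p.1 + p.2 • e)) p :=
        (hF _ hp.1 hp.2).comp p (by fun_prop)
      exact ((DifferentiableAt.inv (by fun_prop) hp2).mul h1).differentiableWithinAt
    · intro s hs
      rw [abs_of_pos hε] at hs
      exact ⟨(hsub hz).1 s hs, ne_of_mem_sphere hs hε.ne'⟩
  · intro z hz hΔz
    have hmem : closedBall (0 : ℂ) ε ⊆ (fun s : ℂ => z + s • e) ⁻¹' ball z₀ r := fun s hs =>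
      hε1 (show (z, s) ∈ closedBall z₀ ε ×ˢ closedBall (0 : ℂ) ε from ⟨(hsub hz).2, hs⟩)
    have h0mem : (0 : ℂ) ∈ closedBall (0 : ℂ) ε := mem_closedBall_self hε.le
    obtain ⟨φ, hφd, hφ⟩ := exists_differentiableOn_extension_of_bounded
      (isOpen_ball.preimage (hline z)) (φ := fun s => F (z + s • e)) (M := M)
      (eventually_ne_zero_of_preconnected (isOpen_ball.preimage (hline z))
        (convex_preimage_line (convex_ball z₀ r) z e).isPreconnected (hdline z)
        (hmem h0mem) (by simpa using hΔz))
      (fun s hs h => (hF _ hs h).comp s (by fun_prop)) (fun s hs h => hM _ hs h)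
    have hC := (hφd.mono hmem).circleIntegral_sub_inv_smul (mem_ball_self hε)
    have h0 : φ 0 = F z := by simpa using hφ 0 (hmem h0mem) (by simpa using hΔz)
    have hcongr : (∮ s in C((0 : ℂ), ε), s⁻¹ * F (z + s • e)) =
        ∮ s in C((0 : ℂ), ε), (s - 0)⁻¹ • φ s := by
      refine circleIntegral.integral_congr hε.le fun s hs => ?_
      simp only [sub_zero, smul_eq_mul]
      rw [hφ s (hmem (sphere_subset_closedBall hs)) ((hsub hz).1 s hs).2]
    simp only [hcongr, hC, h0]
    rw [smul_smul, inv_mul_cancel₀ Complex.two_pi_I_ne_zero, one_smul]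

/-- Near `z₀`, the function `F` agrees outside of a meagre set with a holomorphic function. -/
def HolomorphicResiduallyAt (F : E → ℂ) (z₀ : E) : Prop :=
  ∃ r > 0, ∃ F' : E → ℂ, DifferentiableOn ℂ F' (ball z₀ r) ∧
    ∀ᶠ z in residual E, z ∈ ball z₀ r → F' z = F z

/-- By the identity theorem the zero set has empty interior; the smaller radius makes it closed in
the whole space. -/
theorem eventually_residual_ne_zero {Δ : E → ℂ} {z₀ z₃ : E} {r r' : ℝ} (hr' : r' < r)
    (hΔ : DifferentiableOn ℂ Δ (ball z₀ r)) (hz₃ : z₃ ∈ ball z₀ r) (hΔz₃ : Δ z₃ ≠ 0) :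
    ∀ᶠ z in residual E, z ∈ ball z₀ r' → Δ z ≠ 0 := by
  set A : Set E := {z ∈ closedBall z₀ r' | Δ z = 0}
  have hsub : closedBall z₀ r' ⊆ ball z₀ r := closedBall_subset_ball hr'
  have hA : IsClosed A :=
    (hΔ.continuousOn.mono hsub).preimage_isClosed_of_isClosed isClosed_closedBall isClosed_singleton
  have hint : interior A = ∅ := by
    by_contra hne
    obtain ⟨z, hz⟩ := nonempty_iff_ne_empty.2 hne
    refine hΔz₃ (eqOn_zero_of_convex_of_eventually_eq_zero isOpen_ball (convex_ball z₀ r) hΔ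
      (hsub (interior_subset hz).1) ?_ z₃ hz₃)
    filter_upwards [mem_interior_iff_mem_nhds.1 hz] with y hy using hy.2
  have hmem : Aᶜ ∈ residual E :=
    residual_of_dense_open hA.isOpen_compl (interior_eq_empty_iff_dense_compl.1 hint)
  filter_upwards [hmem] with z hz hzb h
  exact hz ⟨ball_subset_closedBall hzb, h⟩

theorem holomorphicResiduallyAt_of_bounded {F Δ : E → ℂ} {z₀ z₃ : E} {r M : ℝ}
    (hΔ : DifferentiableOn ℂ Δ (ball z₀ r)) (hz₃ : z₃ ∈ ball z₀ r) (hΔz₃ : Δ z₃ ≠ 0)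
    (hF : ∀ z ∈ ball z₀ r, Δ z ≠ 0 → DifferentiableAt ℂ F z)
    (hM : ∀ z ∈ ball z₀ r, Δ z ≠ 0 → ‖F z‖ ≤ M) : HolomorphicResiduallyAt F z₀ := by
  have hr : 0 < r := (dist_nonneg).trans_lt hz₃
  obtain ⟨r', hr', F', hd, h⟩ := exists_differentiableOn_ball_extension hΔ hz₃ hΔz₃ hF hM
  refine ⟨min r' (r / 2), by positivity, F', hd.mono (ball_subset_ball (min_le_left _ _)), ?_⟩
  filter_upwards [eventually_residual_ne_zero (r' := r / 2) (by linarith) hΔ hz₃ hΔz₃] with z hz hzb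
  exact h z (ball_subset_ball (min_le_left _ _) hzb)
    (hz (ball_subset_ball (min_le_right _ _) hzb))

theorem eqOn_of_residual {X : Type*} [TopologicalSpace X] [BaireSpace X] {F G : X → ℂ} {O : Set X} (hO : IsOpen O)
    (hF : ContinuousOn F O) (hG : ContinuousOn G O)
    (h : ∀ᶠ z in residual X, z ∈ O → F z = G z) : ∀ z ∈ O, F z = G z := by
  have hd : Dense {z | z ∈ O → F z = G z} := dense_of_mem_residual h
  have hd2 : O ⊆ closure (O ∩ {z | z ∈ O → F z = G z}) := hd.open_subset_closure_inter hO
  intro z hz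
  by_contra hne
  have hop : IsOpen (O ∩ (fun z => F z - G z) ⁻¹' {0}ᶜ) :=
    (hF.sub hG).isOpen_inter_preimage hO isOpen_compl_singleton
  obtain ⟨y, hy, hy2⟩ := mem_closure_iff.1 (hd2 hz) _ hop ⟨hz, by simpa [sub_eq_zero] using hne⟩
  exact hy.2 (by simpa [sub_eq_zero] using hy2.2 hy2.1)

/-- Local extensions agree on overlaps, being continuous and equal on a residual, hence dense, set.
A countable subcover keeps the exceptional set meagre. -/
theorem exists_differentiableOn_of_holomorphicResiduallyAt [CompleteSpace E]
    [SecondCountableTopology E] {F : E → ℂ} {O : Set E} (hO : IsOpen O)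
    (h : ∀ z ∈ O, HolomorphicResiduallyAt F z) :
    ∃ F' : E → ℂ, DifferentiableOn ℂ F' O ∧ ∀ᶠ z in residual E, z ∈ O → F' z = F z := by
  choose! r hr G hG hGF using h
  have hagree : ∀ x ∈ O, ∀ y ∈ O, ∀ z ∈ ball x (r x) ∩ ball y (r y), G x z = G y z := by
    intro x hx y hy
    refine eqOn_of_residual (isOpen_ball.inter isOpen_ball)
      ((hG x hx).continuousOn.mono inter_subset_left)
      ((hG y hy).continuousOn.mono inter_subset_right) ?_
    filter_upwards [hGF x hx, hGF y hy] with z h1 h2 hz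
    rw [h1 hz.1, h2 hz.2]
  refine ⟨fun z => G z z, fun z hz => ?_, ?_⟩
  · refine (((hG z hz).differentiableAt (isOpen_ball.mem_nhds
      (mem_ball_self (hr z hz)))).congr_of_eventuallyEq ?_).differentiableWithinAt
    filter_upwards [isOpen_ball.mem_nhds (mem_ball_self (hr z hz)), hO.mem_nhds hz] with y hy hyO
    exact hagree y hyO z hz y ⟨mem_ball_self (hr y hyO), hy⟩
  · obtain ⟨t, htO, htc, ht⟩ := TopologicalSpace.countable_cover_nhdsWithin
      (s := O) (f := fun z => ball z (r z))
      (fun z hz => mem_nhdsWithin_of_mem_nhds (ball_mem_nhds z (hr z hz)))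
    have := (eventually_countable_ball htc).2 fun z hz => hGF z (htO hz)
    filter_upwards [this] with z hz hzO
    obtain ⟨x, hx, hzx⟩ := mem_iUnion₂.1 (ht hzO)
    rw [← hz x hx hzx]
    exact hagree z hzO x (htO hx) z ⟨mem_ball_self (hr z hzO), hzx⟩

end RiemannExtension

/-! ### The argument principle and its dependence on parameters. -/

section ZeroCounting

open Metric Set

theorem exists_ball_subset_of_closedBall_subset {c : ℂ} {r : ℝ} (hr : 0 < r) {U : Set ℂ}
    (hU : IsOpen U) (h : closedBall c r ⊆ U) : ∃ R > r, ball c R ⊆ U := by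
  obtain ⟨δ, hδ, hsub⟩ := (isCompact_closedBall c r).exists_thickening_subset_open hU h
  refine ⟨r + δ, by linarith, ?_⟩
  rwa [thickening_closedBall hδ hr.le, add_comm] at hsub

theorem eventually_ne_zero_of_closedBall {f : ℂ → ℂ} {c : ℂ} {r : ℝ} (hr : 0 < r) {U : Set ℂ}
    (hU : IsOpen U) (hsub : closedBall c r ⊆ U) (hf : DifferentiableOn ℂ f U)
    (hne : ∀ x ∈ sphere c r, f x ≠ 0) : ∀ x ∈ closedBall c r, ∀ᶠ y in 𝓝[≠] x, f y ≠ 0 := by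
  obtain ⟨R, hR, hRU⟩ := exists_ball_subset_of_closedBall_subset hr hU hsub
  obtain ⟨x₀, hx₀⟩ : (sphere c r).Nonempty := NormedSpace.sphere_nonempty.2 hr.le
  intro x hx
  exact eventually_ne_zero_of_preconnected isOpen_ball (convex_ball c R).isPreconnected
    (hf.mono hRU) (closedBall_subset_ball hR (sphere_subset_closedBall hx₀)) (hne x₀ hx₀) x
    (closedBall_subset_ball hR hx)

theorem finite_zeros_of_isCompact {f : ℂ → ℂ} {K : Set ℂ} (hK : IsCompact K)
    (h : ∀ x ∈ K, ∀ᶠ y in 𝓝[≠] x, f y ≠ 0) : {x ∈ K | f x = 0}.Finite := by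
  choose! N hN hNf using fun x hx => mem_nhdsWithin_iff_exists_mem_nhds_inter.1 (h x hx)
  obtain ⟨t, ht, htK⟩ := hK.elim_nhds_subcover N hN
  refine t.finite_toSet.subset fun x hx => ?_
  obtain ⟨y, hy, hxy⟩ := mem_iUnion₂.1 (htK hx.1)
  by_contra hne
  have hxy' : x ≠ y := fun h => hne (h ▸ hy)
  exact hNf y (ht y hy) ⟨hxy, hxy'⟩ hx.2

/-- `analyticOrderNatAt` is also `0` where the order is infinite; the isolation hypothesis excludes
this case. -/
theorem analyticOrderNatAt_eq_zero_iff {f : ℂ → ℂ} {x : ℂ} (hf : AnalyticAt ℂ f x)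
    (h : ∀ᶠ y in 𝓝[≠] x, f y ≠ 0) : analyticOrderNatAt f x = 0 ↔ f x ≠ 0 := by
  have htop : analyticOrderAt f x ≠ ⊤ := fun htop => by
    have := (eventually_nhdsWithin_of_eventually_nhds (s := {x}ᶜ)
      (analyticOrderAt_eq_top.1 htop)).and h
    obtain ⟨y, h1, h2⟩ := this.exists
    exact h2 h1
  rw [← hf.analyticOrderAt_eq_zero, ← Nat.cast_analyticOrderNatAt htop]
  simp

theorem two_le_analyticOrderNatAt_iff {f : ℂ → ℂ} {x : ℂ} (hf : AnalyticAt ℂ f x)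
    (h : ∀ᶠ y in 𝓝[≠] x, f y ≠ 0) :
    2 ≤ analyticOrderNatAt f x ↔ f x = 0 ∧ deriv f x = 0 := by
  have htop : analyticOrderAt f x ≠ ⊤ := fun htop => by
    have := (eventually_nhdsWithin_of_eventually_nhds (s := {x}ᶜ)
      (analyticOrderAt_eq_top.1 htop)).and h
    obtain ⟨y, h1, h2⟩ := this.exists
    exact h2 h1
  have h2 := natCast_le_analyticOrderAt_iff_iteratedDeriv_eq_zero (n := 2) hf
  rw [← Nat.cast_analyticOrderNatAt htop, Nat.cast_le] at h2
  rw [h2]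
  constructor
  · intro h
    exact ⟨by simpa using h 0 (by norm_num), by simpa [iteratedDeriv_one] using h 1 (by norm_num)⟩
  · rintro ⟨h0, h1⟩ i hi
    interval_cases i
    · simpa using h0
    · simpa [iteratedDeriv_one] using h1

/-- The sum of `x ^ k` over the zeros `x` of `f` in the disc, with multiplicities. -/
noncomputable def zeroMoment (f : ℂ → ℂ) (c : ℂ) (r : ℝ) (k : ℕ) : ℂ :=
  (2 * Real.pi * Complex.I)⁻¹ * ∮ x in C(c, r), x ^ k * (deriv f x / f x)

/-- Induction on the number of zeros with multiplicity: division by `x - a`, through `dslope`,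
removes one zero and splits `f' / f` into `1 / (x - a) + h' / h`, whose first summand contributes `a
^ k` by Cauchy's formula. -/
theorem zeroMoment_eq_sum {c : ℂ} {r : ℝ} (hr : 0 < r) {U : Set ℂ}
    (hU : IsOpen U) (hsub : closedBall c r ⊆ U) (k : ℕ) (N : ℕ) :
    ∀ (f : ℂ → ℂ) (Z : Finset ℂ), DifferentiableOn ℂ f U → (∀ x ∈ sphere c r, f x ≠ 0) →
    (∀ x, x ∈ Z ↔ x ∈ ball c r ∧ f x = 0) → ∑ x ∈ Z, analyticOrderNatAt f x = N →
    zeroMoment f c r k = ∑ x ∈ Z, (analyticOrderNatAt f x : ℂ) * x ^ k := by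
  have hanal : ∀ f : ℂ → ℂ, DifferentiableOn ℂ f U → ∀ x ∈ closedBall c r, AnalyticAt ℂ f x :=
    fun f hf x hx => hf.analyticAt (hU.mem_nhds (hsub hx))
  have hord : ∀ f : ℂ → ℂ, DifferentiableOn ℂ f U → (∀ x ∈ sphere c r, f x ≠ 0) →
      ∀ x ∈ closedBall c r, (analyticOrderNatAt f x = 0 ↔ f x ≠ 0) := fun f hf hne x hx =>
    analyticOrderNatAt_eq_zero_iff (hanal f hf x hx)
      (eventually_ne_zero_of_closedBall hr hU hsub hf hne x hx)
  have hci : ∀ f : ℂ → ℂ, DifferentiableOn ℂ f U → (∀ x ∈ sphere c r, f x ≠ 0) →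
      ContinuousOn (fun x => x ^ k * (deriv f x / f x)) (sphere c r) := by
    intro f hf hne
    have h1 : ContinuousOn (deriv f) (sphere c r) := fun x hx =>
      (hanal f hf x (sphere_subset_closedBall hx)).deriv.continuousAt.continuousWithinAt
    have h2 : ContinuousOn f (sphere c r) :=
      hf.continuousOn.mono (sphere_subset_closedBall.trans hsub)
    exact (by fun_prop : ContinuousOn (fun x : ℂ => x ^ k) (sphere c r)).mul (h1.div h2 hne)
  induction N with
  | zero =>
    intro f Z hf hne hZ hN
    have hZe : Z = ∅ := by
      rw [Finset.eq_empty_iff_forall_notMem]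
      intro x hx
      have h1 := (Finset.sum_eq_zero_iff.1 hN) x hx
      have h2 := (hZ x).1 hx
      exact (hord f hf hne x (ball_subset_closedBall h2.1)).1 h1 h2.2
    have hne' : ∀ x ∈ closedBall c r, f x ≠ 0 := by
      intro x hx h0
      rcases eq_or_lt_of_le (mem_closedBall.1 hx) with h | h
      · exact hne x h h0
      · have : x ∈ Z := (hZ x).2 ⟨h, h0⟩
        simp [hZe] at this
    have hd : DifferentiableOn ℂ (fun x => x ^ k * (deriv f x / f x)) (closedBall c r) := by
      intro x hx
      have h1 := (hanal f hf x hx)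
      exact ((by fun_prop : DifferentiableAt ℂ (fun x : ℂ => x ^ k) x).mul
        (h1.deriv.differentiableAt.div h1.differentiableAt (hne' x hx))).differentiableWithinAt
    rw [zeroMoment, (hd.diffContOnCl_ball le_rfl).circleIntegral_eq_zero hr.le, hZe]
    simp
  | succ N ih =>
    intro f Z hf hne hZ hN
    obtain ⟨a, haZ⟩ : Z.Nonempty := by
      rw [Finset.nonempty_iff_ne_empty]
      rintro rfl
      simp at hN
    obtain ⟨ha, hfa⟩ := (hZ a).1 haZ
    have hfac : ∀ x, f x = (x - a) * dslope f a x := fun x => by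
      have := sub_smul_dslope f a x
      rw [hfa, sub_zero, smul_eq_mul] at this
      exact this.symm
    set h := dslope f a
    have haU : U ∈ 𝓝 a := hU.mem_nhds (hsub (ball_subset_closedBall ha))
    have hhd : DifferentiableOn ℂ h U := (Complex.differentiableOn_dslope haU).2 hf
    have hhne : ∀ x ∈ sphere c r, h x ≠ 0 := fun x hx h0 => hne x hx (by rw [hfac, h0, mul_zero])
    have hxa : ∀ x ∈ sphere c r, x - a ≠ 0 := fun x hx h0 => hne x hx (by rw [hfac, h0, zero_mul])
    have hordf : ∀ x ∈ closedBall c r, analyticOrderNatAt f x =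
        analyticOrderNatAt h x + if x = a then 1 else 0 := by
      intro x hx
      have hfe : f = (fun y => y - a) * h := funext hfac
      have hta : ∀ᶠ y in 𝓝[≠] x, h y ≠ 0 :=
        eventually_ne_zero_of_closedBall hr hU hsub hhd hhne x hx
      have h1 : analyticOrderAt h x ≠ ⊤ := fun htop => by
        obtain ⟨y, h1, h2⟩ := ((eventually_nhdsWithin_of_eventually_nhds (s := {x}ᶜ)
          (analyticOrderAt_eq_top.1 htop)).and hta).exists
        exact h2 h1
      have h2 : analyticOrderAt (fun y => y - a) x = (if x = a then 1 else 0 : ℕ) := by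
        split_ifs with hxa
        · subst hxa
          refine (AnalyticAt.analyticOrderAt_eq_natCast (by fun_prop)).2
            ⟨fun _ => 1, by fun_prop, one_ne_zero, ?_⟩
          simp
        · rw [Nat.cast_zero, AnalyticAt.analyticOrderAt_eq_zero (by fun_prop)]
          exact sub_ne_zero.2 hxa
      rw [analyticOrderNatAt, hfe, analyticOrderAt_mul (by fun_prop) (hanal h hhd x hx), h2,
        ← Nat.cast_analyticOrderNatAt h1, ← Nat.cast_add, ENat.toNat_natCast, add_comm]
    have hsubZ : ∀ x ∈ Z, x ∈ closedBall c r := fun x hx => ball_subset_closedBall ((hZ x).1 hx).1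
    classical
    set Z' : Finset ℂ := Z.filter fun x => h x = 0
    have hZ' : ∀ x, x ∈ Z' ↔ x ∈ ball c r ∧ h x = 0 := by
      intro x
      simp only [Z', Finset.mem_filter, hZ]
      refine ⟨fun hx => ⟨hx.1.1, hx.2⟩, fun hx => ⟨⟨hx.1, ?_⟩, hx.2⟩⟩
      rw [hfac, hx.2, mul_zero]
    have hzero : ∀ x ∈ Z, x ∉ Z' → analyticOrderNatAt h x = 0 := by
      intro x hx hx'
      refine (hord h hhd hhne x (hsubZ x hx)).2 fun h0 => hx' ?_
      exact Finset.mem_filter.2 ⟨hx, h0⟩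
    have hsum : ∑ x ∈ Z', analyticOrderNatAt h x = N := by
      rw [Finset.sum_subset (Finset.filter_subset _ _) hzero]
      rw [Finset.sum_congr rfl fun x hx => hordf x (hsubZ x hx), Finset.sum_add_distrib] at hN
      simpa [haZ] using hN
    have hres := ih h Z' hhd hhne hZ' hsum
    have hRHS : ∑ x ∈ Z, (analyticOrderNatAt f x : ℂ) * x ^ k =
        a ^ k + ∑ x ∈ Z', (analyticOrderNatAt h x : ℂ) * x ^ k := by
      rw [Finset.sum_subset (Finset.filter_subset _ _)
        (fun x hx hx' => by rw [hzero x hx hx']; simp),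
        Finset.sum_congr rfl fun x hx => by rw [hordf x (hsubZ x hx)]]
      simp only [Nat.cast_add, add_mul, Finset.sum_add_distrib]
      simp [haZ, add_comm]
    rw [hRHS, ← hres, zeroMoment, zeroMoment]
    have hcongr : (∮ x in C(c, r), x ^ k * (deriv f x / f x)) =
        ∮ x in C(c, r), ((x - a)⁻¹ • x ^ k + x ^ k * (deriv h x / h x)) := by
      refine circleIntegral.integral_congr hr.le fun x hx => ?_
      have hd : HasDerivAt f (1 * h x + (x - a) * deriv h x) x := by
        have h1 := ((hasDerivAt_id x).sub_const a).mul
          (hanal h hhd x (sphere_subset_closedBall hx)).differentiableAt.hasDerivAt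
        exact h1.congr_of_eventuallyEq (Eventually.of_forall hfac)
      simp only [hd.deriv, hfac x, smul_eq_mul]
      have h1 := hxa x hx
      have h2 := hhne x hx
      field_simp
    have hC := (DifferentiableOn.circleIntegral_sub_inv_smul (f := fun x : ℂ => x ^ k) (c := c)
      (R := r) (by fun_prop) ha)
    rw [hcongr, circleIntegral.integral_add, hC, mul_add, smul_eq_mul, ← mul_assoc,
      inv_mul_cancel₀ Complex.two_pi_I_ne_zero, one_mul]
    · refine ContinuousOn.circleIntegrable hr.le ?_
      exact ContinuousOn.smul (ContinuousOn.inv₀ (by fun_prop) hxa) (by fun_prop)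
    · exact (hci h hhd hhne).circleIntegrable hr.le

variable {E : Type*} [NormedAddCommGroup E] [NormedSpace ℂ E]

theorem hasDerivAt_slice {φ : E × ℂ → ℂ} {z : E} {x : ℂ} (h : DifferentiableAt ℂ φ (z, x)) :
    HasDerivAt (fun y => φ (z, y)) (fderiv ℂ φ (z, x) (0, 1)) x := by
  have h2 : HasDerivAt (fun y : ℂ => (z, y)) ((0, 1) : E × ℂ) x :=
    (hasDerivAt_const x z).prodMk (hasDerivAt_id x)
  exact h.hasFDerivAt.comp_hasDerivAt x h2

theorem eventually_disc {φ : E × ℂ → ℂ} {W : Set (E × ℂ)} (hW : IsOpen W)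
    (hφ : DifferentiableOn ℂ φ W) {z₀ : E} {c : ℂ} {r : ℝ}
    (hsub : ∀ x ∈ closedBall c r, (z₀, x) ∈ W) (hne : ∀ x ∈ sphere c r, φ (z₀, x) ≠ 0) :
    ∀ᶠ z in 𝓝 z₀, (∀ x ∈ closedBall c r, (z, x) ∈ W) ∧ ∀ x ∈ sphere c r, φ (z, x) ≠ 0 := by
  refine Eventually.and ?_ ?_
  · exact (isCompact_closedBall c r).eventually_forall_of_forall_eventually fun x hx =>
      hW.mem_nhds (hsub x hx)
  · refine (isCompact_sphere c r).eventually_forall_of_forall_eventually fun x hx => ?_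
    exact (hφ.continuousOn.continuousAt (hW.mem_nhds (hsub x
      (sphere_subset_closedBall hx)))).eventually_ne (hne x hx)

theorem differentiableAt_zeroMoment {φ : E × ℂ → ℂ} {W : Set (E × ℂ)} (hW : IsOpen W)
    (hφ : DifferentiableOn ℂ φ W) {z₀ : E} {c : ℂ} {r : ℝ} (hr : 0 < r)
    (hsub : ∀ x ∈ closedBall c r, (z₀, x) ∈ W) (hne : ∀ x ∈ sphere c r, φ (z₀, x) ≠ 0) (k : ℕ) :
    DifferentiableAt ℂ (fun z => zeroMoment (fun x => φ (z, x)) c r k) z₀ := by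
  have hev := eventually_disc hW hφ hsub hne
  have hW' : IsOpen (W ∩ φ ⁻¹' {0}ᶜ) := hφ.continuousOn.isOpen_inter_preimage hW isOpen_compl_singleton
  have hd : DifferentiableAt ℂ (fun z => ∮ x in C(c, r),
      x ^ k * (fderiv ℂ φ (z, x) (0, 1) / φ (z, x))) z₀ := by
    refine differentiableAt_circleIntegral
      (K := fun p => p.2 ^ k * (fderiv ℂ φ p (0, 1) / φ p)) hW' ?_ ?_
    · rintro p ⟨hp, hp2⟩
      have h1 := (differentiableOn_fderiv_apply hW hφ (0, 1)).differentiableAt (hW.mem_nhds hp)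
      have h2 := hφ.differentiableAt (hW.mem_nhds hp)
      exact ((by fun_prop : DifferentiableAt ℂ (fun p : E × ℂ => p.2 ^ k) p).mul
        (by simp only [div_eq_mul_inv]; exact h1.mul (h2.inv hp2) : DifferentiableAt ℂ
          (fun p => fderiv ℂ φ p (0, 1) / φ p) p)).differentiableWithinAt
    · intro x hx
      rw [abs_of_pos hr] at hx
      exact ⟨hsub x (sphere_subset_closedBall hx), hne x hx⟩
  refine (hd.const_mul (2 * Real.pi * Complex.I)⁻¹).congr_of_eventuallyEq ?_
  filter_upwards [hev] with z hz
  rw [zeroMoment]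
  congr 1
  refine circleIntegral.integral_congr hr.le fun x hx => ?_
  rw [(hasDerivAt_slice (hφ.differentiableAt (hW.mem_nhds
    (hz.1 x (sphere_subset_closedBall hx))))).deriv]

theorem exists_zeros_finset {f : ℂ → ℂ} {c : ℂ} {r : ℝ} (hr : 0 < r) {U : Set ℂ}
    (hU : IsOpen U) (hsub : closedBall c r ⊆ U) (hf : DifferentiableOn ℂ f U)
    (hne : ∀ x ∈ sphere c r, f x ≠ 0) :
    ∃ Z : Finset ℂ, (∀ x, x ∈ Z ↔ x ∈ ball c r ∧ f x = 0) ∧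
      (∀ x ∈ Z, 1 ≤ analyticOrderNatAt f x) ∧
      ∀ k, zeroMoment f c r k = ∑ x ∈ Z, (analyticOrderNatAt f x : ℂ) * x ^ k := by
  have hfin : {x | x ∈ ball c r ∧ f x = 0}.Finite :=
    (finite_zeros_of_isCompact (isCompact_closedBall c r)
      (eventually_ne_zero_of_closedBall hr hU hsub hf hne)).subset
      fun x hx => ⟨ball_subset_closedBall hx.1, hx.2⟩
  refine ⟨hfin.toFinset, by simp, fun x hx => ?_, fun k =>
    zeroMoment_eq_sum hr hU hsub k _ f _ hf hne (by simp) rfl⟩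
  replace hx : x ∈ ball c r ∧ f x = 0 := by simpa using hx
  have hx' := ball_subset_closedBall hx.1
  rw [Nat.one_le_iff_ne_zero, Ne, analyticOrderNatAt_eq_zero_iff (hf.analyticAt (hU.mem_nhds
    (hsub hx'))) (eventually_ne_zero_of_closedBall hr hU hsub hf hne x hx')]
  exact not_not.2 hx.2

/-- A zeroth moment is a natural number and depends continuously on `z`. -/
theorem eventually_zeroMoment_zero_eq {φ : E × ℂ → ℂ} {W : Set (E × ℂ)} (hW : IsOpen W)
    (hφ : DifferentiableOn ℂ φ W) {z₀ : E} {c : ℂ} {r : ℝ} (hr : 0 < r)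
    (hsub : ∀ x ∈ closedBall c r, (z₀, x) ∈ W) (hne : ∀ x ∈ sphere c r, φ (z₀, x) ≠ 0) :
    ∀ᶠ z in 𝓝 z₀, zeroMoment (fun x => φ (z, x)) c r 0 =
      zeroMoment (fun x => φ (z₀, x)) c r 0 := by
  have hnat : ∀ z, (∀ x ∈ closedBall c r, (z, x) ∈ W) ∧ (∀ x ∈ sphere c r, φ (z, x) ≠ 0) →
      ∃ n : ℕ, zeroMoment (fun x => φ (z, x)) c r 0 = n := by
    rintro z ⟨h1, h2⟩
    obtain ⟨Z, -, -, hZ⟩ := exists_zeros_finset (f := fun x => φ (z, x)) hr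
      (hW.preimage (by fun_prop : Continuous fun x : ℂ => (z, x))) h1
      (hφ.comp (by fun_prop) fun _ h => h) h2
    exact ⟨∑ x ∈ Z, analyticOrderNatAt (fun x => φ (z, x)) x, by simp [hZ 0]⟩
  obtain ⟨n, hn⟩ := hnat z₀ ⟨hsub, hne⟩
  have hc := (differentiableAt_zeroMoment hW hφ hr hsub hne 0).continuousAt
  have h1 : ∀ᶠ z in 𝓝 z₀, ‖zeroMoment (fun x => φ (z, x)) c r 0 -
      zeroMoment (fun x => φ (z₀, x)) c r 0‖ < 1 := by
    have := (hc.sub (continuousAt_const (y := zeroMoment (fun x => φ (z₀, x)) c r 0))).norm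
    refine this.eventually_lt continuousAt_const (by simp)
  filter_upwards [h1, eventually_disc hW hφ hsub hne] with z h1 h2
  obtain ⟨m, hm⟩ := hnat z h2
  rw [hm, hn] at h1 ⊢
  have h3 : ‖((m - n : ℤ) : ℂ)‖ < 1 := by push_cast; exact h1
  rw [Complex.norm_intCast] at h3
  have h4 : |(m - n : ℤ)| < 1 := by exact_mod_cast h3
  have : (m : ℤ) = n := by rw [Int.abs_lt_one_iff] at h4; omega
  exact_mod_cast this

end ZeroCounting

/-! ### Hankel determinants of power sums as detectors of the number of distinct zeros. -/

section Hankel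

/-- The Hankel matrix factors through the functions on `Z`, so its rank is at most `Z.card`. -/
theorem hankel_det_eq_zero {d : ℕ} (Z : Finset ℂ) (m : ℂ → ℂ) (h : Z.card < d) :
    (Matrix.of fun i j : Fin d => ∑ y ∈ Z, m y * y ^ (i + j : ℕ)).det = 0 := by
  by_contra hne
  set M := Matrix.of fun i j : Fin d => ∑ y ∈ Z, m y * y ^ (i + j : ℕ)
  have hM : M = (Matrix.of fun (i : Fin d) (y : Z) => (y : ℂ) ^ (i : ℕ)) *
      (Matrix.of fun (y : Z) (j : Fin d) => m y * (y : ℂ) ^ (j : ℕ)) := by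
    ext i j
    simp only [M, Matrix.of_apply, Matrix.mul_apply]
    rw [← Finset.sum_coe_sort]
    refine Finset.sum_congr rfl fun y _ => ?_
    ring
  have h1 : M.rank = d := by
    rw [Matrix.rank_of_isUnit M ((Matrix.isUnit_iff_isUnit_det _).2 (isUnit_iff_ne_zero.2 hne))]
    simp
  have h2 : M.rank ≤ Z.card := by
    rw [hM]
    refine (Matrix.rank_mul_le_left _ _).trans ((Matrix.rank_le_card_width _).trans ?_)
    simp
  omega

/-- With exactly `d` nodes the matrix is `Vᵀ diag(m) V` for an invertible Vandermonde matrix `V`. -/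
theorem hankel_det_ne_zero {d : ℕ} (Z : Finset ℂ) (m : ℂ → ℂ) (h : Z.card = d)
    (hm : ∀ y ∈ Z, m y ≠ 0) :
    (Matrix.of fun i j : Fin d => ∑ y ∈ Z, m y * y ^ (i + j : ℕ)).det ≠ 0 := by
  set e : Fin d ≃ Z := (Finset.equivFinOfCardEq h).symm
  set v : Fin d → ℂ := fun l => (e l : ℂ)
  have hM : (Matrix.of fun i j : Fin d => ∑ y ∈ Z, m y * y ^ (i + j : ℕ)) =
      (Matrix.vandermonde v)ᵀ * (Matrix.diagonal (fun l => m (v l)) * Matrix.vandermonde v) := by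
    ext i j
    rw [Matrix.mul_apply]
    simp only [Matrix.of_apply, Matrix.transpose_apply, Matrix.vandermonde_apply,
      Matrix.diagonal_mul]
    rw [← Finset.sum_coe_sort, ← e.sum_comp]
    refine Finset.sum_congr rfl fun l _ => ?_
    simp only [v]
    ring
  rw [hM, Matrix.det_mul, Matrix.det_mul, Matrix.det_transpose, Matrix.det_diagonal]
  have hv : Function.Injective v := Subtype.val_injective.comp e.injective
  have h1 := Matrix.det_vandermonde_ne_zero_iff.2 hv
  refine mul_ne_zero h1 (mul_ne_zero (Finset.prod_ne_zero_iff.2 fun l _ => hm _ (e l).2) h1)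

end Hankel

/-! ### Zeros of a slice moving with a parameter. -/

section Clusters

open Metric Set

variable {E : Type*} [NormedAddCommGroup E] [NormedSpace ℂ E]

/-- The zeros of `φ (z, ·)` in the closure of `A` are isolated and lie in `A`. -/
structure IsolatedZeros (φ : E × ℂ → ℂ) (W : Set (E × ℂ)) (A : Set ℂ) (z : E) : Prop where
  mem : ∀ x ∈ closure A, (z, x) ∈ W
  ne_zero : ∀ x ∈ closure A, φ (z, x) = 0 → x ∈ A
  isolated : ∀ x ∈ closure A, ∀ᶠ y in 𝓝[≠] x, φ (z, y) ≠ 0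

variable {φ : E × ℂ → ℂ} {W : Set (E × ℂ)} {A : Set ℂ} {z₀ : E}

/-- The finitely many zeros over `z₀` are put in disjoint discs; compactness of the bounding circles
and of the region outside the discs keeps both free of zeros for nearby `z`. -/
theorem IsolatedZeros.exists_discs (hW : IsOpen W) (hφ : DifferentiableOn ℂ φ W) (hA : IsOpen A)
    (hAc : IsCompact (closure A)) (h : IsolatedZeros φ W A z₀) :
    ∃ (X : Finset ℂ) (ρ : ℝ), 0 < ρ ∧ (∀ x, x ∈ X ↔ x ∈ A ∧ φ (z₀, x) = 0) ∧
      (∀ x ∈ X, closedBall x ρ ⊆ A) ∧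
      (∀ x ∈ X, ∀ y ∈ X, ∀ w, w ∈ ball x ρ → w ∈ ball y ρ → x = y) ∧
      (∀ x ∈ X, ∀ y ∈ closedBall x ρ, φ (z₀, y) = 0 → y = x) ∧
      ∀ᶠ z in 𝓝 z₀, (∀ x ∈ closure A, (z, x) ∈ W) ∧
        (∀ x ∈ X, ∀ y ∈ sphere x ρ, φ (z, y) ≠ 0) ∧
        ∀ y ∈ closure A, φ (z, y) = 0 → ∃ x ∈ X, y ∈ ball x ρ := by
  have hfin : {x | x ∈ A ∧ φ (z₀, x) = 0}.Finite :=
    (finite_zeros_of_isCompact hAc h.isolated).subset fun x hx => ⟨subset_closure hx.1, hx.2⟩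
  set X := hfin.toFinset
  have hX : ∀ x, x ∈ X ↔ x ∈ A ∧ φ (z₀, x) = 0 := fun x => by simp [X]
  have hsmall : ∀ᶠ ρ in 𝓝[>] (0 : ℝ), ∀ x ∈ X, closedBall x ρ ⊆ A ∧
      (∀ y ∈ closedBall x ρ, φ (z₀, y) = 0 → y = x) ∧ ∀ y ∈ X, y ≠ x → ρ < dist x y / 2 := by
    refine (Finset.eventually_all X).2 fun x hx => ?_
    have hxA := ((hX x).1 hx).1
    have h1 : ∀ᶠ y in 𝓝 x, y ∈ A ∧ (φ (z₀, y) = 0 → y = x) := by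
      refine Eventually.and (hA.mem_nhds hxA) ?_
      filter_upwards [eventually_nhdsWithin_iff.1 (h.isolated x (subset_closure hxA))] with y hy h0
      by_contra hne
      exact hy hne h0
    obtain ⟨ε, hε, hε'⟩ := Metric.eventually_nhds_iff_ball.1 h1
    have h2 : ∀ᶠ ρ in 𝓝[>] (0 : ℝ), ∀ y ∈ X, y ≠ x → ρ < dist x y / 2 := by
      refine (Finset.eventually_all X).2 fun y hy => ?_
      rcases eq_or_ne y x with rfl | hne
      · simp
      · have : 0 < dist x y / 2 := by have := dist_pos.2 hne.symm; positivity
        filter_upwards [eventually_nhdsWithin_of_eventually_nhds (eventually_lt_nhds this)]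
          with ρ hρ _ using hρ
    filter_upwards [h2, eventually_nhdsWithin_of_eventually_nhds (eventually_lt_nhds hε)] with ρ h2 h3
    have hb : closedBall x ρ ⊆ ball x ε := closedBall_subset_ball h3
    exact ⟨fun y hy => (hε' y (hb hy)).1, fun y hy => (hε' y (hb hy)).2, h2⟩
  obtain ⟨ρ, hρ, hρ0⟩ := (hsmall.and self_mem_nhdsWithin).exists
  have hρ0 : 0 < ρ := hρ0
  have hcont : ∀ x ∈ closure A, ContinuousAt φ (z₀, x) := fun x hx =>
    hφ.continuousOn.continuousAt (hW.mem_nhds (h.mem x hx))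
  refine ⟨X, ρ, hρ0, hX, fun x hx => (hρ x hx).1, ?_, fun x hx => (hρ x hx).2.1, ?_⟩
  · intro x hx y hy w hwx hwy
    by_contra hne
    have h1 := (hρ x hx).2.2 y hy (Ne.symm hne)
    have h2 := dist_triangle_left x y w
    rw [mem_ball] at hwx hwy
    linarith
  · refine Eventually.and ?_ (Eventually.and ?_ ?_)
    · exact hAc.eventually_forall_of_forall_eventually fun x hx => hW.mem_nhds (h.mem x hx)
    · refine (Finset.eventually_all X).2 fun x hx => ?_
      refine (isCompact_sphere x ρ).eventually_forall_of_forall_eventually fun y hy => ?_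
      have hyc := sphere_subset_closedBall hy
      refine (hcont y (subset_closure ((hρ x hx).1 hyc))).eventually_ne fun h0 => ?_
      exact ne_of_mem_sphere hy hρ0.ne' ((hρ x hx).2.1 y hyc h0)
    · have hK : IsCompact (closure A \ ⋃ x ∈ X, ball x ρ) :=
        hAc.diff (isOpen_biUnion fun x _ => isOpen_ball)
      have : ∀ᶠ z in 𝓝 z₀, ∀ y ∈ closure A \ ⋃ x ∈ X, ball x ρ, φ (z, y) ≠ 0 := by
        refine hK.eventually_forall_of_forall_eventually fun y hy => ?_
        refine (hcont y hy.1).eventually_ne fun h0 => hy.2 ?_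
        exact mem_iUnion₂.2 ⟨y, (hX y).2 ⟨h.ne_zero y hy.1 h0, h0⟩, mem_ball_self hρ0⟩
      filter_upwards [this] with z hz y hy h0
      by_contra hcon
      refine hz y ⟨hy, fun hmem => hcon ?_⟩ h0
      simpa using mem_iUnion₂.1 hmem

theorem exists_slice_zeros {z : E} {x : ℂ} {ρ : ℝ} (hρ : 0 < ρ) (hW : IsOpen W)
    (hφ : DifferentiableOn ℂ φ W) (hsub : ∀ y ∈ closedBall x ρ, (z, y) ∈ W)
    (hne : ∀ y ∈ sphere x ρ, φ (z, y) ≠ 0) :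
    ∃ Z : Finset ℂ, (∀ y, y ∈ Z ↔ y ∈ ball x ρ ∧ φ (z, y) = 0) ∧
      (∀ y ∈ Z, 1 ≤ analyticOrderNatAt (fun y => φ (z, y)) y) ∧
      ∀ k, zeroMoment (fun y => φ (z, y)) x ρ k =
        ∑ y ∈ Z, (analyticOrderNatAt (fun y => φ (z, y)) y : ℂ) * y ^ k :=
  exists_zeros_finset (f := fun y => φ (z, y)) hρ
    (hW.preimage (by fun_prop : Continuous fun y : ℂ => (z, y))) hsub
    (hφ.comp (by fun_prop) fun _ h => h) hne

theorem IsolatedZeros.eventually (hW : IsOpen W) (hφ : DifferentiableOn ℂ φ W) (hA : IsOpen A)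
    (hAc : IsCompact (closure A)) (h : IsolatedZeros φ W A z₀) :
    ∀ᶠ z in 𝓝 z₀, IsolatedZeros φ W A z := by
  obtain ⟨X, ρ, hρ, hX, hXA, -, -, hev⟩ := h.exists_discs hW hφ hA hAc
  filter_upwards [hev] with z ⟨h1, h2, h3⟩
  refine ⟨h1, fun y hy h0 => ?_, fun y hy => ?_⟩
  · obtain ⟨x, hx, hyx⟩ := h3 y hy h0
    exact hXA x hx (ball_subset_closedBall hyx)
  · have hc : ContinuousAt (fun y => φ (z, y)) y :=
      (hφ.continuousOn.continuousAt (hW.mem_nhds (h1 y hy))).comp (by fun_prop)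
    rcases eq_or_ne (φ (z, y)) 0 with h0 | h0
    · obtain ⟨x, hx, hyx⟩ := h3 y hy h0
      exact eventually_ne_zero_of_closedBall (f := fun y => φ (z, y)) hρ
        (hW.preimage (by fun_prop : Continuous fun y : ℂ => (z, y)))
        (fun w hw => h1 w (subset_closure (hXA x hx hw)))
        (hφ.comp (by fun_prop) fun _ h => h) (h2 x hx) y (ball_subset_closedBall hyx)
    · exact eventually_nhdsWithin_of_eventually_nhds (hc.eventually_ne h0)

/-- `P k` adds the moments over the discs. Power sums of all zeros are holomorphic in `z` although
single zeros may branch, and `P 0` counts zeros with multiplicity. -/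
theorem IsolatedZeros.exists_moments (hW : IsOpen W) (hφ : DifferentiableOn ℂ φ W) (hA : IsOpen A)
    (hAc : IsCompact (closure A)) (h : IsolatedZeros φ W A z₀) :
    ∃ P : ℕ → E → ℂ, ∀ᶠ z in 𝓝 z₀, (∀ k, DifferentiableAt ℂ (P k) z) ∧ P 0 z = P 0 z₀ ∧
      ∃ Z : Finset ℂ, (∀ y, y ∈ Z ↔ y ∈ A ∧ φ (z, y) = 0) ∧
        (∀ y ∈ Z, 1 ≤ analyticOrderNatAt (fun y => φ (z, y)) y) ∧
        ∀ k, P k z = ∑ y ∈ Z, (analyticOrderNatAt (fun y => φ (z, y)) y : ℂ) * y ^ k := by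
  classical
  obtain ⟨X, ρ, hρ, hX, hXA, hdisj, hiso, hev⟩ := h.exists_discs hW hφ hA hAc
  refine ⟨fun k z => ∑ x ∈ X, zeroMoment (fun y => φ (z, y)) x ρ k, ?_⟩
  have hconst : ∀ᶠ z in 𝓝 z₀, ∀ x ∈ X, zeroMoment (fun y => φ (z, y)) x ρ 0 =
      zeroMoment (fun y => φ (z₀, y)) x ρ 0 := by
    refine (Finset.eventually_all X).2 fun x hx => ?_
    refine eventually_zeroMoment_zero_eq hW hφ hρ
      (fun y hy => h.mem y (subset_closure (hXA x hx hy))) fun y hy h0 => ?_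
    exact ne_of_mem_sphere hy hρ.ne' (hiso x hx y (sphere_subset_closedBall hy) h0)
  filter_upwards [hev, hconst] with z ⟨h1, h2, h3⟩ h4
  have hsub : ∀ x ∈ X, ∀ y ∈ closedBall x ρ, (z, y) ∈ W := fun x hx y hy =>
    h1 y (subset_closure (hXA x hx hy))
  refine ⟨fun k => DifferentiableAt.fun_sum fun x hx =>
    differentiableAt_zeroMoment hW hφ hρ (hsub x hx) (h2 x hx) k, Finset.sum_congr rfl h4, ?_⟩
  choose! Z hZ hZ1 hZm using fun x hx => exists_slice_zeros hρ hW hφ (hsub x hx) (h2 x hx)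
  refine ⟨X.biUnion Z, fun y => ?_, fun y hy => ?_, fun k => ?_⟩
  · simp only [Finset.mem_biUnion]
    constructor
    · rintro ⟨x, hx, hy⟩
      have := (hZ x hx y).1 hy
      exact ⟨hXA x hx (ball_subset_closedBall this.1), this.2⟩
    · rintro ⟨hy, h0⟩
      obtain ⟨x, hx, hyx⟩ := h3 y (subset_closure hy) h0
      exact ⟨x, hx, (hZ x hx y).2 ⟨hyx, h0⟩⟩
  · obtain ⟨x, hx, hyx⟩ := Finset.mem_biUnion.1 hy
    exact hZ1 x hx y hyx
  · rw [Finset.sum_biUnion]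
    · exact Finset.sum_congr rfl fun x hx => hZm x hx k
    · intro x hx x' hx' hne
      rw [Function.onFun, Finset.disjoint_left]
      intro y hy hy'
      exact hne (hdisj x hx x' hx' y ((hZ x hx y).1 hy).1 ((hZ x' hx' y).1 hy').1)

/-- The sum of `κ` over the multiple zeros of `φ (z, ·)` in `A`. -/
noncomputable def multipleZeroSum (φ : E × ℂ → ℂ) (A : Set ℂ) (κ : ℂ → ℂ) (z : E) : ℂ :=
  ∑ᶠ y ∈ {y | y ∈ A ∧ φ (z, y) = 0 ∧ deriv (fun y => φ (z, y)) y = 0}, κ y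

theorem IsolatedZeros.multipleZeroSum_eq {z : E} (hW : IsOpen W) (hφ : DifferentiableOn ℂ φ W)
    (h : IsolatedZeros φ W A z) (κ : ℂ → ℂ) {Z : Finset ℂ}
    (hZ : ∀ y, y ∈ Z ↔ y ∈ A ∧ φ (z, y) = 0) :
    multipleZeroSum φ A κ z =
      ∑ y ∈ Z with 2 ≤ analyticOrderNatAt (fun y => φ (z, y)) y, κ y := by
  have hset : {y | y ∈ A ∧ φ (z, y) = 0 ∧ deriv (fun y => φ (z, y)) y = 0} =
      ↑(Z.filter fun y => 2 ≤ analyticOrderNatAt (fun y => φ (z, y)) y) := by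
    ext y
    simp only [mem_ofPred_eq, Finset.coe_filter, hZ]
    refine ⟨fun hy => ?_, fun hy => ?_⟩
    · have han : AnalyticAt ℂ (fun y => φ (z, y)) y := by
        have hO := hW.preimage (by fun_prop : Continuous fun y : ℂ => (z, y))
        exact DifferentiableOn.analyticAt (s := (fun y : ℂ => (z, y)) ⁻¹' W)
          (hφ.comp (by fun_prop) fun _ h => h) (hO.mem_nhds (h.mem y (subset_closure hy.1)))
      exact ⟨⟨hy.1, hy.2.1⟩, (two_le_analyticOrderNatAt_iff han
        (h.isolated y (subset_closure hy.1))).2 hy.2⟩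
    · have han : AnalyticAt ℂ (fun y => φ (z, y)) y := by
        have hO := hW.preimage (by fun_prop : Continuous fun y : ℂ => (z, y))
        exact DifferentiableOn.analyticAt (s := (fun y : ℂ => (z, y)) ⁻¹' W)
          (hφ.comp (by fun_prop) fun _ h => h) (hO.mem_nhds (h.mem y (subset_closure hy.1.1)))
      exact ⟨hy.1.1, (two_le_analyticOrderNatAt_iff han
        (h.isolated y (subset_closure hy.1.1))).1 hy.2⟩
  rw [multipleZeroSum, hset, finsum_mem_coe_finset]

/-- Every disc around a zero over `z₀` keeps at least one zero, so by `hcard` it keeps exactly one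
and no zero splits. That zero has constant multiplicity `N` and equals the first moment of its disc
divided by `N`, hence moves holomorphically. -/
theorem IsolatedZeros.differentiableAt_multipleZeroSum (hW : IsOpen W)
    (hφ : DifferentiableOn ℂ φ W) (hA : IsOpen A) (hAc : IsCompact (closure A))
    (h : IsolatedZeros φ W A z₀) {κ : ℂ → ℂ}
    (hκ : ∀ y ∈ A, φ (z₀, y) = 0 → DifferentiableAt ℂ κ y) {Z₀ : Finset ℂ}
    (hZ₀ : ∀ y, y ∈ Z₀ ↔ y ∈ A ∧ φ (z₀, y) = 0)
    (hcard : ∀ᶠ z in 𝓝 z₀, ∀ Z : Finset ℂ, (∀ y, y ∈ Z ↔ y ∈ A ∧ φ (z, y) = 0) →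
      Z.card ≤ Z₀.card) :
    DifferentiableAt ℂ (multipleZeroSum φ A κ) z₀ := by
  classical
  obtain ⟨X, ρ, hρ, hX, hXA, hdisj, hiso, hev⟩ := h.exists_discs hW hφ hA hAc
  obtain rfl : Z₀ = X := Finset.ext fun y => (hZ₀ y).trans (hX y).symm
  have hsub₀ : ∀ x ∈ Z₀, ∀ y ∈ closedBall x ρ, (z₀, y) ∈ W := fun x hx y hy =>
    h.mem y (subset_closure (hXA x hx hy))
  have hne₀ : ∀ x ∈ Z₀, ∀ y ∈ sphere x ρ, φ (z₀, y) ≠ 0 := fun x hx y hy h0 =>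
    ne_of_mem_sphere hy hρ.ne' (hiso x hx y (sphere_subset_closedBall hy) h0)
  set N : ℂ → ℕ := fun x => analyticOrderNatAt (fun y => φ (z₀, y)) x
  set p : ℕ → ℂ → E → ℂ := fun k x z => zeroMoment (fun y => φ (z, y)) x ρ k
  have hcenter : ∀ x ∈ Z₀, 1 ≤ N x ∧ ∀ k, p k x z₀ = N x * x ^ k := by
    intro x hx
    obtain ⟨Y, hY, hY1, hYm⟩ := exists_slice_zeros hρ hW hφ (hsub₀ x hx) (hne₀ x hx)
    have : Y = {x} := by
      ext y
      rw [hY, Finset.mem_singleton]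
      refine ⟨fun hy => hiso x hx y (ball_subset_closedBall hy.1) hy.2, ?_⟩
      rintro rfl
      exact ⟨mem_ball_self hρ, ((hX y).1 hx).2⟩
    subst this
    exact ⟨hY1 x (by simp), fun k => by simpa using hYm k⟩
  have hconst : ∀ᶠ z in 𝓝 z₀, ∀ x ∈ Z₀, p 0 x z = p 0 x z₀ :=
    (Finset.eventually_all Z₀).2 fun x hx =>
      eventually_zeroMoment_zero_eq hW hφ hρ (hsub₀ x hx) (hne₀ x hx)
  have hdiff : DifferentiableAt ℂ (fun z => ∑ x ∈ Z₀ with 2 ≤ N x, κ (p 1 x z / N x)) z₀ := by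
    refine DifferentiableAt.fun_sum fun x hx => ?_
    have hx := (Finset.mem_filter.1 hx).1
    have hNx : (N x : ℂ) ≠ 0 := by
      have := (hcenter x hx).1
      exact_mod_cast (by omega : N x ≠ 0)
    have hval : p 1 x z₀ / N x = x := by
      rw [(hcenter x hx).2 1]
      field_simp
    have h1 : DifferentiableAt ℂ (fun z => p 1 x z / N x) z₀ := by
      simp only [div_eq_mul_inv]
      exact (differentiableAt_zeroMoment hW hφ hρ (hsub₀ x hx) (hne₀ x hx) 1).mul_const _
    refine DifferentiableAt.comp z₀ ?_ h1
    rw [hval]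
    exact hκ x ((hX x).1 hx).1 ((hX x).1 hx).2
  refine hdiff.congr_of_eventuallyEq ?_
  filter_upwards [hev, hconst, hcard, h.eventually hW hφ hA hAc] with z ⟨h1, h2, h3⟩ h4 h5 h6
  have hsub : ∀ x ∈ Z₀, ∀ y ∈ closedBall x ρ, (z, y) ∈ W := fun x hx y hy =>
    h1 y (subset_closure (hXA x hx hy))
  choose! Y hY hY1 hYm using fun x hx => exists_slice_zeros hρ hW hφ (hsub x hx) (h2 x hx)
  have hexists : ∀ x ∈ Z₀, ∃ y, y ∈ Y x := by
    intro x hx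
    by_contra hcon
    have hemp : Y x = ∅ := Finset.eq_empty_iff_forall_notMem.2 fun y hy => hcon ⟨y, hy⟩
    have h7 := h4 x hx
    have h8 := hYm x hx 0
    rw [hemp, Finset.sum_empty] at h8
    have h9 := (hcenter x hx).2 0
    have h10 : (N x : ℂ) = 0 := by
      rw [pow_zero, mul_one] at h9
      rw [← h9, ← h7]
      exact h8
    have := (hcenter x hx).1
    exact absurd (Nat.cast_eq_zero.1 h10) (by omega)
  choose! η hη using hexists
  set Z := Z₀.image η
  have hηinj : Set.InjOn η Z₀ := by
    intro x hx x' hx' heq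
    refine hdisj x hx x' hx' (η x) ((hY x hx _).1 (hη x hx)).1 ?_
    rw [heq]
    exact ((hY x' hx' _).1 (hη x' hx')).1
  have hfull : ∀ y, y ∈ Z ↔ y ∈ A ∧ φ (z, y) = 0 := by
    have hfin : {y | y ∈ A ∧ φ (z, y) = 0}.Finite :=
      (finite_zeros_of_isCompact hAc h6.isolated).subset fun x hx => ⟨subset_closure hx.1, hx.2⟩
    have hsubZ : Z ⊆ hfin.toFinset := by
      intro y hy
      obtain ⟨x, hx, rfl⟩ := Finset.mem_image.1 hy
      have := (hY x hx _).1 (hη x hx)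
      simpa using ⟨hXA x hx (ball_subset_closedBall this.1), this.2⟩
    have hle := h5 hfin.toFinset (by simp)
    have hcardZ : Z.card = Z₀.card := Finset.card_image_of_injOn hηinj
    have heq : Z = hfin.toFinset := Finset.eq_of_subset_of_card_le hsubZ (by omega)
    intro y
    rw [heq]
    simp
  have hYsing : ∀ x ∈ Z₀, Y x = {η x} := by
    intro x hx
    ext y
    rw [Finset.mem_singleton]
    refine ⟨fun hy => ?_, fun hy => hy ▸ hη x hx⟩
    have hy' := (hY x hx y).1 hy
    have hyZ : y ∈ Z := (hfull y).2 ⟨hXA x hx (ball_subset_closedBall hy'.1), hy'.2⟩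
    obtain ⟨x', hx', rfl⟩ := Finset.mem_image.1 hyZ
    rw [hdisj x' hx' x hx (η x') ((hY x' hx' _).1 (hη x' hx')).1 hy'.1]
  have hord : ∀ x ∈ Z₀, analyticOrderNatAt (fun y => φ (z, y)) (η x) = N x := by
    intro x hx
    have h7 := h4 x hx
    have h8 := hYm x hx 0
    have h9 := (hcenter x hx).2 0
    rw [hYsing x hx, Finset.sum_singleton] at h8
    rw [pow_zero, mul_one] at h8 h9
    have : (analyticOrderNatAt (fun y => φ (z, y)) (η x) : ℂ) = N x := by
      rw [← h8, ← h9]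
      exact h7
    exact_mod_cast this
  have hval : ∀ x ∈ Z₀, p 1 x z / N x = η x := by
    intro x hx
    have h8 := hYm x hx 1
    rw [hYsing x hx, Finset.sum_singleton, hord x hx, pow_one] at h8
    have hNx : (N x : ℂ) ≠ 0 := by
      have := (hcenter x hx).1
      exact_mod_cast (by omega : N x ≠ 0)
    rw [show p 1 x z = N x * η x from h8]
    field_simp
  rw [h6.multipleZeroSum_eq hW hφ κ hfull]
  have hfilter : (Z.filter fun y => 2 ≤ analyticOrderNatAt (fun y => φ (z, y)) y) =
      (Z₀.filter fun x => 2 ≤ N x).image η := by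
    ext y
    simp only [Finset.mem_filter, Z, Finset.mem_image]
    constructor
    · rintro ⟨⟨x, hx, rfl⟩, h2⟩
      exact ⟨x, ⟨hx, hord x hx ▸ h2⟩, rfl⟩
    · rintro ⟨x, ⟨hx, h2⟩, rfl⟩
      exact ⟨⟨x, hx, rfl⟩, (hord x hx).symm ▸ h2⟩
  rw [hfilter, Finset.sum_image (hηinj.mono fun x hx => (Finset.mem_filter.1 hx).1)]
  exact Finset.sum_congr rfl fun x hx => by rw [hval x (Finset.mem_filter.1 hx).1]

end Clusters

/-! ### The Koebe function summed over the multiple zeros in a bounded region. -/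

section Block

open Metric Set

variable {E : Type*} [NormedAddCommGroup E] [NormedSpace ℂ E]

/-- The Koebe function with its pole at `1`. -/
noncomputable def koebe (q : ℂ) : ℂ := q / (1 - q) ^ 2

theorem differentiableAt_koebe {q : ℂ} (hq : q ≠ 1) : DifferentiableAt ℂ koebe q := by
  have : (1 - q) ^ 2 ≠ 0 := pow_ne_zero 2 (sub_ne_zero.2 hq.symm)
  unfold koebe
  fun_prop (disch := exact this)

/-- The mean value inequality along the segment from `a` to `b`, used for `deriv f` and then for
`f`. -/
theorem norm_le_of_double_zero {f : ℂ → ℂ} {S : Set ℂ} (hS : Convex ℝ S) (hSo : IsOpen S)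
    (hf : DifferentiableOn ℂ f S) {M : ℝ} (hM : ∀ x ∈ S, ‖deriv (deriv f) x‖ ≤ M) {a b : ℂ}
    (ha : a ∈ S) (hb : b ∈ S) (h0 : f a = 0) (h1 : deriv f a = 0) :
    ‖f b‖ ≤ M * ‖b - a‖ ^ 2 := by
  have hM0 : 0 ≤ M := (norm_nonneg _).trans (hM a ha)
  have hfd : ∀ x ∈ S, DifferentiableAt ℂ f x := fun x hx => hf.differentiableAt (hSo.mem_nhds hx)
  have hfd2 : ∀ x ∈ S, DifferentiableAt ℂ (deriv f) x := fun x hx =>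
    (hf.analyticAt (hSo.mem_nhds hx)).deriv.differentiableAt
  have hseg : segment ℝ a b ⊆ S := hS.segment_subset ha hb
  have h2 : ∀ x ∈ segment ℝ a b, ‖deriv f x‖ ≤ M * ‖b - a‖ := by
    intro x hx
    have := hS.norm_image_sub_le_of_norm_deriv_le hfd2 hM ha (hseg hx)
    rw [h1, sub_zero] at this
    refine this.trans (mul_le_mul_of_nonneg_left ?_ hM0)
    have h3 := norm_sub_le_of_mem_segment hx
    simpa [norm_sub_rev] using h3
  have := (convex_segment a b).norm_image_sub_le_of_norm_deriv_le (𝕜 := ℂ) (f := f)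
    (fun x hx => hfd x (hseg hx)) h2 (left_mem_segment ℝ a b) (right_mem_segment ℝ a b)
  rw [h0, sub_zero] at this
  rw [pow_two, ← mul_assoc]
  exact this

variable {φ : E × ℂ → ℂ} {z₀ : E}

/-- A multiple zero at `y` near `1` makes `φ (z, 1)` of size `|1 - y|²`, which cancels the double
pole of `koebe` at `1`. -/
theorem exists_bound_near_one (hφ : DifferentiableOn ℂ φ {p | p.2 ≠ 0}) :
    ∃ M, ∀ᶠ p in 𝓝 (z₀, (1 : ℂ)), φ p = 0 → deriv (fun y => φ (p.1, y)) p.2 = 0 →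
      ‖φ (p.1, 1) * koebe p.2‖ ≤ M := by
  have hW : IsOpen {p : E × ℂ | p.2 ≠ 0} := isOpen_ne_fun continuous_snd continuous_const
  have h1 := differentiableOn_fderiv_apply hW hφ (0, 1)
  have h2 := differentiableOn_fderiv_apply hW h1 (0, 1)
  set D2 : E × ℂ → ℂ := fun p => fderiv ℂ (fun p => fderiv ℂ φ p (0, 1)) p (0, 1)
  have hmem : (z₀, (1 : ℂ)) ∈ {p : E × ℂ | p.2 ≠ 0} := one_ne_zero
  have hc : ContinuousAt D2 (z₀, 1) := h2.continuousOn.continuousAt (hW.mem_nhds hmem)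
  set M := ‖D2 (z₀, 1)‖ + 1
  have hM : 0 < M := by positivity
  have hev : ∀ᶠ p in 𝓝 (z₀, (1 : ℂ)), p.2 ≠ 0 ∧ ‖D2 p‖ < M ∧ ‖p.2‖ < 2 := by
    refine Eventually.and (hW.mem_nhds hmem) (Eventually.and ?_ ?_)
    · exact hc.norm.eventually_lt continuousAt_const (by simp [M])
    · exact (continuous_snd.norm.continuousAt).eventually_lt continuousAt_const (by simp)
  obtain ⟨ε, hε, hball⟩ := Metric.eventually_nhds_iff_ball.1 hev
  refine ⟨M * 2, Metric.eventually_nhds_iff_ball.2 ⟨ε, hε, fun p hp h0 hd => ?_⟩⟩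
  rw [← ball_prod_same] at hp hball
  have hin : ∀ x ∈ ball (1 : ℂ) ε, (p.1, x) ∈ ball z₀ ε ×ˢ ball (1 : ℂ) ε := fun x hx => ⟨hp.1, hx⟩
  have hder : ∀ x ∈ ball (1 : ℂ) ε, deriv (fun y => φ (p.1, y)) x = fderiv ℂ φ (p.1, x) (0, 1) :=
    fun x hx => (hasDerivAt_slice (hφ.differentiableAt (hW.mem_nhds (hball _ (hin x hx)).1))).deriv
  have hder2 : ∀ x ∈ ball (1 : ℂ) ε, deriv (deriv fun y => φ (p.1, y)) x = D2 (p.1, x) := by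
    intro x hx
    have : (deriv fun y => φ (p.1, y)) =ᶠ[𝓝 x] fun x => fderiv ℂ φ (p.1, x) (0, 1) := by
      filter_upwards [isOpen_ball.mem_nhds hx] with y hy using hder y hy
    rw [this.deriv_eq]
    exact (hasDerivAt_slice (h1.differentiableAt (hW.mem_nhds (hball _ (hin x hx)).1))).deriv
  have hdiff : DifferentiableOn ℂ (fun y => φ (p.1, y)) (ball 1 ε) := fun x hx =>
    (hasDerivAt_slice (hφ.differentiableAt (hW.mem_nhds
      (hball _ (hin x hx)).1))).differentiableAt.differentiableWithinAt
  have hest := norm_le_of_double_zero (convex_ball (1 : ℂ) ε) isOpen_ball hdiff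
    (fun x hx => by rw [hder2 x hx]; exact (hball _ (hin x hx)).2.1.le) hp.2 (mem_ball_self hε)
    h0 hd
  have hp2 := (hball p hp).2.2
  rcases eq_or_ne p.2 1 with heq | hne
  -- At the pole itself `koebe` takes the default value `0` of division by zero.
  · simp only [koebe, heq, sub_self]
    simp [hM.le]
  · have hpos : 0 < ‖1 - p.2‖ := norm_pos_iff.2 (sub_ne_zero.2 hne.symm)
    rw [koebe, norm_mul, norm_div, norm_pow, mul_div_assoc', div_le_iff₀ (by positivity)]
    calc _ ≤ M * ‖1 - p.2‖ ^ 2 * 2 := mul_le_mul hest hp2.le (norm_nonneg _) (by positivity)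
      _ = _ := by ring

theorem exists_bound_multiple_zero {A : Set ℂ} (hφ : DifferentiableOn ℂ φ {p | p.2 ≠ 0})
    (hAc : IsCompact (closure A)) :
    ∃ M, ∀ᶠ z in 𝓝 z₀, ∀ y ∈ closure A, φ (z, y) = 0 → deriv (fun y => φ (z, y)) y = 0 →
      ‖φ (z, 1) * koebe y‖ ≤ M := by
  refine hAc.induction_on (p := fun S => ∃ M, ∀ᶠ z in 𝓝 z₀, ∀ y ∈ S, φ (z, y) = 0 →
    deriv (fun y => φ (z, y)) y = 0 → ‖φ (z, 1) * koebe y‖ ≤ M) ⟨0, by simp⟩ ?_ ?_ ?_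
  · rintro s t hst ⟨M, hM⟩
    exact ⟨M, hM.mono fun z hz y hy => hz y (hst hy)⟩
  · rintro s t ⟨M, hM⟩ ⟨M', hM'⟩
    refine ⟨max M M', ?_⟩
    filter_upwards [hM, hM'] with z h1 h2 y hy h3 h4
    rcases hy with hy | hy
    · exact (h1 y hy h3 h4).trans (le_max_left _ _)
    · exact (h2 y hy h3 h4).trans (le_max_right _ _)
  · intro x _
    have key : ∃ M, ∀ᶠ p in 𝓝 (z₀, x), φ p = 0 → deriv (fun y => φ (p.1, y)) p.2 = 0 →
        ‖φ (p.1, 1) * koebe p.2‖ ≤ M := by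
      rcases eq_or_ne x 1 with rfl | hne
      · exact exists_bound_near_one hφ
      · have hW : IsOpen {p : E × ℂ | p.2 ≠ 0} := isOpen_ne_fun continuous_snd continuous_const
        have h1 : ContinuousAt (fun p : E × ℂ => φ (p.1, 1)) (z₀, x) :=
          ContinuousAt.comp (g := φ) (f := fun p : E × ℂ => (p.1, (1 : ℂ)))
            (hφ.continuousOn.continuousAt (hW.mem_nhds one_ne_zero)) (by fun_prop)
        have h2 : ContinuousAt (fun p : E × ℂ => koebe p.2) (z₀, x) :=
          ContinuousAt.comp (g := koebe) (f := fun p : E × ℂ => p.2)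
            (differentiableAt_koebe hne).continuousAt continuousAt_snd
        refine ⟨‖φ (z₀, 1) * koebe x‖ + 1, ?_⟩
        filter_upwards [(h1.mul h2).norm.eventually_lt continuousAt_const (lt_add_one _)] with p hp _ _
        exact hp.le
    obtain ⟨M, hM⟩ := key
    rw [nhds_prod_eq, eventually_prod_iff] at hM
    obtain ⟨p, hp, q, hq, hpq⟩ := hM
    refine ⟨{y | q y}, mem_nhdsWithin_of_mem_nhds hq, M, ?_⟩
    filter_upwards [hp] with z hz y hy
    exact hpq hz hy

/-- Boundedness comes from `exists_bound_multiple_zero` and the bounded number of zeros. For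
holomorphy, let `d` be the largest number of distinct zeros over a ball around `z₀`. The Hankel
determinant `H` of the moments is holomorphic, and where it is nonzero there are exactly `d` zeros,
none of which can split. The factor `φ (z, 1)` in `Δ` also keeps the zeros off the pole of `koebe`.
-/
theorem holomorphicResiduallyAt_mul_multipleZeroSum {A : Set ℂ}
    (hφ : DifferentiableOn ℂ φ {p | p.2 ≠ 0}) (hA : IsOpen A) (hAc : IsCompact (closure A))
    (hd : Dense {z | φ (z, 1) ≠ 0}) (h : IsolatedZeros φ {p | p.2 ≠ 0} A z₀) :
    HolomorphicResiduallyAt (fun z => φ (z, 1) * multipleZeroSum φ A koebe z) z₀ := by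
  classical
  have hW : IsOpen {p : E × ℂ | p.2 ≠ 0} := isOpen_ne_fun continuous_snd continuous_const
  obtain ⟨P, hP⟩ := h.exists_moments hW hφ hA hAc
  obtain ⟨M, hM⟩ := exists_bound_multiple_zero (z₀ := z₀) hφ hAc
  obtain ⟨r, hr, hball⟩ := Metric.eventually_nhds_iff_ball.1
    ((hP.and hM).and (h.eventually hW hφ hA hAc))
  choose! Z hZ hZ1 hZm using fun z hz => (hball z hz).1.1.2.2
  obtain ⟨n, hn⟩ : ∃ n : ℕ, P 0 z₀ = n := by
    refine ⟨∑ y ∈ Z z₀, analyticOrderNatAt (fun y => φ (z₀, y)) y, ?_⟩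
    simpa using hZm z₀ (mem_ball_self hr) 0
  have hcardn : ∀ z ∈ ball z₀ r, (Z z).card ≤ n := by
    intro z hz
    have h1 := hZm z hz 0
    rw [(hball z hz).1.1.2.1, hn] at h1
    have h2 : n = ∑ y ∈ Z z, analyticOrderNatAt (fun y => φ (z, y)) y := by
      have : (n : ℂ) = ((∑ y ∈ Z z, analyticOrderNatAt (fun y => φ (z, y)) y : ℕ) : ℂ) := by
        simpa using h1
      exact_mod_cast this
    rw [h2, Finset.card_eq_sum_ones]
    exact Finset.sum_le_sum fun y hy => hZ1 z hz y hy
  obtain ⟨d, ⟨z₄, hz₄, hd₄⟩, hdmax⟩ : ∃ d, (∃ z ∈ ball z₀ r, (Z z).card = d) ∧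
      ∀ z ∈ ball z₀ r, (Z z).card ≤ d := by
    set S := {d | ∃ z ∈ ball z₀ r, (Z z).card = d}
    have hne : S.Nonempty := ⟨_, z₀, mem_ball_self hr, rfl⟩
    have hbdd : BddAbove S := ⟨n, by rintro _ ⟨z, hz, rfl⟩; exact hcardn z hz⟩
    exact ⟨sSup S, Nat.sSup_mem hne hbdd, fun z hz => le_csSup hbdd ⟨z, hz, rfl⟩⟩
  set H : E → ℂ := fun z => (Matrix.of fun i j : Fin d => P (i + j) z).det
  have hHd : ∀ z ∈ ball z₀ r, DifferentiableAt ℂ H z := by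
    intro z hz
    have hent : ∀ k, DifferentiableAt ℂ (P k) z := (hball z hz).1.1.1
    simp only [H, Matrix.det_apply, Matrix.of_apply]
    refine DifferentiableAt.fun_sum fun σ _ => ?_
    refine DifferentiableAt.fun_const_smul ?_ _
    induction (Finset.univ : Finset (Fin d)) using Finset.induction_on with
    | empty => simp
    | insert i s hi ih =>
      simp only [Finset.prod_insert hi]
      exact (hent _).mul ih
  have hH : ∀ z ∈ ball z₀ r, H z = (Matrix.of fun i j : Fin d => ∑ y ∈ Z z,
      (analyticOrderNatAt (fun y => φ (z, y)) y : ℂ) * y ^ (i + j : ℕ)).det := by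
    intro z hz
    simp only [H, hZm z hz]
  have hH0 : ∀ z ∈ ball z₀ r, H z ≠ 0 → (Z z).card = d := by
    intro z hz hne
    by_contra hcon
    refine hne ?_
    rw [hH z hz]
    exact hankel_det_eq_zero _ _ (lt_of_le_of_ne (hdmax z hz) hcon)
  have hH4 : H z₄ ≠ 0 := by
    rw [hH z₄ hz₄]
    refine hankel_det_ne_zero _ _ hd₄ fun y hy => ?_
    have := hZ1 z₄ hz₄ y hy
    exact_mod_cast (by omega : analyticOrderNatAt (fun y => φ (z₄, y)) y ≠ 0)
  obtain ⟨z₃, hz₃⟩ : ∃ z₃, z₃ ∈ ball z₀ r ∧ H z₃ ≠ 0 ∧ φ (z₃, 1) ≠ 0 := by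
    have hev : ∀ᶠ z in 𝓝 z₄, z ∈ ball z₀ r ∧ H z ≠ 0 :=
      Eventually.and (isOpen_ball.mem_nhds hz₄) ((hHd z₄ hz₄).continuousAt.eventually_ne hH4)
    obtain ⟨z, hz1, hz2⟩ := hd.inter_nhds_nonempty hev
    exact ⟨z, hz2.1, hz2.2, hz1⟩
  have hφ1 : ∀ z, DifferentiableAt ℂ (fun z => φ (z, 1)) z := fun z =>
    DifferentiableAt.comp (g := φ) z (hφ.differentiableAt (hW.mem_nhds one_ne_zero)) (by fun_prop)
  have hsum : ∀ z ∈ ball z₀ r, multipleZeroSum φ A koebe z =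
      ∑ y ∈ Z z with 2 ≤ analyticOrderNatAt (fun y => φ (z, y)) y, koebe y := fun z hz =>
    (hball z hz).2.multipleZeroSum_eq hW hφ koebe (hZ z hz)
  refine holomorphicResiduallyAt_of_bounded (Δ := fun z => H z * φ (z, 1)) (M := n * max M 0)
    (fun z hz => ((hHd z hz).mul (hφ1 z)).differentiableWithinAt) hz₃.1
    (mul_ne_zero hz₃.2.1 hz₃.2.2) ?_ ?_
  · intro z hz hne
    have hcard := hH0 z hz (left_ne_zero_of_mul hne)
    refine (hφ1 z).mul ((hball z hz).2.differentiableAt_multipleZeroSum hW hφ hA hAc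
      (fun y _ h0 => differentiableAt_koebe ?_) (hZ z hz) ?_)
    · rintro rfl
      exact right_ne_zero_of_mul hne h0
    · filter_upwards [isOpen_ball.mem_nhds hz] with z' hz' Z' hZ'
      have : Z' = Z z' := Finset.ext fun y => (hZ' y).trans (hZ z' hz' y).symm
      rw [this, hcard]
      exact hdmax z' hz'
  · intro z hz _
    rw [hsum z hz, Finset.mul_sum]
    refine (norm_sum_le _ _).trans ?_
    have hterm : ∀ y ∈ (Z z).filter fun y => 2 ≤ analyticOrderNatAt (fun y => φ (z, y)) y,
        ‖φ (z, 1) * koebe y‖ ≤ max M 0 := by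
      intro y hy
      obtain ⟨hy1, hy2⟩ := Finset.mem_filter.1 hy
      have hyA := (hZ z hz y).1 hy1
      have han : AnalyticAt ℂ (fun y => φ (z, y)) y :=
        DifferentiableOn.analyticAt (s := (fun y : ℂ => (z, y)) ⁻¹' {p : E × ℂ | p.2 ≠ 0})
          (hφ.comp (by fun_prop) fun _ h => h)
          ((hW.preimage (by fun_prop : Continuous fun y : ℂ => (z, y))).mem_nhds
            ((hball z hz).2.mem y (subset_closure hyA.1)))
      have h2 := (two_le_analyticOrderNatAt_iff han
        ((hball z hz).2.isolated y (subset_closure hyA.1))).1 hy2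
      exact ((hball z hz).1.2 y (subset_closure hyA.1) h2.1 h2.2).trans (le_max_left _ _)
    refine (Finset.sum_le_sum hterm).trans ?_
    rw [Finset.sum_const, nsmul_eq_mul]
    refine mul_le_mul_of_nonneg_right ?_ (le_max_right _ _)
    exact_mod_cast (Finset.card_filter_le _ _).trans (hcardn z hz)

end Block

/-! ### Summability of Gaussian sums over a lattice. -/

section Summability

/-- A finite set of indices lies in a box, and the sum over a box is a product of one-variable sums.
-/
theorem summable_pi_prod {g : ℕ} {u : Fin g → ℤ → ℝ} (hu0 : ∀ j n, 0 ≤ u j n)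
    (hu : ∀ j, Summable (u j)) : Summable fun n : Fin g → ℤ => ∏ j, u j (n j) := by
  classical
  refine summable_of_sum_le (c := ∏ j, ∑' n, u j n)
    (fun n => Finset.prod_nonneg fun j _ => hu0 j (n j)) fun s => ?_
  calc ∑ n ∈ s, ∏ j, u j (n j)
      ≤ ∑ n ∈ Fintype.piFinset fun j => s.image fun n => n j, ∏ j, u j (n j) := by
        refine Finset.sum_le_sum_of_subset_of_nonneg (fun n hn => ?_)
          fun n _ _ => Finset.prod_nonneg fun j _ => hu0 j (n j)
        exact Fintype.mem_piFinset.2 fun j => Finset.mem_image_of_mem _ hn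
    _ = ∏ j, ∑ n ∈ s.image fun n => n j, u j n := (Finset.prod_univ_sum _ _).symm
    _ ≤ _ := Finset.prod_le_prod (fun j _ => Finset.sum_nonneg fun n _ => hu0 j n)
        fun j _ => (hu j).sum_le_tsum _ fun n _ => hu0 j n

theorem summable_exp_neg_abs_int : Summable fun n : ℤ => Real.exp (-|(n : ℝ)|) := by
  refine Summable.of_nat_of_neg ?_ ?_ <;>
  · simpa using Real.summable_exp_neg_nat

theorem summable_exp_gaussian {c : ℝ} (hc : 0 < c) (R a : ℝ) :
    Summable fun n : ℤ => Real.exp (-c * (n + a) ^ 2 + R * |n + a|) := by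
  -- Completing the square bounds the exponent with linear coefficient `R + 1`; the extra `1` leaves
  -- the summable factor `exp (-|n|)`.
  set C := (R + 1) ^ 2 / (4 * c) + |a|
  refine Summable.of_nonneg_of_le (fun n => (Real.exp_pos _).le) (fun n => ?_)
    (summable_exp_neg_abs_int.mul_left (Real.exp C))
  rw [← Real.exp_add, Real.exp_le_exp]
  have h1 : |(n : ℝ)| ≤ |n + a| + |a| := by
    calc |(n : ℝ)| = |(n + a) - a| := by ring_nf
      _ ≤ _ := abs_sub _ _
  have h2 : -c * (n + a) ^ 2 + (R + 1) * |n + a| ≤ (R + 1) ^ 2 / (4 * c) := by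
    rw [le_div_iff₀ (by positivity), ← sq_abs (n + a)]
    nlinarith [sq_nonneg (2 * c * |(n : ℝ) + a| - (R + 1))]
  simp only [C]
  linarith

theorem exists_pos_mul_sum_sq_le {g : ℕ} {Y : Matrix (Fin g) (Fin g) ℝ} (hY : Y.PosDef) :
    ∃ c > 0, ∀ x : Fin g → ℝ, c * ∑ j, x j ^ 2 ≤ x ⬝ᵥ (Y *ᵥ x) := by
  rcases Nat.eq_zero_or_pos g with rfl | hg
  · exact ⟨1, one_pos, fun x => by simp⟩
  have hcont : Continuous fun x : Fin g → ℝ => x ⬝ᵥ (Y *ᵥ x) := by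
    simp only [dotProduct, Matrix.mulVec]
    fun_prop
  have : Nonempty (Fin g) := ⟨⟨0, hg⟩⟩
  have : Nontrivial (Fin g → ℝ) := Function.nontrivial
  obtain ⟨x₀, hx₀, hmin⟩ := (isCompact_sphere (0 : Fin g → ℝ) 1).exists_isMinOn
    (NormedSpace.sphere_nonempty.2 zero_le_one) hcont.continuousOn
  have hpos : 0 < x₀ ⬝ᵥ (Y *ᵥ x₀) := by
    have := hY.dotProduct_mulVec_pos (x := x₀) (ne_zero_of_mem_unit_sphere ⟨x₀, hx₀⟩)
    simpa using this
  set c := x₀ ⬝ᵥ (Y *ᵥ x₀)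
  -- The minimum `c` is taken on the unit sphere of the sup norm; comparison with the sum of squares
  -- costs the factor `g`.
  refine ⟨c / g, by positivity, fun x => ?_⟩
  rcases eq_or_ne x 0 with rfl | hx
  · simp
  have hx' : 0 < ‖x‖ := norm_pos_iff.2 hx
  have h1 := hmin (a := ‖x‖⁻¹ • x) (by simp [norm_smul, hx'.ne'])
  simp only [Set.mem_ofPred_eq, Matrix.mulVec_smul, dotProduct_smul, smul_dotProduct, smul_eq_mul] at h1
  have h2 : c * ‖x‖ ^ 2 ≤ x ⬝ᵥ (Y *ᵥ x) := by
    calc c * ‖x‖ ^ 2 ≤ ‖x‖⁻¹ * (‖x‖⁻¹ * (x ⬝ᵥ (Y *ᵥ x))) * ‖x‖ ^ 2 := by gcongr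
      _ = _ := by field_simp
  have h3 : ∑ j, x j ^ 2 ≤ g * ‖x‖ ^ 2 := by
    calc ∑ j, x j ^ 2 ≤ ∑ _j : Fin g, ‖x‖ ^ 2 := by
          refine Finset.sum_le_sum fun j _ => ?_
          rw [← sq_abs]
          exact pow_le_pow_left₀ (abs_nonneg _) (norm_le_pi_norm x j) 2
      _ = _ := by simp
  calc c / g * ∑ j, x j ^ 2 ≤ c / g * (g * ‖x‖ ^ 2) := by gcongr
    _ = c * ‖x‖ ^ 2 := by field_simp
    _ ≤ _ := h2

end Summability

/-! ### Convergence, holomorphy and quasi-periodicity of theta series. -/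

section ThetaSeries

variable {g : ℕ} {τ : Matrix (Fin g) (Fin g) ℂ}

/-- The coercion of integer vectors to complex vectors. -/
def intVec (n : Fin g → ℤ) : Fin g → ℂ := fun j => (n j : ℂ)

/-- The exponential `exp (π i xᵗ (τ x + 2 z))`. -/
noncomputable def thetaTerm (τ : Matrix (Fin g) (Fin g) ℂ) (x z : Fin g → ℂ) : ℂ :=
  Complex.exp (Real.pi * Complex.I * (x ⬝ᵥ (τ *ᵥ x + (2 : ℂ) • z)))

theorem theta_eq (z : Fin g → ℂ) : theta τ z = ∑' n, thetaTerm τ (intVec n) z := rfl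

theorem thetaChar_eq (ε z : Fin g → ℂ) :
    thetaChar ε 0 τ z = ∑' n, thetaTerm τ (intVec n + ε) z := by
  rw [thetaChar, add_zero]
  rfl

theorem norm_thetaTerm_ofReal (x : Fin g → ℝ) (z : Fin g → ℂ) :
    ‖thetaTerm τ (fun j => (x j : ℂ)) z‖ =
      Real.exp (-Real.pi * (x ⬝ᵥ (τ.map Complex.im *ᵥ x)) - 2 * Real.pi * ∑ j, x j * (z j).im) := by
  rw [thetaTerm, Complex.norm_exp]
  congr 1
  have : ((fun j => (x j : ℂ)) ⬝ᵥ (τ *ᵥ (fun j => (x j : ℂ)) + (2 : ℂ) • z)).im =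
      x ⬝ᵥ (τ.map Complex.im *ᵥ x) + 2 * ∑ j, x j * (z j).im := by
    simp only [dotProduct, Matrix.mulVec, Pi.add_apply, Pi.smul_apply, smul_eq_mul, Complex.im_sum,
      Complex.mul_im, Complex.ofReal_re, Complex.ofReal_im, zero_mul, add_zero, Complex.add_im,
      Complex.re_ofNat, Complex.im_ofNat, Matrix.map_apply, mul_zero, zero_add]
    rw [Finset.mul_sum, ← Finset.sum_add_distrib]
    refine Finset.sum_congr rfl fun j _ => ?_
    rw [mul_add]
    ring
  rw [show (Real.pi * Complex.I * ((fun j => (x j : ℂ)) ⬝ᵥ (τ *ᵥ (fun j => (x j : ℂ)) + (2 : ℂ) • z)) :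
      ℂ).re = -Real.pi * ((fun j => (x j : ℂ)) ⬝ᵥ (τ *ᵥ (fun j => (x j : ℂ)) + (2 : ℂ) • z)).im by
    simp [Complex.mul_re], this]
  ring

theorem exists_summable_bound_thetaTerm (hτ : τ ∈ siegelSpace g) (a : Fin g → ℝ) (R : ℝ) :
    ∃ u : (Fin g → ℤ) → ℝ, Summable u ∧ ∀ n z, (∀ j, |(z j).im| ≤ R) →
      ‖thetaTerm τ (intVec n + fun j => (a j : ℂ)) z‖ ≤ u n := by
  obtain ⟨c, hc, hcY⟩ := exists_pos_mul_sum_sq_le hτ.2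
  refine ⟨fun n => ∏ j, Real.exp (-(Real.pi * c) * (n j + a j) ^ 2 + 2 * Real.pi * R * |n j + a j|),
    summable_pi_prod (u := fun j n => Real.exp (-(Real.pi * c) * (n + a j) ^ 2 +
      2 * Real.pi * R * |n + a j|)) (fun j n => (Real.exp_pos _).le)
      fun j => summable_exp_gaussian (by positivity) _ _, fun n z hz => ?_⟩
  have hx : (intVec n + fun j => (a j : ℂ)) = fun j => ((n j + a j : ℝ) : ℂ) := by
    ext j; simp [intVec]
  beta_reduce
  rw [hx, norm_thetaTerm_ofReal, ← Real.exp_sum, Real.exp_le_exp]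
  have h1 := hcY fun j => (n j + a j : ℝ)
  have h2 : -∑ j, (n j + a j : ℝ) * (z j).im ≤ ∑ j, R * |n j + a j| := by
    rw [← Finset.sum_neg_distrib]
    refine Finset.sum_le_sum fun j _ => ?_
    refine (neg_le_abs _).trans ?_
    rw [abs_mul, mul_comm]
    exact mul_le_mul_of_nonneg_right (hz j) (abs_nonneg _)
  rw [Finset.sum_add_distrib, ← Finset.mul_sum]
  have h3 : ∑ j, 2 * Real.pi * R * |(n j : ℝ) + a j| = 2 * Real.pi * ∑ j, R * |n j + a j| := by
    rw [Finset.mul_sum]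
    exact Finset.sum_congr rfl fun j _ => by ring
  rw [h3]
  have h4 := mul_le_mul_of_nonneg_left h1 Real.pi_pos.le
  have h5 := mul_le_mul_of_nonneg_left h2 Real.two_pi_pos.le
  linarith

theorem summable_norm_thetaTerm (hτ : τ ∈ siegelSpace g) (a : Fin g → ℝ) (z : Fin g → ℂ) :
    Summable fun n => ‖thetaTerm τ (intVec n + fun j => (a j : ℂ)) z‖ := by
  obtain ⟨u, hu, hb⟩ := exists_summable_bound_thetaTerm hτ a ‖z‖
  refine Summable.of_nonneg_of_le (fun _ => norm_nonneg _) (fun n => hb n z fun j => ?_) hu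
  exact (Complex.abs_im_le_norm _).trans (norm_le_pi_norm z j)

theorem differentiable_thetaTerm (x : Fin g → ℂ) : Differentiable ℂ (thetaTerm τ x) := by
  have : Differentiable ℂ fun z : Fin g → ℂ => x ⬝ᵥ (τ *ᵥ x + (2 : ℂ) • z) := by
    simp only [dotProduct, Pi.add_apply, Pi.smul_apply]
    fun_prop
  unfold thetaTerm
  fun_prop

theorem differentiable_tsum_thetaTerm (hτ : τ ∈ siegelSpace g) (a : Fin g → ℝ) :
    Differentiable ℂ fun z => ∑' n, thetaTerm τ (intVec n + fun j => (a j : ℂ)) z := by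
  intro z
  obtain ⟨u, hu, hb⟩ := exists_summable_bound_thetaTerm hτ a (‖z‖ + 1)
  refine (differentiableOn_tsum_of_summable hu
    (F := fun n z => thetaTerm τ (intVec n + fun j => (a j : ℂ)) z) (z := z) (r := 1)
    (fun n => (differentiable_thetaTerm _).differentiableOn) fun n y hy => hb n y fun j => ?_).differentiableAt
    (Metric.ball_mem_nhds z one_pos)
  refine (Complex.abs_im_le_norm _).trans ((norm_le_pi_norm y j).trans ?_)
  rw [mem_ball_iff_norm] at hy
  have := norm_le_norm_add_norm_sub' y z
  linarith

theorem differentiable_theta (hτ : τ ∈ siegelSpace g) : Differentiable ℂ (theta τ) := by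
  have := differentiable_tsum_thetaTerm hτ 0
  simp only [show (fun j : Fin g => (((0 : Fin g → ℝ) j : ℝ) : ℂ)) = 0 by ext; simp, add_zero] at this
  exact this

theorem summable_norm_theta (hτ : τ ∈ siegelSpace g) (z : Fin g → ℂ) :
    Summable fun n => ‖thetaTerm τ (intVec n) z‖ := by
  have := summable_norm_thetaTerm hτ 0 z
  simpa only [show (fun j : Fin g => (((0 : Fin g → ℝ) j : ℝ) : ℂ)) = 0 by ext; simp, add_zero]
    using this

theorem exp_two_pi_mul_intVec_dotProduct (n m : Fin g → ℤ) :
    Complex.exp (2 * Real.pi * Complex.I * (intVec n ⬝ᵥ intVec m)) = 1 := by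
  rw [Complex.exp_eq_one_iff]
  refine ⟨∑ j, n j * m j, ?_⟩
  simp only [intVec, dotProduct]
  push_cast
  ring

theorem thetaTerm_add_intVec (n m : Fin g → ℤ) (z : Fin g → ℂ) :
    thetaTerm τ (intVec n) (z + intVec m) = thetaTerm τ (intVec n) z := by
  rw [thetaTerm, thetaTerm, smul_add, ← add_assoc, dotProduct_add, mul_add, Complex.exp_add,
    dotProduct_smul, smul_eq_mul, show (Real.pi * Complex.I * (2 * (intVec n ⬝ᵥ intVec m)) : ℂ) =
    2 * Real.pi * Complex.I * (intVec n ⬝ᵥ intVec m) by ring, exp_two_pi_mul_intVec_dotProduct, mul_one]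

theorem theta_add_intVec (m : Fin g → ℤ) (z : Fin g → ℂ) :
    theta τ (z + intVec m) = theta τ z := by
  simp only [theta_eq, thetaTerm_add_intVec]

theorem dotProduct_mulVec_comm (hτ : τ.IsSymm) (x y : Fin g → ℂ) :
    x ⬝ᵥ (τ *ᵥ y) = y ⬝ᵥ (τ *ᵥ x) := by
  rw [Matrix.dotProduct_mulVec, dotProduct_comm, ← Matrix.mulVec_transpose, hτ.eq]

/-- The factor of automorphy of the theta function. -/
noncomputable def automorphyFactor (τ : Matrix (Fin g) (Fin g) ℂ) (m : Fin g → ℤ) (z : Fin g → ℂ) :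
    ℂ :=
  Complex.exp (-(Real.pi * Complex.I * (intVec m ⬝ᵥ (τ *ᵥ intVec m + (2 : ℂ) • z))))

theorem thetaTerm_add_mulVec (hτ : τ.IsSymm) (x : Fin g → ℂ) (m : Fin g → ℤ) (z : Fin g → ℂ) :
    thetaTerm τ x (z + τ *ᵥ intVec m) =
      automorphyFactor τ m z * thetaTerm τ (x + intVec m) z := by
  rw [thetaTerm, automorphyFactor, thetaTerm, ← Complex.exp_add]
  congr 1
  have := dotProduct_mulVec_comm hτ x (intVec m)
  simp only [Matrix.mulVec_add, dotProduct_add, add_dotProduct, smul_add, dotProduct_smul,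
    smul_eq_mul, this]
  ring

theorem theta_add_mulVec (hτ : τ.IsSymm) (m : Fin g → ℤ) (z : Fin g → ℂ) :
    theta τ (z + τ *ᵥ intVec m) = automorphyFactor τ m z * theta τ z := by
  simp only [theta_eq, thetaTerm_add_mulVec hτ, tsum_mul_left]
  congr 1
  rw [← (Equiv.addRight m).tsum_eq fun n => thetaTerm τ (intVec n) z]
  refine tsum_congr fun n => ?_
  congr 1
  ext j
  simp [intVec]

theorem automorphyFactor_ne_zero (m : Fin g → ℤ) (z : Fin g → ℂ) : automorphyFactor τ m z ≠ 0 :=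
  Complex.exp_ne_zero _

theorem thetaTerm_neg (x z : Fin g → ℂ) : thetaTerm τ (-x) (-z) = thetaTerm τ x z := by
  rw [thetaTerm, thetaTerm, Matrix.mulVec_neg, smul_neg, ← neg_add, neg_dotProduct_neg]

end ThetaSeries

/-! ### Fourier series on the torus and uniqueness of the theta function up to a scalar. -/

section Torus

open MeasureTheory UnitAddTorus

variable {g : ℕ}

attribute [local instance] instMeasureSpaceUnitAddCircle

local instance : IsProbabilityMeasure (volume : Measure UnitAddCircle) :=
  inferInstanceAs (IsProbabilityMeasure AddCircle.haarAddCircle)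

local instance : Measure.IsAddHaarMeasure (volume : Measure UnitAddCircle) :=
  inferInstanceAs (Measure.IsAddHaarMeasure AddCircle.haarAddCircle)

/-- The inner product with the `n`-th Fourier monomial extracts the coefficient. Several `i` may
share a frequency, hence the sum over a fibre of `m`. -/
theorem tsum_ite_eq_zero_of_tsum_mFourier_eq_zero {d ι : Type*} [Fintype d] {b : ι → ℂ}
    (hb : Summable fun i => ‖b i‖) (m : ι → d → ℤ)
    (h : ∀ x, ∑' i, b i * mFourier (m i) x = 0) (n : d → ℤ) :
    ∑' i, (open Classical in if m i = n then b i else 0) = 0 := by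
  classical
  have hs : Summable fun i => b i • mFourier (m i) := by
    refine Summable.of_norm ?_
    simpa only [norm_smul, mFourier_norm, mul_one] using hb
  have h0 : ∑' i, b i • mFourier (m i) = 0 := by
    ext x
    have := (ContinuousMap.evalCLM ℂ x).map_tsum hs
    refine this.trans ((tsum_congr fun i => ?_).trans (h x))
    simp [ContinuousMap.evalCLM_apply]
  have h1 := congr_arg ((innerSL ℂ (mFourierLp (d := d) 2 n)).comp
    (ContinuousMap.toLp 2 volume ℂ)) h0
  rw [map_zero] at h1
  refine Eq.trans ?_ ((ContinuousLinearMap.map_tsum _ hs).symm.trans h1)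
  refine tsum_congr fun i => ?_
  have := orthonormal_iff_ite.1 (orthonormal_mFourier (d := d)) n (m i)
  rw [map_smul, ContinuousLinearMap.comp_apply, innerSL_apply_apply, this]
  by_cases hi : m i = n
  · simp [hi]
  · simp [hi, Ne.symm hi]

theorem mFourier_coe (n : Fin g → ℤ) (x : Fin g → ℝ) :
    mFourier n (fun j => (x j : UnitAddCircle)) =
      Complex.exp (2 * Real.pi * Complex.I * (intVec n ⬝ᵥ fun j => (x j : ℂ))) := by
  rw [mFourier, ContinuousMap.coe_mk, dotProduct, Finset.mul_sum, Complex.exp_sum]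
  refine Finset.prod_congr rfl fun j _ => ?_
  rw [fourier_coe_apply]
  congr 1
  simp [intVec]
  ring

theorem exists_torusLift {F : (Fin g → ℂ) → ℂ} (hF : Continuous F)
    (hp : ∀ (m : Fin g → ℤ) z, F (z + intVec m) = F z) (ζ : Fin g → ℂ) :
    ∃ f : C(UnitAddTorus (Fin g), ℂ), ∀ x : Fin g → ℝ,
      f (fun j => (x j : UnitAddCircle)) = F (ζ + fun j => (x j : ℂ)) := by
  let π : C(Fin g → ℝ, UnitAddTorus (Fin g)) :=
    ⟨fun x j => (x j : UnitAddCircle), continuous_pi fun j =>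
      (AddCircle.continuous_mk' 1).comp (continuous_apply j)⟩
  have hq : Topology.IsQuotientMap π :=
    (IsOpenQuotientMap.piMap (f := fun (_ : Fin g) (x : ℝ) => (x : UnitAddCircle))
      fun _ => QuotientAddGroup.isOpenQuotientMap_mk).isQuotientMap
  let G : C(Fin g → ℝ, ℂ) := ⟨fun x => F (ζ + fun j => (x j : ℂ)), by fun_prop⟩
  have hG : ∀ x y, π x = π y → G x = G y := by
    intro x y hxy
    have h1 : ∀ j, ∃ m : ℤ, x j = y j + m := fun j => by
      have h2 : ((x j - y j : ℝ) : UnitAddCircle) = 0 := by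
        rw [AddCircle.coe_sub, sub_eq_zero]
        exact congr_fun hxy j
      obtain ⟨m, hm⟩ := (AddCircle.coe_eq_zero_iff 1).1 h2
      refine ⟨m, ?_⟩
      rw [zsmul_one] at hm
      linarith
    choose m hm using h1
    have : (ζ + fun j => (x j : ℂ)) = (ζ + fun j => (y j : ℂ)) + intVec m := by
      ext j
      simp [hm, intVec, add_assoc]
    simp only [G, ContinuousMap.coe_mk, this, hp]
  exact ⟨hq.lift G hG, fun x => congr_fun (congr_arg DFunLike.coe (hq.lift_comp G hG)) x⟩

theorem differentiable_integral_translate {E X : Type*} [NormedAddCommGroup E] [NormedSpace ℂ E]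
    [FiniteDimensional ℂ E] [MeasurableSpace X] {μ : Measure X} [IsFiniteMeasure μ]
    {F : E → ℂ} (hF : Differentiable ℂ F) [MeasurableSpace E] [BorelSpace E] {s : X → E} (hs : Measurable s) {R : ℝ}
    (hR : ∀ᵐ x ∂μ, ‖s x‖ ≤ R) : Differentiable ℂ fun ζ => ∫ x, F (ζ + s x) ∂μ := by
  have : ProperSpace E := FiniteDimensional.proper ℂ E
  intro ζ
  have hc : Continuous (fderiv ℂ F) := (contDiff_of_differentiable hF).continuous_fderiv (by simp)
  obtain ⟨C, hC⟩ := (isCompact_closedBall ζ (R + 1)).exists_bound_of_continuousOn hc.continuousOn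
  obtain ⟨C', hC'⟩ := (isCompact_closedBall ζ (R + 1)).exists_bound_of_continuousOn
    hF.continuous.continuousOn
  refine (hasFDerivAt_integral_of_dominated_of_fderiv_le (μ := μ) (bound := fun _ => C)
    (F := fun ζ x => F (ζ + s x)) (F' := fun ζ x => fderiv ℂ F (ζ + s x)) (x₀ := ζ)
    (Metric.ball_mem_nhds ζ one_pos) ?_ ?_ ?_ ?_ (integrable_const C) ?_).differentiableAt
  · exact Eventually.of_forall fun z => (hF.continuous.measurable.comp
      (hs.const_add z)).aestronglyMeasurable
  · refine Integrable.of_bound (hF.continuous.measurable.comp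
      (hs.const_add ζ)).aestronglyMeasurable C' ?_
    filter_upwards [hR] with x hx
    refine hC' _ ?_
    rw [mem_closedBall_iff_norm, add_sub_cancel_left]
    linarith
  · exact (hc.stronglyMeasurable.comp_measurable (hs.const_add ζ)).aestronglyMeasurable
  · filter_upwards [hR] with x hx z hz
    refine hC _ ?_
    rw [mem_ball_iff_norm] at hz
    rw [mem_closedBall_iff_norm, add_sub_right_comm]
    exact (norm_add_le _ _).trans (by linarith)
  · refine Eventually.of_forall fun x z _ => ?_
    exact HasFDerivAt.comp z (f := fun ζ => ζ + s x) (hF _).hasFDerivAt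
      ((hasFDerivAt_id z).add_const (s x))

/-- The mean `c ζ` of `F` over the real torus through `ζ` is entire and invariant under real
translations, hence constant. A shift of `ζ` by `τ m` turns this mean into the `m`-th Fourier
coefficient, so the constant determines all coefficients, and they are those of a multiple of `θ`.
-/
theorem exists_eq_const_mul_theta {τ : Matrix (Fin g) (Fin g) ℂ} (hτ : τ ∈ siegelSpace g)
    {F : (Fin g → ℂ) → ℂ} (hF : Differentiable ℂ F)
    (h1 : ∀ (m : Fin g → ℤ) z, F (z + intVec m) = F z)
    (h2 : ∀ (m : Fin g → ℤ) z, F (z + τ *ᵥ intVec m) = automorphyFactor τ m z * F z) :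
    ∃ c, ∀ z, F z = c * theta τ z := by
  choose f hf using fun ζ => exists_torusLift hF.continuous h1 ζ
  have hπ : Function.Surjective fun (x : Fin g → ℝ) (j : Fin g) => (x j : UnitAddCircle) :=
    fun t => ⟨fun j => (QuotientAddGroup.mk_surjective (t j)).choose,
      funext fun j => (QuotientAddGroup.mk_surjective (t j)).choose_spec⟩
  let c : (Fin g → ℂ) → ℂ := fun ζ => ∫ t, f ζ t
  have hc_real : ∀ ζ (x : Fin g → ℝ), c (ζ + fun j => (x j : ℂ)) = c ζ := by
    intro ζ x
    have h3 : ∀ t, f (ζ + fun j => (x j : ℂ)) t = f ζ (t + fun j => (x j : UnitAddCircle)) := by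
      intro t
      obtain ⟨y, rfl⟩ := hπ t
      have := hf ζ (y + x)
      simp only [Pi.add_apply, AddCircle.coe_add] at this
      rw [hf]
      refine Eq.trans ?_ this.symm
      congr 1
      ext j
      simp
      ring
    simp only [c, h3]
    exact integral_add_right_eq_self (μ := volume) (fun t => f ζ t) _
  have hc_diff : Differentiable ℂ c := by
    have h3 : c = fun ζ => ∫ x in {x : Fin g → ℝ | ∀ i, x i ∈ Set.Ioc ((0 : Fin g → ℝ) i) ((0 : Fin g → ℝ) i + 1)},
        F (ζ + fun j => (x j : ℂ)) := by
      ext ζ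
      simp only [c, integral_preimage _ (0 : Fin g → ℝ), hf]
    have hms : MeasurableSet {x : Fin g → ℝ | ∀ i, x i ∈ Set.Ioc ((0 : Fin g → ℝ) i) ((0 : Fin g → ℝ) i + 1)} :=
      MeasurableSet.univ_pi' fun i => measurableSet_Ioc
    have hfin : volume {x : Fin g → ℝ | ∀ i, x i ∈ Set.Ioc ((0 : Fin g → ℝ) i) ((0 : Fin g → ℝ) i + 1)} < ⊤ := by
      refine (measure_mono fun x hx => ?_).trans_lt
        (isCompact_Icc (a := (0 : Fin g → ℝ)) (b := 1)).measure_lt_top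
      exact ⟨fun i => (hx i).1.le, fun i => by simpa using (hx i).2⟩
    have : IsFiniteMeasure (volume.restrict {x : Fin g → ℝ | ∀ i, x i ∈ Set.Ioc ((0 : Fin g → ℝ) i) ((0 : Fin g → ℝ) i + 1)}) :=
      ⟨by simpa using hfin⟩
    rw [h3]
    refine differentiable_integral_translate hF (R := 1) (s := fun (x : Fin g → ℝ) j => (x j : ℂ))
      (Continuous.measurable (by fun_prop)) ?_
    filter_upwards [ae_restrict_mem hms] with x hx
    refine (pi_norm_le_iff_of_nonneg zero_le_one).2 fun j => ?_
    have := hx j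
    rw [Complex.norm_real, Real.norm_eq_abs, abs_le]
    simp only [Pi.zero_apply, zero_add] at this
    exact ⟨by linarith [this.1], this.2⟩
  have hc_const : ∀ ζ, c ζ = c 0 := by
    refine fun ζ => is_const_of_fderiv_eq_zero (𝕜 := ℂ) hc_diff (fun z => ?_) ζ 0
    have h3 : ∀ x : Fin g → ℝ, fderiv ℂ c z (fun j => (x j : ℂ)) = 0 := by
      intro x
      have h4 : HasDerivAt (fun t : ℝ => c (z + (t : ℂ) • fun j => (x j : ℂ)))
          (fderiv ℂ c z fun j => (x j : ℂ)) 0 := by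
        have h5 : HasDerivAt (fun t : ℂ => c (z + t • fun j => (x j : ℂ)))
            (fderiv ℂ c z fun j => (x j : ℂ)) ((0 : ℝ) : ℂ) := by
          have h6 : HasFDerivAt c (fderiv ℂ c z) (z + ((0 : ℝ) : ℂ) • fun j => (x j : ℂ)) := by
            simpa using (hc_diff z).hasFDerivAt
          have h7 : HasDerivAt (fun t : ℂ => z + t • fun j => (x j : ℂ)) (fun j => (x j : ℂ))
              ((0 : ℝ) : ℂ) := by
            simpa using ((hasDerivAt_id ((0 : ℝ) : ℂ)).smul_const fun j => (x j : ℂ)).const_add z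
          exact h6.comp_hasDerivAt _ h7
        exact h5.comp_ofReal
      have h5 : (fun t : ℝ => c (z + (t : ℂ) • fun j => (x j : ℂ))) = fun _ => c z := by
        ext t
        rw [← hc_real z (t • x)]
        congr 2
        ext j
        simp
      rw [h5] at h4
      exact h4.unique (hasDerivAt_const _ _)
    -- The derivative kills real vectors, hence all vectors, being complex linear.
    ext1 v
    have h4 : v = (fun j => ((v j).re : ℂ)) + Complex.I • fun j => ((v j).im : ℂ) := by
      ext j
      simp [mul_comm Complex.I, Complex.re_add_im]
    rw [h4, map_add, map_smul, h3 fun j => (v j).re, h3 fun j => (v j).im]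
    simp
  have hcoeff : ∀ ζ m, mFourierCoeff (f ζ) m = c 0 * thetaTerm τ (intVec m) ζ := by
    intro ζ m
    have h3 : ∀ t, f (ζ + τ *ᵥ intVec m) t =
        automorphyFactor τ m ζ * (mFourier (-m) t • f ζ t) := by
      intro t
      obtain ⟨x, rfl⟩ := hπ t
      rw [hf, mFourier_coe, hf, add_right_comm, h2, smul_eq_mul, ← mul_assoc]
      congr 1
      rw [automorphyFactor, automorphyFactor, ← Complex.exp_add]
      congr 1
      have : intVec (-m) = -intVec m := by ext; simp [intVec]
      simp only [this, smul_add, dotProduct_add, neg_dotProduct, dotProduct_smul, smul_eq_mul]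
      ring
    have h4 : c (ζ + τ *ᵥ intVec m) = automorphyFactor τ m ζ * mFourierCoeff (f ζ) m := by
      simp only [c, h3, mFourierCoeff]
      exact integral_const_mul _ _
    rw [hc_const] at h4
    rw [h4, automorphyFactor, thetaTerm, mul_right_comm, ← Complex.exp_add, neg_add_cancel,
      Complex.exp_zero, one_mul]
  refine ⟨c 0, fun ζ => ?_⟩
  have h3 : Summable (mFourierCoeff (f ζ)) := by
    rw [show mFourierCoeff (f ζ) = _ from funext (hcoeff ζ)]
    exact ((summable_norm_theta hτ ζ).of_norm).mul_left (c 0)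
  have h4 := (hasSum_mFourier_series_apply_of_summable h3
    fun j => (((0 : Fin g → ℝ) j : ℝ) : UnitAddCircle)).tsum_eq
  rw [hf] at h4
  have h5 : (ζ + fun j => (((0 : Fin g → ℝ) j : ℝ) : ℂ)) = ζ := by ext; simp
  rw [h5] at h4
  rw [← h4, theta_eq, ← tsum_mul_left]
  refine tsum_congr fun m => ?_
  rw [hcoeff, mFourier_coe]
  simp [dotProduct]

end Torus

/-! ### Second order theta functions: evenness, linear independence, addition theorem. -/

section Kummer

variable {g : ℕ} {τ : Matrix (Fin g) (Fin g) ℂ}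

/-- The half-integral characteristic `e / 2`. -/
noncomputable def halfChar (e : Fin g → Fin 2) : Fin g → ℂ :=
  fun j => ((((e j : ℕ) : ℝ) / 2 : ℝ) : ℂ)

theorem kummer_eq (z : Fin g → ℂ) (e : Fin g → Fin 2) :
    kummer τ z e = ∑' n, thetaTerm ((2 : ℂ) • τ) (intVec n + halfChar e) ((2 : ℂ) • z) := by
  rw [kummer, thetaChar_eq]
  have : (fun j => (((e j : ℕ) : ℂ)) / 2) = halfChar e := by ext; simp [halfChar]
  rw [this]

theorem two_smul_mem_siegelSpace (hτ : τ ∈ siegelSpace g) : (2 : ℂ) • τ ∈ siegelSpace g := by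
  refine ⟨?_, ?_⟩
  · rw [Matrix.IsSymm, Matrix.transpose_smul, hτ.1.eq]
  · have : ((2 : ℂ) • τ).map Complex.im = (2 : ℝ) • τ.map Complex.im := by
      ext i j
      simp
    rw [this]
    exact hτ.2.smul two_pos

theorem summable_norm_kummer (hτ : τ ∈ siegelSpace g) (e : Fin g → Fin 2) (z : Fin g → ℂ) :
    Summable fun n => ‖thetaTerm ((2 : ℂ) • τ) (intVec n + halfChar e) z‖ :=
  summable_norm_thetaTerm (two_smul_mem_siegelSpace hτ) (fun j => ((e j : ℕ) : ℝ) / 2) z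

theorem differentiable_kummer_apply (hτ : τ ∈ siegelSpace g) (e : Fin g → Fin 2) :
    Differentiable ℂ fun z => kummer τ z e := by
  simp only [kummer_eq]
  exact (differentiable_tsum_thetaTerm (two_smul_mem_siegelSpace hτ)
    fun j => ((e j : ℕ) : ℝ) / 2).comp (differentiable_id.const_smul (2 : ℂ))

theorem differentiable_kummer (hτ : τ ∈ siegelSpace g) : Differentiable ℂ (kummer τ) :=
  differentiable_pi.2 fun e => differentiable_kummer_apply hτ e

/-- The reindexing `n ↦ -e - n` sends `n + e / 2` to its negative. -/
theorem kummer_neg (z : Fin g → ℂ) : kummer τ (-z) = kummer τ z := by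
  ext e
  rw [kummer_eq, kummer_eq,
    ← (Equiv.subLeft (fun j => -((e j : ℕ) : ℤ)) : (Fin g → ℤ) ≃ _).tsum_eq]
  refine tsum_congr fun n => ?_
  rw [← thetaTerm_neg]
  congr 1
  · ext j
    simp [intVec, halfChar]
    ring
  · simp

theorem thetaTerm_add_right (x z w : Fin g → ℂ) :
    thetaTerm τ x (z + w) = thetaTerm τ x z * Complex.exp (2 * Real.pi * Complex.I * (x ⬝ᵥ w)) := by
  rw [thetaTerm, thetaTerm, ← Complex.exp_add]
  congr 1
  simp only [smul_add, dotProduct_add, dotProduct_smul, smul_eq_mul]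
  ring

/-- The frequency of a term of a second order theta function. -/
def kummerFreq (i : (Fin g → Fin 2) × (Fin g → ℤ)) : Fin g → ℤ := fun j => 2 * i.2 j + (i.1 j : ℕ)

theorem kummerFreq_injective : Function.Injective (kummerFreq (g := g)) := by
  rintro ⟨e, n⟩ ⟨e', n'⟩ h
  have h1 : ∀ j, e j = e' j ∧ n j = n' j := fun j => by
    have h2 : 2 * n j + (e j : ℕ) = 2 * n' j + (e' j : ℕ) := congr_fun h j
    have h3 := (e j).2
    have h4 := (e' j).2
    refine ⟨Fin.ext ?_, ?_⟩ <;> omega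
  exact Prod.ext (funext fun j => (h1 j).1) (funext fun j => (h1 j).2)

/-- On real vectors the left side is a Fourier series whose frequencies `2 n + e` are pairwise
distinct, so every coefficient vanishes. -/
theorem eq_zero_of_sum_mul_kummer_eq_zero (hτ : τ ∈ siegelSpace g) {c : (Fin g → Fin 2) → ℂ}
    (h : ∀ z, ∑ e, c e * kummer τ z e = 0) : c = 0 := by
  classical
  ext e₀
  let b : (Fin g → Fin 2) × (Fin g → ℤ) → ℂ := fun i =>
    c i.1 * thetaTerm ((2 : ℂ) • τ) (intVec i.2 + halfChar i.1) 0
  have hb : Summable fun i => ‖b i‖ := by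
    rw [summable_prod_of_nonneg fun i => norm_nonneg _]
    refine ⟨fun e => ?_, Summable.of_finite⟩
    simp only [b, norm_mul]
    exact (summable_norm_kummer hτ e 0).mul_left _
  have h1 := tsum_ite_eq_zero_of_tsum_mFourier_eq_zero hb kummerFreq (fun t => ?_) (kummerFreq (e₀, 0))
  · rw [tsum_eq_single (e₀, 0)] at h1
    · simp only [if_true] at h1
      exact (mul_eq_zero.1 h1).resolve_right (Complex.exp_ne_zero _)
    · intro i hi
      exact if_neg (kummerFreq_injective.ne hi)
  · choose x hx using fun j => QuotientAddGroup.mk_surjective (t j)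
    obtain rfl : (fun j => (x j : UnitAddCircle)) = t := funext hx
    have h2 : ∀ i, b i * UnitAddTorus.mFourier (kummerFreq i) (fun j => (x j : UnitAddCircle)) =
        c i.1 * thetaTerm ((2 : ℂ) • τ) (intVec i.2 + halfChar i.1) ((2 : ℂ) • fun j => (x j : ℂ)) := by
      intro i
      rw [mFourier_coe, ← zero_add ((2 : ℂ) • fun j => (x j : ℂ)), thetaTerm_add_right, ← mul_assoc]
      congr 3
      rw [dotProduct_smul, ← smul_dotProduct]
      congr 1
      ext j
      simp [intVec, halfChar, kummerFreq]
      ring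
    have h3 : Summable fun i : (Fin g → Fin 2) × (Fin g → ℤ) => c i.1 *
        thetaTerm ((2 : ℂ) • τ) (intVec i.2 + halfChar i.1) ((2 : ℂ) • fun j => (x j : ℂ)) := by
      simp only [← h2]
      refine Summable.of_norm_bounded hb fun i => ?_
      rw [norm_mul]
      refine mul_le_of_le_one_right (norm_nonneg _) ?_
      exact (ContinuousMap.norm_coe_le_norm _ _).trans_eq UnitAddTorus.mFourier_norm
    simp only [h2]
    rw [h3.tsum_prod, tsum_fintype, ← h fun j => (x j : ℂ)]
    simp only [tsum_mul_left, kummer_eq]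

/-- Each pair of integer vectors is uniquely of the form `(k + l + e, k - l)`, with `e` the parity
of the difference of its members. In the variables `k + e / 2` and `l + e / 2` the two quadratic
forms combine by the parallelogram law. -/
theorem theta_add_mul_theta_sub (hτ : τ ∈ siegelSpace g) (a b : Fin g → ℂ) :
    theta τ (a + b) * theta τ (a - b) = ∑ e, kummer τ a e * kummer τ b e := by
  let Φ : (Fin g → Fin 2) × (Fin g → ℤ) × (Fin g → ℤ) → (Fin g → ℤ) × (Fin g → ℤ) := fun i =>
    (fun j => i.2.1 j + i.2.2 j + (i.1 j : ℕ), fun j => i.2.1 j - i.2.2 j)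
  have hΦ : Function.Bijective Φ := by
    refine ⟨?_, ?_⟩
    · rintro ⟨e, k, l⟩ ⟨e', k', l'⟩ h
      have h1 : ∀ j, e j = e' j ∧ k j = k' j ∧ l j = l' j := fun j => by
        have h2 : k j + l j + (e j : ℕ) = k' j + l' j + (e' j : ℕ) := congr_fun (congr_arg Prod.fst h) j
        have h5 : k j - l j = k' j - l' j := congr_fun (congr_arg Prod.snd h) j
        have h3 := (e j).2
        have h4 := (e' j).2
        refine ⟨Fin.ext ?_, ?_, ?_⟩ <;> omega
      simp only [Prod.mk.injEq, funext_iff]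
      exact ⟨fun j => (h1 j).1, fun j => (h1 j).2.1, fun j => (h1 j).2.2⟩
    · rintro ⟨n, m⟩
      refine ⟨(fun j => ⟨((n j - m j) % 2).toNat, by omega⟩, fun j => m j + (n j - m j) / 2,
        fun j => (n j - m j) / 2), ?_⟩
      simp only [Φ, Prod.mk.injEq, funext_iff]
      refine ⟨fun j => ?_, fun j => ?_⟩ <;> omega
  have hterm : ∀ i, thetaTerm τ (intVec (Φ i).1) (a + b) * thetaTerm τ (intVec (Φ i).2) (a - b) =
      thetaTerm ((2 : ℂ) • τ) (intVec i.2.1 + halfChar i.1) ((2 : ℂ) • a) *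
        thetaTerm ((2 : ℂ) • τ) (intVec i.2.2 + halfChar i.1) ((2 : ℂ) • b) := by
    rintro ⟨e, k, l⟩
    set A := intVec k + halfChar e with hA
    set B := intVec l + halfChar e with hB
    have h1 : intVec (Φ (e, k, l)).1 = A + B := by
      ext j
      simp [Φ, hA, hB, intVec, halfChar]
      ring
    have h2 : intVec (Φ (e, k, l)).2 = A - B := by
      ext j
      simp [Φ, hA, hB, intVec, halfChar]
    rw [h1, h2, thetaTerm, thetaTerm, thetaTerm, thetaTerm, ← Complex.exp_add, ← Complex.exp_add]
    congr 1
    have := dotProduct_mulVec_comm hτ.1 A B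
    simp only [smul_add, smul_sub, dotProduct_add, dotProduct_sub, add_dotProduct, sub_dotProduct,
      Matrix.mulVec_add, Matrix.mulVec_sub, dotProduct_smul, smul_eq_mul, Matrix.smul_mulVec, this]
    ring
  have hsum := summable_mul_of_summable_norm (summable_norm_theta hτ (a + b))
    (summable_norm_theta hτ (a - b))
  rw [theta_eq, theta_eq, tsum_mul_tsum_of_summable_norm (summable_norm_theta hτ (a + b))
    (summable_norm_theta hτ (a - b)), ← (Equiv.ofBijective Φ hΦ).tsum_eq]
  rw [← (Equiv.ofBijective Φ hΦ).summable_iff] at hsum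
  simp only [Function.comp_def, Equiv.ofBijective_apply, hterm] at hsum ⊢
  rw [hsum.tsum_prod, tsum_fintype]
  refine Finset.sum_congr rfl fun e _ => ?_
  rw [kummer_eq, kummer_eq, tsum_mul_tsum_of_summable_norm (summable_norm_kummer hτ e _)
    (summable_norm_kummer hτ e _)]

end Kummer

/-! ### A compact fundamental domain, and integral directions on which theta is never identically
zero. -/

section Lattice

variable {g : ℕ} {τ : Matrix (Fin g) (Fin g) ℂ}

theorem exists_isCompact_fundamental (hτ : τ ∈ siegelSpace g) :
    ∃ K : Set (Fin g → ℂ), IsCompact K ∧ ∀ z, ∃ k ∈ K, ∃ m m' : Fin g → ℤ,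
      z = k + intVec m + τ *ᵥ intVec m' := by
  classical
  let f : (Fin g → ℝ) × (Fin g → ℝ) → Fin g → ℂ := fun p =>
    (fun j => (p.1 j : ℂ)) + τ *ᵥ fun j => (p.2 j : ℂ)
  have hf : Continuous f := by fun_prop
  refine ⟨f '' Set.Icc 0 1, isCompact_Icc.image hf, fun z => ?_⟩
  set Y := τ.map Complex.im
  have hY : IsUnit Y.det := isUnit_iff_ne_zero.2 hτ.2.det_pos.ne'
  set y : Fin g → ℝ := Y⁻¹ *ᵥ fun j => (z j).im with hy
  have hYy : Y *ᵥ y = fun j => (z j).im := by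
    rw [hy, Matrix.mulVec_mulVec, Matrix.mul_nonsing_inv Y hY, Matrix.one_mulVec]
  set x : Fin g → ℝ := fun j => (z j - (τ *ᵥ fun j => (y j : ℂ)) j).re with hx
  have hz : z = (fun j => (x j : ℂ)) + τ *ᵥ fun j => (y j : ℂ) := by
    ext j
    refine Complex.ext ?_ ?_
    · simp [hx]
    · have h1 := congr_fun hYy j
      simp only [Pi.add_apply, Complex.add_im, Complex.ofReal_im, zero_add]
      rw [← h1]
      simp [Matrix.mulVec, dotProduct, Y]
  refine ⟨_, ⟨(fun j => Int.fract (x j), fun j => Int.fract (y j)), ⟨⟨?_, ?_⟩, ⟨?_, ?_⟩⟩, rfl⟩,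
    fun j => ⌊x j⌋, fun j => ⌊y j⌋, ?_⟩
  · exact fun j => Int.fract_nonneg _
  · exact fun j => Int.fract_nonneg _
  · exact fun j => (Int.fract_lt_one _).le
  · exact fun j => (Int.fract_lt_one _).le
  · have h1 : (fun j => (x j : ℂ)) = (fun j => ((Int.fract (x j) : ℝ) : ℂ)) +
        intVec fun j => ⌊x j⌋ := by
      ext j
      simp only [intVec, Pi.add_apply]
      exact_mod_cast (Int.fract_add_floor (x j)).symm
    have h2 : (fun j => (y j : ℂ)) = (fun j => ((Int.fract (y j) : ℝ) : ℂ)) +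
        intVec fun j => ⌊y j⌋ := by
      ext j
      simp only [intVec, Pi.add_apply]
      exact_mod_cast (Int.fract_add_floor (y j)).symm
    rw [hz, h1, h2, Matrix.mulVec_add]
    simp only [f]
    abel

/-- Reduction modulo `b`: the first nonzero entry of `n` is divisible by `b`. -/
theorem le_natAbs_of_sum_mul_pow_eq_zero {b : ℕ} (hb : 0 < b) :
    ∀ {g : ℕ} {n : Fin g → ℤ}, n ≠ 0 → ∑ j, n j * (b : ℤ) ^ (j : ℕ) = 0 → ∃ j, b ≤ (n j).natAbs := by
  intro g
  induction g with
  | zero => exact fun h _ => absurd (Subsingleton.elim _ _) h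
  | succ g ih =>
    intro n hn h
    rw [Fin.sum_univ_succ] at h
    have h1 : ∑ j : Fin g, n j.succ * (b : ℤ) ^ (j.succ : ℕ) =
        b * ∑ j : Fin g, n j.succ * (b : ℤ) ^ (j : ℕ) := by
      rw [Finset.mul_sum]
      refine Finset.sum_congr rfl fun j _ => ?_
      rw [Fin.val_succ, pow_succ]
      ring
    rw [h1, Fin.val_zero, pow_zero, mul_one] at h
    by_cases h0 : n 0 = 0
    · rw [h0, zero_add] at h
      have h2 := (mul_eq_zero.1 h).resolve_left (by exact_mod_cast hb.ne')
      have h3 : (fun j : Fin g => n j.succ) ≠ 0 := fun hcon =>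
        hn (funext fun j => Fin.cases h0 (fun j => congr_fun hcon j) j)
      obtain ⟨j, hj⟩ := ih h3 h2
      exact ⟨j.succ, hj⟩
    · refine ⟨0, Nat.le_of_dvd (Int.natAbs_pos.2 h0) ?_⟩
      rw [← Int.natCast_dvd]
      exact ⟨-∑ j : Fin g, n j.succ * (b : ℤ) ^ (j : ℕ), by linarith⟩

theorem theta_add_lattice_smul (hτ : τ ∈ siegelSpace g) (z v : Fin g → ℂ) (m m' : Fin g → ℤ) :
    theta τ (z + intVec m + τ *ᵥ intVec m' + v) =
      automorphyFactor τ m' (z + v) * theta τ (z + v) := by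
  rw [show z + intVec m + τ *ᵥ intVec m' + v = (z + v) + τ *ᵥ intVec m' + intVec m by abel,
    theta_add_intVec, theta_add_mulVec hτ.1]

/-- For `w = (1, b, b², …)` the zeroth Fourier coefficient in `t` of `θ (k + t w)` collects the `n`
orthogonal to `w`. The term `n = 0` is `1`; any other such `n` has an entry of size at least `b`, so
for large `b` these terms lie in a tail of sum below `1 / 2`. Translation into a compact fundamental
domain makes `b` independent of `z`. -/
theorem exists_forall_exists_theta_ne_zero (hτ : τ ∈ siegelSpace g) :
    ∃ b₀ : ℕ, ∀ b ≥ b₀, ∀ z, ∃ t : ℂ,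
      theta τ (z + t • intVec fun j => (b : ℤ) ^ (j : ℕ)) ≠ 0 := by
  classical
  obtain ⟨K, hK, hfund⟩ := exists_isCompact_fundamental hτ
  obtain ⟨R, hR⟩ := hK.isBounded.exists_norm_le
  obtain ⟨u, hu, hbound⟩ := exists_summable_bound_thetaTerm hτ 0 R
  simp only [show (fun j : Fin g => (((0 : Fin g → ℝ) j : ℝ) : ℂ)) = 0 by ext; simp, add_zero]
    at hbound
  have hu0 : ∀ z : Fin g → ℂ, ‖z‖ ≤ R → ∀ n, ‖thetaTerm τ (intVec n) z‖ ≤ u n := fun z hz n =>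
    hbound n z fun j => (Complex.abs_im_le_norm _).trans ((norm_le_pi_norm z j).trans hz)
  obtain ⟨T, hT⟩ := (summable_iff_vanishing_norm.1 hu) (1 / 2) one_half_pos
  set T' := insert 0 T
  refine ⟨1 + ∑ n ∈ T', ∑ j, (n j).natAbs, fun b hb z => ?_⟩
  obtain ⟨k, hk, m, m', rfl⟩ := hfund z
  simp only [theta_add_lattice_smul hτ]
  set w : Fin g → ℤ := fun j => (b : ℤ) ^ (j : ℕ)
  by_contra! hcon
  have hcon' : ∀ t : ℂ, theta τ (k + t • intVec w) = 0 := fun t =>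
    (mul_eq_zero.1 (hcon t)).resolve_left (automorphyFactor_ne_zero _ _)
  have hsum := summable_norm_theta hτ k
  have h1 := tsum_ite_eq_zero_of_tsum_mFourier_eq_zero (d := Fin 1) hsum
    (fun n _ => ∑ j, n j * w j) (fun t => ?_) 0
  · set a : (Fin g → ℤ) → ℂ := fun n =>
      if (fun _ : Fin 1 => ∑ j, n j * w j) = 0 then thetaTerm τ (intVec n) k else 0
    have ha : ∀ n, ‖a n‖ ≤ u n := fun n => by
      have := hu0 k (hR k hk) n
      simp only [a]
      split_ifs
      · exact this
      · simpa using (norm_nonneg _).trans this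
    have ha0 : a 0 = 1 := by
      have : intVec (0 : Fin g → ℤ) = 0 := by ext; simp [intVec]
      simp only [a]
      rw [if_pos (by ext; simp), this]
      simp [thetaTerm]
    have haT : ∀ n ∈ T', n ≠ 0 → a n = 0 := by
      intro n hn hn0
      refine if_neg fun h => ?_
      obtain ⟨j, hj⟩ := le_natAbs_of_sum_mul_pow_eq_zero (b := b) (by omega) hn0 (congr_fun h 0)
      have h2 : (n j).natAbs ≤ ∑ j, (n j).natAbs :=
        Finset.single_le_sum (f := fun j => (n j).natAbs) (fun _ _ => Nat.zero_le _)
          (Finset.mem_univ j)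
      have h3 := Finset.single_le_sum (f := fun n : Fin g → ℤ => ∑ j, (n j).natAbs)
        (fun _ _ => Nat.zero_le _) hn
      omega
    have hlim : HasSum a 0 := by
      have : Summable a := Summable.of_norm_bounded hu ha
      convert this.hasSum
      rw [← h1]
    obtain ⟨s, hs1, hs2⟩ := ((eventually_ge_atTop T').and
      (hlim.norm.eventually_lt_const (u := 1 / 2) (by simp))).exists
    have h2 : ∑ n ∈ s, a n = 1 + ∑ n ∈ s \ T', a n := by
      rw [← Finset.sum_sdiff hs1, add_comm, Finset.sum_eq_single_of_mem 0 (Finset.mem_insert_self _ _)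
        fun n hn hn0 => haT n hn hn0, ha0]
    have h3 : ‖∑ n ∈ s \ T', a n‖ < 1 / 2 := by
      refine (norm_sum_le_of_le _ fun n _ => ha n).trans_lt ((le_abs_self _).trans_lt
        (hT (s \ T') ?_))
      exact Finset.sdiff_disjoint.mono_right (Finset.subset_insert _ _)
    rw [h2] at hs2
    have h4 : (1 : ℂ) = (1 + ∑ n ∈ s \ T', a n) - ∑ n ∈ s \ T', a n := by ring
    have h5 := norm_sub_le (1 + ∑ n ∈ s \ T', a n) (∑ n ∈ s \ T', a n)
    rw [← h4, norm_one] at h5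
    linarith
  · obtain ⟨x, hx⟩ := QuotientAddGroup.mk_surjective (t 0)
    obtain rfl : (fun j => (((fun _ : Fin 1 => x) j : ℝ) : UnitAddCircle)) = t := by
      ext j
      rw [Subsingleton.elim j 0]
      exact hx
    rw [← hcon' x, theta_eq]
    refine tsum_congr fun n => ?_
    rw [mFourier_coe, thetaTerm_add_right, dotProduct_smul]
    congr 3
    simp only [intVec, dotProduct, Finset.univ_unique, Finset.sum_singleton, smul_eq_mul]
    push_cast
    ring

/-- For `w = (1, b, b², …)` the value of `L` is a nonzero polynomial in `b`, so some large `b` is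
not a root. -/
theorem exists_intVec_apply_ne_zero_and_theta_ne_zero (hτ : τ ∈ siegelSpace g)
    {L : (Fin g → ℂ) →L[ℂ] ℂ} (hL : L ≠ 0) :
    ∃ w : Fin g → ℤ, L (intVec w) ≠ 0 ∧ ∀ z, ∃ t : ℂ, theta τ (z + t • intVec w) ≠ 0 := by
  classical
  obtain ⟨b₀, hb₀⟩ := exists_forall_exists_theta_ne_zero hτ
  set P : Polynomial ℂ := ∑ j : Fin g, Polynomial.C (L (Pi.single j 1)) * Polynomial.X ^ (j : ℕ)
  have hP : P ≠ 0 := by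
    intro h0
    refine hL ?_
    have h1 : ∀ j : Fin g, L (Pi.single j 1) = 0 := fun j => by
      have h2 := congr_arg (fun Q => Polynomial.coeff Q (j : ℕ)) h0
      simpa [P, Polynomial.finsetSum_coeff, Polynomial.coeff_C_mul, Polynomial.coeff_X_pow,
        Fin.val_inj] using h2
    ext v
    have : v = ∑ j : Fin g, v j • Pi.single j (1 : ℂ) := by
      ext i
      simp [Finset.sum_apply, Pi.single_apply]
    rw [this, map_sum]
    exact Finset.sum_eq_zero fun j _ => by rw [map_smul, h1, smul_zero]
  obtain ⟨b, hb, hbP⟩ : ∃ b ≥ b₀, P.eval (b : ℂ) ≠ 0 := by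
    have hfin : {b : ℕ | P.eval (b : ℂ) = 0}.Finite := by
      refine (P.roots.toFinset.finite_toSet.preimage
        (Nat.cast_injective (R := ℂ)).injOn).subset fun b hb => ?_
      simpa [hP] using hb
    obtain ⟨b, hb1, hb2⟩ := (Set.Ici_infinite b₀).exists_notMem_finite hfin
    exact ⟨b, hb1, hb2⟩
  refine ⟨fun j => (b : ℤ) ^ (j : ℕ), ?_, hb₀ b hb⟩
  convert hbP
  have : intVec (fun j : Fin g => (b : ℤ) ^ (j : ℕ)) =
      ∑ j : Fin g, ((b : ℂ) ^ (j : ℕ)) • Pi.single j (1 : ℂ) := by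
    ext i
    simp [intVec, Finset.sum_apply, Pi.single_apply]
  rw [this, map_sum]
  simp only [P, Polynomial.eval_finsetSum, map_smul, smul_eq_mul, Polynomial.eval_mul,
    Polynomial.eval_C, Polynomial.eval_pow, Polynomial.eval_X]
  exact Finset.sum_congr rfl fun j _ => mul_comm _ _

end Lattice

/-! ### Theta on lines of an integral direction, as a function on the punctured plane. -/

section Slice

open Metric Set

variable {g : ℕ} {τ : Matrix (Fin g) (Fin g) ℂ} {w : Fin g → ℤ}

/-- The restrictions of the theta function to the complex lines in an integral direction `w`, as
functions of the exponential coordinate `q = exp (2 π i t)`. -/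
noncomputable def thetaSlice (τ : Matrix (Fin g) (Fin g) ℂ) (w : Fin g → ℤ)
    (p : (Fin g → ℂ) × ℂ) : ℂ :=
  theta τ (p.1 + (Complex.log p.2 / (2 * Real.pi * Complex.I)) • intVec w)

theorem thetaSlice_exp (z : Fin g → ℂ) (t : ℂ) :
    thetaSlice τ w (z, Complex.exp (2 * Real.pi * Complex.I * t)) = theta τ (z + t • intVec w) := by
  obtain ⟨n, hn⟩ := Complex.exp_eq_exp_iff_exists_int.1
    (Complex.exp_log (Complex.exp_ne_zero (2 * Real.pi * Complex.I * t)))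
  have hpi : (2 * Real.pi * Complex.I : ℂ) ≠ 0 := Complex.two_pi_I_ne_zero
  have h1 : Complex.log (Complex.exp (2 * Real.pi * Complex.I * t)) / (2 * Real.pi * Complex.I) =
      t + n := by
    rw [hn]
    field_simp
  rw [thetaSlice]
  simp only [h1]
  rw [add_smul, ← add_assoc]
  have h2 : (n : ℂ) • intVec w = intVec (n • w) := by
    ext j
    simp [intVec]
  rw [h2, theta_add_intVec]

theorem thetaSlice_eq {q t : ℂ} (h : Complex.exp (2 * Real.pi * Complex.I * t) = q)
    (z : Fin g → ℂ) : thetaSlice τ w (z, q) = theta τ (z + t • intVec w) := by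
  rw [← h, thetaSlice_exp]

theorem exists_exp_eq {q : ℂ} (hq : q ≠ 0) : ∃ t, Complex.exp (2 * Real.pi * Complex.I * t) = q := by
  refine ⟨Complex.log q / (2 * Real.pi * Complex.I), ?_⟩
  rw [mul_div_cancel₀ _ Complex.two_pi_I_ne_zero, Complex.exp_log hq]

theorem thetaSlice_one (z : Fin g → ℂ) : thetaSlice τ w (z, 1) = theta τ z := by
  rw [thetaSlice_eq (t := 0) (by simp)]
  simp

theorem isOpen_snd_ne_zero : IsOpen {p : (Fin g → ℂ) × ℂ | p.2 ≠ 0} :=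
  isOpen_ne_fun continuous_snd continuous_const

theorem differentiableOn_thetaSlice (hτ : τ ∈ siegelSpace g) (w : Fin g → ℤ) :
    DifferentiableOn ℂ (thetaSlice τ w) {p | p.2 ≠ 0} := by
  rintro ⟨z₀, q₀⟩ hq₀
  change q₀ ≠ 0 at hq₀
  refine DifferentiableAt.differentiableWithinAt ?_
  obtain ⟨t₀, ht₀⟩ := exists_exp_eq hq₀
  have hpi : (2 * Real.pi * Complex.I : ℂ) ≠ 0 := Complex.two_pi_I_ne_zero
  -- A branch of the logarithm centred at `q₀` replaces the principal one, whose cut may pass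
  -- through `q₀`.
  have heq : thetaSlice τ w =ᶠ[𝓝 (z₀, q₀)] fun p => theta τ (p.1 +
      (t₀ + (2 * Real.pi * Complex.I)⁻¹ * Complex.log (q₀⁻¹ * p.2)) • intVec w) := by
    filter_upwards [isOpen_snd_ne_zero.mem_nhds (show (z₀, q₀) ∈ {p : (Fin g → ℂ) × ℂ | p.2 ≠ 0}
      from hq₀)] with p hp
    refine thetaSlice_eq (τ := τ) (w := w) (q := p.2) ?_ p.1
    rw [mul_add, Complex.exp_add, ht₀, mul_inv_cancel_left₀ hpi,
      Complex.exp_log (mul_ne_zero (inv_ne_zero hq₀) hp), mul_inv_cancel_left₀ hq₀]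
  refine DifferentiableAt.congr_of_eventuallyEq ?_ heq
  refine (differentiable_theta hτ _).comp _ ?_
  have h1 : DifferentiableAt ℂ (fun p : (Fin g → ℂ) × ℂ => Complex.log (q₀⁻¹ * p.2)) (z₀, q₀) := by
    have h2 : (fun p : (Fin g → ℂ) × ℂ => q₀⁻¹ * p.2) (z₀, q₀) ∈ Complex.slitPlane := by
      simp [hq₀]
    exact DifferentiableAt.clog (by fun_prop) h2
  fun_prop

theorem differentiableAt_thetaSlice_snd (hτ : τ ∈ siegelSpace g) (w : Fin g → ℤ) (z : Fin g → ℂ)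
    {q : ℂ} (hq : q ≠ 0) : DifferentiableAt ℂ (fun q => thetaSlice τ w (z, q)) q :=
  (hasDerivAt_slice ((differentiableOn_thetaSlice hτ w).differentiableAt
    (isOpen_snd_ne_zero.mem_nhds hq))).differentiableAt

theorem thetaSlice_add_intVec (m : Fin g → ℤ) (z : Fin g → ℂ) (q : ℂ) :
    thetaSlice τ w (z + intVec m, q) = thetaSlice τ w (z, q) := by
  simp only [thetaSlice]
  rw [add_right_comm, theta_add_intVec]

theorem thetaSlice_add_mulVec (hτ : τ ∈ siegelSpace g) (m : Fin g → ℤ) (z : Fin g → ℂ) {q : ℂ}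
    (hq : q ≠ 0) : thetaSlice τ w (z + τ *ᵥ intVec m, q) =
      automorphyFactor τ m z * q ^ (-∑ j, m j * w j) * thetaSlice τ w (z, q) := by
  obtain ⟨t, rfl⟩ := exists_exp_eq hq
  rw [thetaSlice_exp, thetaSlice_exp, add_right_comm, theta_add_mulVec hτ.1, ← Complex.exp_int_mul]
  congr 1
  rw [automorphyFactor, automorphyFactor, ← Complex.exp_add]
  congr 1
  have : (((-∑ j, m j * w j : ℤ)) : ℂ) = -(intVec m ⬝ᵥ intVec w) := by
    simp [intVec, dotProduct]
  rw [this]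
  simp only [smul_add, dotProduct_add, dotProduct_smul, smul_eq_mul]
  ring

theorem thetaSlice_add_smul (z : Fin g → ℂ) (s : ℂ) {q : ℂ} (hq : q ≠ 0) :
    thetaSlice τ w (z + s • intVec w, q) =
      thetaSlice τ w (z, q * Complex.exp (2 * Real.pi * Complex.I * s)) := by
  obtain ⟨t, rfl⟩ := exists_exp_eq hq
  rw [← Complex.exp_add, ← mul_add, thetaSlice_exp, thetaSlice_exp, add_assoc, ← add_smul,
    add_comm s]

/-- The set of multiple zeros of `thetaSlice τ w (z, ·)` in the punctured plane. -/
def multipleZeros (τ : Matrix (Fin g) (Fin g) ℂ) (w : Fin g → ℤ) (z : Fin g → ℂ) : Set ℂ :=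
  {q | q ≠ 0 ∧ thetaSlice τ w (z, q) = 0 ∧ deriv (fun q => thetaSlice τ w (z, q)) q = 0}

theorem multipleZeros_add_intVec (m : Fin g → ℤ) (z : Fin g → ℂ) :
    multipleZeros τ w (z + intVec m) = multipleZeros τ w z := by
  simp only [multipleZeros, thetaSlice_add_intVec]

/-- A quasi-period multiplies the slice by a nowhere vanishing function of `q ≠ 0`, which preserves
zeros and their being multiple. -/
theorem multipleZeros_add_mulVec (hτ : τ ∈ siegelSpace g) (m : Fin g → ℤ) (z : Fin g → ℂ) :
    multipleZeros τ w (z + τ *ᵥ intVec m) = multipleZeros τ w z := by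
  ext q
  refine and_congr_right fun hq => ?_
  rw [thetaSlice_add_mulVec hτ m z hq]
  have hu : automorphyFactor τ m z * q ^ (-∑ j, m j * w j) ≠ 0 :=
    mul_ne_zero (automorphyFactor_ne_zero _ _) (zpow_ne_zero _ hq)
  rw [mul_eq_zero, or_iff_right hu]
  refine and_congr_right fun h0 => ?_
  have heq : (fun q => thetaSlice τ w (z + τ *ᵥ intVec m, q)) =ᶠ[𝓝 q] fun q =>
      automorphyFactor τ m z * q ^ (-∑ j, m j * w j) * thetaSlice τ w (z, q) := by
    filter_upwards [eventually_ne_nhds hq] with q hq using thetaSlice_add_mulVec hτ m z hq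
  have hd : DifferentiableAt ℂ (fun q : ℂ => automorphyFactor τ m z * q ^ (-∑ j, m j * w j)) q :=
    (differentiableAt_zpow.2 (Or.inl hq)).const_mul _
  have h1 := (hd.hasDerivAt.mul (differentiableAt_thetaSlice_snd hτ w z hq).hasDerivAt).deriv
  rw [h0, mul_zero, zero_add] at h1
  rw [heq.deriv_eq]
  change deriv ((fun q : ℂ => automorphyFactor τ m z * q ^ (-∑ j, m j * w j)) *
    fun q => thetaSlice τ w (z, q)) q = 0 ↔ _
  rw [h1, mul_eq_zero, or_iff_right hu]

end Slice

/-! ### Uniform zero counts in dyadic annuli. -/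

section ZeroCount

open Metric Set

variable {g : ℕ} {τ : Matrix (Fin g) (Fin g) ℂ} {w : Fin g → ℤ}

theorem eventually_thetaSlice_ne_zero (hτ : τ ∈ siegelSpace g)
    (hw : ∀ z, ∃ t : ℂ, theta τ (z + t • intVec w) ≠ 0) (z : Fin g → ℂ) {q : ℂ} (hq : q ≠ 0) :
    ∀ᶠ y in 𝓝[≠] q, thetaSlice τ w (z, y) ≠ 0 := by
  obtain ⟨t, ht⟩ := hw z
  rw [← thetaSlice_exp] at ht
  exact eventually_ne_zero_of_preconnected (δ := fun q => thetaSlice τ w (z, q)) (U := {0}ᶜ)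
    isOpen_compl_singleton
    (isConnected_compl_singleton_of_one_lt_rank (by simp) 0).isPreconnected
    (fun q hq => (differentiableAt_thetaSlice_snd hτ w z hq).differentiableWithinAt)
    (Complex.exp_ne_zero _) ht q hq

theorem isCompact_annulus (a b : ℝ) : IsCompact {q : ℂ | a ≤ ‖q‖ ∧ ‖q‖ ≤ b} := by
  refine (isCompact_closedBall (0 : ℂ) b).of_isClosed_subset ?_ fun q hq => by simpa using hq.2
  exact (isClosed_le continuous_const continuous_norm).inter
    (isClosed_le continuous_norm continuous_const)

theorem closure_annulus_subset (a b : ℝ) :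
    closure {q : ℂ | a < ‖q‖ ∧ ‖q‖ < b} ⊆ {q : ℂ | a ≤ ‖q‖ ∧ ‖q‖ ≤ b} :=
  closure_minimal (fun _ hq => ⟨hq.1.le, hq.2.le⟩) (isCompact_annulus a b).isClosed

theorem isOpen_annulus (a b : ℝ) : IsOpen {q : ℂ | a < ‖q‖ ∧ ‖q‖ < b} :=
  (isOpen_lt continuous_const continuous_norm).inter (isOpen_lt continuous_norm continuous_const)

theorem isCompact_closure_annulus (a b : ℝ) : IsCompact (closure {q : ℂ | a < ‖q‖ ∧ ‖q‖ < b}) :=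
  (isCompact_annulus a b).of_isClosed_subset isClosed_closure (closure_annulus_subset a b)

theorem isolatedZeros_annulus (hτ : τ ∈ siegelSpace g)
    (hw : ∀ z, ∃ t : ℂ, theta τ (z + t • intVec w) ≠ 0) {z : Fin g → ℂ} {a b : ℝ} (ha : 0 < a)
    (h : ∀ q : ℂ, ‖q‖ = a ∨ ‖q‖ = b → thetaSlice τ w (z, q) ≠ 0) :
    IsolatedZeros (thetaSlice τ w) {p | p.2 ≠ 0} {q : ℂ | a < ‖q‖ ∧ ‖q‖ < b} z := by
  have h0 : ∀ q ∈ closure {q : ℂ | a < ‖q‖ ∧ ‖q‖ < b}, q ≠ 0 := fun q hq =>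
    norm_pos_iff.1 (ha.trans_le (closure_annulus_subset a b hq).1)
  refine ⟨h0, fun q hq hq0 => ?_, fun q hq => eventually_thetaSlice_ne_zero hτ hw z (h0 q hq)⟩
  have h1 := closure_annulus_subset a b hq
  exact ⟨lt_of_le_of_ne h1.1 fun he => h q (Or.inl he.symm) hq0,
    lt_of_le_of_ne h1.2 fun he => h q (Or.inr he) hq0⟩

theorem exists_radius_thetaSlice_ne_zero (hτ : τ ∈ siegelSpace g)
    (hw : ∀ z, ∃ t : ℂ, theta τ (z + t • intVec w) ≠ 0) (z : Fin g → ℂ) {a b : ℝ} (ha : 0 < a)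
    (hab : a < b) : ∃ r, a < r ∧ r < b ∧ ∀ q : ℂ, ‖q‖ = r → thetaSlice τ w (z, q) ≠ 0 := by
  have hfin : {q ∈ {q : ℂ | a ≤ ‖q‖ ∧ ‖q‖ ≤ b} | thetaSlice τ w (z, q) = 0}.Finite :=
    finite_zeros_of_isCompact (f := fun q => thetaSlice τ w (z, q)) (isCompact_annulus a b)
      fun q hq => eventually_thetaSlice_ne_zero hτ hw z (norm_pos_iff.1 (ha.trans_le hq.1))
  obtain ⟨r, hr, hr'⟩ := (Ioo_infinite hab).exists_notMem_finite (hfin.image norm)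
  refine ⟨r, hr.1, hr.2, ?_⟩
  rintro q rfl h0
  exact hr' ⟨q, ⟨⟨hr.1.le, hr.2.le⟩, h0⟩, rfl⟩

theorem exists_uniform_radius_of_compact (hτ : τ ∈ siegelSpace g)
    (hw : ∀ z, ∃ t : ℂ, theta τ (z + t • intVec w) ≠ 0) {K : Set (Fin g → ℂ)} (hK : IsCompact K) :
    ∃ δ > 0, ∃ N : ℕ, ∀ z ∈ K, ∃ r, 1 < r ∧ r < 2 ∧ ∀ z' ∈ ball z δ,
      (∀ q : ℂ, ‖q‖ = r → thetaSlice τ w (z', q) ≠ 0) ∧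
      ∃ Z : Finset ℂ, Z.card ≤ N ∧ ∀ q : ℂ, 1 ≤ ‖q‖ → ‖q‖ ≤ 4 → thetaSlice τ w (z', q) = 0 → q ∈ Z := by
  refine hK.induction_on (p := fun K => ∃ δ > 0, ∃ N : ℕ, ∀ z ∈ K, ∃ r, 1 < r ∧ r < 2 ∧
    ∀ z' ∈ ball z δ, (∀ q : ℂ, ‖q‖ = r → thetaSlice τ w (z', q) ≠ 0) ∧
      ∃ Z : Finset ℂ, Z.card ≤ N ∧ ∀ q : ℂ, 1 ≤ ‖q‖ → ‖q‖ ≤ 4 → thetaSlice τ w (z', q) = 0 → q ∈ Z)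
    ⟨1, one_pos, 0, by simp⟩ ?_ ?_ ?_
  · rintro s t hst ⟨δ, hδ, N, h⟩
    exact ⟨δ, hδ, N, fun z hz => h z (hst hz)⟩
  · rintro s t ⟨δ, hδ, N, h⟩ ⟨δ', hδ', N', h'⟩
    refine ⟨min δ δ', lt_min hδ hδ', max N N', fun z hz => ?_⟩
    rcases hz with hz | hz
    · obtain ⟨r, h1, h2, h3⟩ := h z hz
      refine ⟨r, h1, h2, fun z' hz' => ?_⟩
      obtain ⟨h4, Z, hZ, h5⟩ := h3 z' (ball_subset_ball (min_le_left _ _) hz')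
      exact ⟨h4, Z, hZ.trans (le_max_left _ _), h5⟩
    · obtain ⟨r, h1, h2, h3⟩ := h' z hz
      refine ⟨r, h1, h2, fun z' hz' => ?_⟩
      obtain ⟨h4, Z, hZ, h5⟩ := h3 z' (ball_subset_ball (min_le_right _ _) hz')
      exact ⟨h4, Z, hZ.trans (le_max_right _ _), h5⟩
  · intro z₀ _
    obtain ⟨r, hr1, hr2, hr⟩ := exists_radius_thetaSlice_ne_zero hτ hw z₀ one_pos one_lt_two
    -- The radii `a` and `b` serve to enclose `1 ≤ ‖q‖ ≤ 4` in an annulus with zero-free boundary,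
    -- where the zero count is locally constant in `z`.
    obtain ⟨a, ha1, ha2, ha⟩ := exists_radius_thetaSlice_ne_zero hτ hw z₀ one_half_pos one_half_lt_one
    obtain ⟨b, hb1, hb2, hb⟩ := exists_radius_thetaSlice_ne_zero hτ hw z₀ (a := 4) (b := 5)
      (by norm_num) (by norm_num)
    have hφ := differentiableOn_thetaSlice hτ w
    have hiso := isolatedZeros_annulus hτ hw (z := z₀) (a := a) (b := b) (by linarith)
      (by rintro q (h | h); exacts [ha q h, hb q h])
    obtain ⟨P, hP⟩ := hiso.exists_moments isOpen_snd_ne_zero hφ (isOpen_annulus a b)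
      (isCompact_closure_annulus a b)
    have hcirc : ∀ᶠ z in 𝓝 z₀, ∀ q ∈ sphere (0 : ℂ) r, thetaSlice τ w (z, q) ≠ 0 := by
      refine (isCompact_sphere (0 : ℂ) r).eventually_forall_of_forall_eventually fun q hq => ?_
      rw [mem_sphere_zero_iff_norm] at hq
      have hq0 : q ≠ 0 := norm_pos_iff.1 (by linarith)
      exact (hφ.continuousOn.continuousAt (isOpen_snd_ne_zero.mem_nhds hq0)).eventually_ne (hr q hq)
    obtain ⟨ε, hε, hball⟩ := Metric.eventually_nhds_iff_ball.1 (hP.and hcirc)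
    obtain ⟨n, hn⟩ : ∃ n : ℕ, P 0 z₀ = n := by
      obtain ⟨-, -, Z, -, -, hZ⟩ := (hball z₀ (mem_ball_self hε)).1
      exact ⟨∑ y ∈ Z, analyticOrderNatAt (fun y => thetaSlice τ w (z₀, y)) y, by simpa using hZ 0⟩
    refine ⟨ball z₀ (ε / 2), mem_nhdsWithin_of_mem_nhds (ball_mem_nhds _ (by positivity)), ε / 2,
      by positivity, n, fun z hz => ⟨r, hr1, hr2, fun z' hz' => ?_⟩⟩
    have hz'' : z' ∈ ball z₀ ε := by
      rw [mem_ball] at hz hz' ⊢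
      exact (dist_triangle _ _ _).trans_lt (by linarith)
    obtain ⟨⟨-, h0, Z, hZ, hZ1, hZm⟩, hc⟩ := hball z' hz''
    refine ⟨fun q hq => hc q (by simpa using hq), Z, ?_, fun q h1 h4 hq0 =>
      (hZ q).2 ⟨⟨by linarith, by linarith⟩, hq0⟩⟩
    have h1 := hZm 0
    rw [h0, hn] at h1
    have h2 : n = ∑ y ∈ Z, analyticOrderNatAt (fun y => thetaSlice τ w (z', y)) y := by
      have : (n : ℂ) = ((∑ y ∈ Z, analyticOrderNatAt (fun y => thetaSlice τ w (z', y)) y : ℕ) : ℂ) := by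
        simpa using h1
      exact_mod_cast this
    rw [h2, Finset.card_eq_sum_ones]
    exact Finset.sum_le_sum fun y hy => hZ1 y hy

/-- A shift of `z` by `s • w` with `exp (2 π i s) = 2 ^ j` rescales the annulus of index `j` to that
of index `0`; a lattice translation then brings `z` into a compact set. -/
theorem exists_uniform_radius (hτ : τ ∈ siegelSpace g)
    (hw : ∀ z, ∃ t : ℂ, theta τ (z + t • intVec w) ≠ 0) :
    ∃ δ > 0, ∃ N : ℕ, ∀ (z : Fin g → ℂ) (j : ℤ), ∃ r, (2 : ℝ) ^ j < r ∧ r < 2 ^ (j + 1) ∧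
      ∀ z' ∈ ball z δ, (∀ q : ℂ, ‖q‖ = r → thetaSlice τ w (z', q) ≠ 0) ∧
      ∃ Z : Finset ℂ, Z.card ≤ N ∧
        ∀ q : ℂ, 2 ^ j ≤ ‖q‖ → ‖q‖ ≤ 2 ^ (j + 2) → thetaSlice τ w (z', q) = 0 → q ∈ Z := by
  classical
  obtain ⟨K, hK, hfund⟩ := exists_isCompact_fundamental hτ
  obtain ⟨δ, hδ, N, h⟩ := exists_uniform_radius_of_compact hτ hw hK
  refine ⟨δ, hδ, N, fun z j => ?_⟩
  have h2j : (0 : ℝ) < 2 ^ j := by positivity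
  set c : ℂ := Complex.ofReal (2 ^ j) with hc
  have hc0 : c ≠ 0 := by rw [hc]; exact_mod_cast h2j.ne'
  have hcn : ‖c‖ = 2 ^ j := by rw [hc, Complex.norm_real, Real.norm_of_nonneg h2j.le]
  obtain ⟨s, hs⟩ := exists_exp_eq hc0
  obtain ⟨k, hk, m, m', hz⟩ := hfund (z + s • intVec w)
  obtain ⟨r, hr1, hr2, hr⟩ := h k hk
  have hkey : ∀ z' q, q ≠ 0 → (thetaSlice τ w (z', q) = 0 ↔
      thetaSlice τ w (k + (z' - z), q * c⁻¹) = 0) := by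
    intro z' q hq
    have hq' : q * c⁻¹ ≠ 0 := mul_ne_zero hq (inv_ne_zero hc0)
    have h1 := thetaSlice_add_smul (τ := τ) (w := w) z' s hq'
    rw [hs, inv_mul_cancel_right₀ hc0,
      show z' + s • intVec w = (k + (z' - z)) + intVec m + τ *ᵥ intVec m' by
        rw [show z' + s • intVec w = (z + s • intVec w) + (z' - z) by abel, hz]; abel,
      thetaSlice_add_mulVec hτ _ _ hq', thetaSlice_add_intVec] at h1
    rw [← h1, mul_eq_zero, or_iff_right]
    exact mul_ne_zero (automorphyFactor_ne_zero _ _) (zpow_ne_zero _ hq')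
  have hnorm : ∀ q : ℂ, ‖q * c⁻¹‖ = ‖q‖ / 2 ^ j := fun q => by
    rw [norm_mul, norm_inv, hcn, div_eq_mul_inv]
  refine ⟨2 ^ j * r, ?_, ?_, fun z' hz' => ?_⟩
  · exact lt_mul_of_one_lt_right h2j hr1
  · rw [zpow_add_one₀ two_ne_zero]
    exact mul_lt_mul_of_pos_left hr2 h2j
  · obtain ⟨h1, Z, hZ, h2⟩ := hr (k + (z' - z)) (by
      rwa [mem_ball_iff_norm, add_sub_cancel_left, ← mem_ball_iff_norm])
    have hq0 : ∀ q : ℂ, 2 ^ j ≤ ‖q‖ → q ≠ 0 := fun q hq => norm_pos_iff.1 (h2j.trans_le hq)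
    refine ⟨fun q hq h0 => ?_, Z.image (· * c), Finset.card_image_le.trans hZ, fun q hq1 hq2 h0 => ?_⟩
    · have hq' : q ≠ 0 := hq0 q (hq ▸ (lt_mul_of_one_lt_right h2j hr1).le)
      refine h1 (q * c⁻¹) ?_ ((hkey z' q hq').1 h0)
      rw [hnorm, hq, mul_div_cancel_left₀ _ h2j.ne']
    · refine Finset.mem_image.2 ⟨q * c⁻¹, h2 _ ?_ ?_ ((hkey z' q (hq0 q hq1)).1 h0),
        inv_mul_cancel_right₀ hc0 q⟩
      · rwa [hnorm, one_le_div h2j]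
      · rw [hnorm, div_le_iff₀ h2j]
        rw [zpow_add₀ two_ne_zero] at hq2
        norm_num at hq2 ⊢
        linarith

end ZeroCount

/-! ### Decay of the Koebe function and convergence over dyadic annuli. -/

section KoebeSum

open Metric Set

/-- Decay at both ends of the punctured plane is what makes the sum over infinitely many annuli
converge. -/
theorem norm_koebe_le {ε : ℝ} (hε : 0 < ε) {q : ℂ} (hq : q ≠ 0) (h : ε ≤ ‖q - 1‖) :
    ‖koebe q‖ ≤ (4 + 4 / ε ^ 2) * min ‖q‖ ‖q‖⁻¹ := by
  have hq' : 0 < ‖q‖ := norm_pos_iff.2 hq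
  have h1 : ‖koebe q‖ = ‖q‖ / ‖q - 1‖ ^ 2 := by
    rw [koebe, norm_div, norm_pow, norm_sub_rev]
  have h0 : 0 < ‖q - 1‖ := hε.trans_le h
  rw [h1, div_le_iff₀ (by positivity)]
  have hA : 0 < 4 / ε ^ 2 := by positivity
  have htri1 : ‖q‖ ≤ ‖q - 1‖ + 1 := by
    calc ‖q‖ = ‖(q - 1) + 1‖ := by ring_nf
      _ ≤ _ := by simpa using norm_add_le (q - 1) 1
  have htri2 : 1 ≤ ‖q - 1‖ + ‖q‖ := by
    calc (1 : ℝ) = ‖q - (q - 1)‖ := by simp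
      _ ≤ _ := by simpa [add_comm] using norm_sub_le q (q - 1)
  have hmin0 : 0 < min ‖q‖ ‖q‖⁻¹ := lt_min hq' (inv_pos.2 hq')
  by_cases hfar : 1 / 2 ≤ ‖q‖ ∧ ‖q‖ ≤ 2
  · have h2 : ‖q‖ ≤ 4 * min ‖q‖ ‖q‖⁻¹ := by
      rcases min_cases ‖q‖ ‖q‖⁻¹ with ⟨he, -⟩ | ⟨he, -⟩ <;> rw [he]
      · linarith
      · rw [← div_eq_mul_inv, le_div_iff₀ hq']
        nlinarith [hfar.1, hfar.2]
    have h3 : ε ^ 2 ≤ ‖q - 1‖ ^ 2 := pow_le_pow_left₀ hε.le h 2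
    calc ‖q‖ ≤ 4 * min ‖q‖ ‖q‖⁻¹ := h2
      _ = 4 / ε ^ 2 * min ‖q‖ ‖q‖⁻¹ * ε ^ 2 := by field_simp
      _ ≤ (4 + 4 / ε ^ 2) * min ‖q‖ ‖q‖⁻¹ * ‖q - 1‖ ^ 2 := by
        gcongr
        linarith
  · have h2 : ‖q‖ ≤ 4 * min ‖q‖ ‖q‖⁻¹ * ‖q - 1‖ ^ 2 := by
      rcases not_and_or.1 hfar with hlt | hgt
      · push Not at hlt
        have h3 : 1 / 2 ≤ ‖q - 1‖ := by linarith
        have : min ‖q‖ ‖q‖⁻¹ = ‖q‖ := min_eq_left (by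
          rw [le_inv_comm₀ hq' hq', inv_eq_one_div, le_div_iff₀ hq']; nlinarith)
        rw [this]
        nlinarith [mul_le_mul h3 h3 (by norm_num) h0.le]
      · push Not at hgt
        have h3 : ‖q‖ / 2 ≤ ‖q - 1‖ := by linarith
        have : min ‖q‖ ‖q‖⁻¹ = ‖q‖⁻¹ := min_eq_right (by
          rw [inv_le_comm₀ hq' hq', inv_eq_one_div, div_le_iff₀ hq']; nlinarith)
        rw [this, mul_right_comm, ← div_eq_mul_inv, le_div_iff₀ hq']
        nlinarith [mul_le_mul h3 h3 (by positivity) h0.le]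
    refine h2.trans ?_
    gcongr
    linarith

theorem min_norm_inv_le {q : ℂ} (hq : q ≠ 0) {j : ℤ} (h1 : 2 ^ j ≤ ‖q‖) (h2 : ‖q‖ ≤ 2 ^ (j + 2)) :
    min ‖q‖ ‖q‖⁻¹ ≤ 4 * (2 : ℝ) ^ (-|j|) := by
  have hq' : 0 < ‖q‖ := norm_pos_iff.2 hq
  rcases le_total 0 j with hj | hj
  · rw [abs_of_nonneg hj]
    refine (min_le_right _ _).trans ?_
    have h3 : ‖q‖⁻¹ ≤ (2 : ℝ) ^ (-j) := by
      rw [zpow_neg]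
      exact inv_anti₀ (by positivity) h1
    have h4 : (0 : ℝ) < 2 ^ (-j) := by positivity
    linarith
  · rw [abs_of_nonpos hj, neg_neg]
    refine (min_le_left _ _).trans (h2.trans_eq ?_)
    rw [zpow_add₀ two_ne_zero]
    norm_num
    ring

theorem summable_two_zpow_neg_abs : Summable fun j : ℤ => (2 : ℝ) ^ (-|j|) := by
  have h : Summable fun n : ℕ => (2 : ℝ) ^ (-|(n : ℤ)|) := by
    simpa [zpow_neg] using summable_geometric_two
  exact Summable.of_nat_of_neg h (by simpa using h)

theorem two_zpow_log_le {q : ℂ} (hq : q ≠ 0) : (2 : ℝ) ^ Int.log 2 ‖q‖ ≤ ‖q‖ := by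
  exact_mod_cast Int.zpow_log_le_self (b := 2) one_lt_two (norm_pos_iff.2 hq)

theorem lt_two_zpow_log_add_one (q : ℂ) : ‖q‖ < (2 : ℝ) ^ (Int.log 2 ‖q‖ + 1) := by
  exact_mod_cast Int.lt_zpow_succ_log_self (b := 2) one_lt_two ‖q‖

theorem sum_norm_koebe_le {N : ℕ} {ε : ℝ} (hε : 0 < ε) (u : Finset ℂ) (hu : ∀ q ∈ u, q ≠ 0)
    (hu1 : ∀ q ∈ u, ε ≤ ‖q - 1‖) (hN : ∀ j : ℤ, (u.filter fun q => Int.log 2 ‖q‖ = j).card ≤ N) :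
    ∑ q ∈ u, ‖koebe q‖ ≤ N * ((4 + 4 / ε ^ 2) * 4) * ∑' j : ℤ, (2 : ℝ) ^ (-|j|) := by
  classical
  rw [← Finset.sum_fiberwise_of_maps_to (t := u.image fun q => Int.log 2 ‖q‖)
    fun q hq => Finset.mem_image_of_mem _ hq]
  calc _ ≤ ∑ j ∈ u.image fun q => Int.log 2 ‖q‖, N * ((4 + 4 / ε ^ 2) * 4) * (2 : ℝ) ^ (-|j|) := by
        refine Finset.sum_le_sum fun j _ => ?_
        have h1 : ∀ q ∈ u.filter fun q => Int.log 2 ‖q‖ = j,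
            ‖koebe q‖ ≤ (4 + 4 / ε ^ 2) * (4 * (2 : ℝ) ^ (-|j|)) := by
          intro q hq
          obtain ⟨hq1, rfl⟩ := Finset.mem_filter.1 hq
          refine (norm_koebe_le hε (hu q hq1) (hu1 q hq1)).trans ?_
          refine mul_le_mul_of_nonneg_left (min_norm_inv_le (hu q hq1) (two_zpow_log_le (hu q hq1))
            ((lt_two_zpow_log_add_one q).le.trans ?_)) (by positivity)
          exact zpow_le_zpow_right₀ one_le_two (by omega)
        refine (Finset.sum_le_card_nsmul _ _ _ h1).trans ?_
        rw [nsmul_eq_mul]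
        calc _ ≤ (N : ℝ) * ((4 + 4 / ε ^ 2) * (4 * (2 : ℝ) ^ (-|j|))) := by
              gcongr
              exact hN j
          _ = _ := by ring
    _ ≤ _ := by
        rw [← Finset.mul_sum]
        refine mul_le_mul_of_nonneg_left ?_ (by positivity)
        exact summable_two_zpow_neg_abs.sum_le_tsum _ fun j _ => by positivity

end KoebeSum

/-! ### The Koebe sum over all multiple zeros is generically constant. -/

section Extension

open Metric Set

variable {g : ℕ} {τ : Matrix (Fin g) (Fin g) ℂ} {w : Fin g → ℤ}

/-- The sum of the Koebe function over the multiple zeros of `thetaSlice τ w (z, ·)`. -/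
noncomputable def koebeSum (τ : Matrix (Fin g) (Fin g) ℂ) (w : Fin g → ℤ) (z : Fin g → ℂ) : ℂ :=
  ∑' q, (multipleZeros τ w z).indicator koebe q

/-- The constant does not depend on `z` because the zero counts in dyadic annuli do not; the proof
of reducedness relies on this. -/
theorem exists_bound_koebe_away (hτ : τ ∈ siegelSpace g)
    (hw : ∀ z, ∃ t : ℂ, theta τ (z + t • intVec w) ≠ 0) {ε : ℝ} (hε : 0 < ε) :
    ∃ C, ∀ z, ∀ u : Finset ℂ, (∀ q ∈ u, q ∈ multipleZeros τ w z ∧ ε ≤ ‖q - 1‖) →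
      ∑ q ∈ u, ‖koebe q‖ ≤ C := by
  obtain ⟨δ, hδ, N, h⟩ := exists_uniform_radius hτ hw
  refine ⟨_, fun z u hu => sum_norm_koebe_le (N := N) hε u (fun q hq => (hu q hq).1.1)
    (fun q hq => (hu q hq).2) fun j => ?_⟩
  obtain ⟨r, -, -, hr⟩ := h z j
  obtain ⟨-, Z, hZ, hmem⟩ := hr z (mem_ball_self hδ)
  refine (Finset.card_le_card fun q hq => ?_).trans hZ
  obtain ⟨hq1, rfl⟩ := Finset.mem_filter.1 hq
  refine hmem q (two_zpow_log_le (hu q hq1).1.1) ((lt_two_zpow_log_add_one q).le.trans ?_)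
    (hu q hq1).1.2.1
  exact zpow_le_zpow_right₀ one_le_two (by omega)

theorem koebe_one : koebe 1 = 0 := by simp [koebe]

theorem summable_koebe_multipleZeros (hτ : τ ∈ siegelSpace g)
    (hw : ∀ z, ∃ t : ℂ, theta τ (z + t • intVec w) ≠ 0) (z : Fin g → ℂ) :
    Summable ((multipleZeros τ w z).indicator koebe) := by
  classical
  obtain ⟨ε, hε, hball⟩ := Metric.mem_nhdsWithin_iff.1
    (eventually_thetaSlice_ne_zero hτ hw z one_ne_zero)
  obtain ⟨C, hC⟩ := exists_bound_koebe_away hτ hw hε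
  refine Summable.of_norm (summable_of_sum_le (c := C) (fun _ => norm_nonneg _) fun u => ?_)
  -- The index `1` can be dropped since `koebe 1 = 0`.
  refine le_trans (le_of_eq ?_) (hC z (u.filter fun q => q ∈ multipleZeros τ w z ∧ q ≠ 1) ?_)
  · rw [Finset.sum_filter]
    refine Finset.sum_congr rfl fun q _ => ?_
    by_cases hq : q ∈ multipleZeros τ w z
    · rcases eq_or_ne q 1 with rfl | h1
      · simp [indicator, koebe_one]
      · simp [indicator, hq, h1]
    · simp [indicator, hq]
  · intro q hq
    obtain ⟨-, hq1, hq2⟩ := Finset.mem_filter.1 hq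
    refine ⟨hq1, ?_⟩
    by_contra! hlt
    exact hball ⟨mem_ball_iff_norm.2 hlt, hq2⟩ hq1.2.1

theorem hasSum_multipleZeroSum (hτ : τ ∈ siegelSpace g)
    (hw : ∀ z, ∃ t : ℂ, theta τ (z + t • intVec w) ≠ 0) {z : Fin g → ℂ} {r : ℤ → ℝ}
    (hr1 : ∀ j, (2 : ℝ) ^ j < r j) (hr2 : ∀ j, r j < 2 ^ (j + 1))
    (hr : ∀ j (q : ℂ), ‖q‖ = r j → thetaSlice τ w (z, q) ≠ 0) :
    HasSum (fun j => multipleZeroSum (thetaSlice τ w) {q : ℂ | r j < ‖q‖ ∧ ‖q‖ < r (j + 1)} koebe z)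
      (koebeSum τ w z) := by
  classical
  -- The radius `r j` lies strictly between `2 ^ j` and `2 ^ (j + 1)`, so the annulus containing `q`
  -- is given by the dyadic index of `‖q‖` or by the one before it.
  let idx : ℂ → ℤ := fun q => if r (Int.log 2 ‖q‖) < ‖q‖ then Int.log 2 ‖q‖ else Int.log 2 ‖q‖ - 1
  have hidx : ∀ j q, q ∈ multipleZeros τ w z →
      (idx q = j ↔ r j < ‖q‖ ∧ ‖q‖ < r (j + 1)) := by
    intro j q hq
    have h1 := two_zpow_log_le hq.1
    have h2 := lt_two_zpow_log_add_one q
    set l := Int.log 2 ‖q‖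
    constructor
    · rintro rfl
      simp only [idx]
      split_ifs with h
      · exact ⟨h, h2.trans (hr1 _)⟩
      · refine ⟨?_, ?_⟩
        · have := hr2 (l - 1)
          rw [sub_add_cancel] at this
          exact this.trans_le h1
        · rw [sub_add_cancel]
          exact lt_of_le_of_ne (not_lt.1 h) fun he => hr _ q he hq.2.1
    · rintro ⟨h3, h4⟩
      have h5 : j < l + 1 := (zpow_lt_zpow_iff_right₀ (one_lt_two (α := ℝ))).1
        ((hr1 j).trans (h3.trans h2))
      have h6 : l < j + 1 + 1 := (zpow_lt_zpow_iff_right₀ (one_lt_two (α := ℝ))).1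
        (h1.trans_lt (h4.trans (hr2 _)))
      have h7 : l = j ∨ l = j + 1 := by omega
      rcases h7 with h7 | h7
      · change (if r l < ‖q‖ then l else l - 1) = j
        rw [if_pos (h7 ▸ h3), h7]
      · change (if r l < ‖q‖ then l else l - 1) = j
        rw [if_neg (not_lt.2 (h7 ▸ h4.le)), h7, add_sub_cancel_right]
  have hsum := (summable_koebe_multipleZeros hτ hw z).hasSum.tsum_fiberwise idx
  refine hsum.congr_fun ?_
  intro j
  have hpos : 0 < r j := (by positivity : (0 : ℝ) < 2 ^ j).trans (hr1 j)
  have hiso := isolatedZeros_annulus hτ hw (z := z) hpos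
    (by rintro q (h | h); exacts [hr j q h, hr (j + 1) q h])
  have hfin : {q | q ∈ {q : ℂ | r j < ‖q‖ ∧ ‖q‖ < r (j + 1)} ∧ thetaSlice τ w (z, q) = 0 ∧
      deriv (fun q => thetaSlice τ w (z, q)) q = 0}.Finite :=
    (finite_zeros_of_isCompact (isCompact_closure_annulus _ _) hiso.isolated).subset
      fun q hq => ⟨subset_closure hq.1, hq.2.1⟩
  rw [multipleZeroSum, finsum_mem_eq_finite_toFinset_sum _ hfin,
    tsum_subtype (idx ⁻¹' {j}) ((multipleZeros τ w z).indicator koebe),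
    tsum_eq_sum (s := hfin.toFinset)]
  · refine Finset.sum_congr rfl fun q hq => ?_
    have hq' := hfin.mem_toFinset.1 hq
    have hm : q ∈ multipleZeros τ w z := ⟨norm_pos_iff.1 (hpos.trans hq'.1.1), hq'.2⟩
    rw [indicator_of_mem (show q ∈ idx ⁻¹' {j} from (hidx j q hm).2 hq'.1), indicator_of_mem hm]
  · intro q hq
    rw [indicator_apply_eq_zero]
    intro hqj
    rw [indicator_apply_eq_zero]
    intro hm
    exact absurd (hfin.mem_toFinset.2 ⟨(hidx j q hm).1 hqj, hm.2⟩) hq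

theorem dense_theta_ne_zero (hτ : τ ∈ siegelSpace g) {z₁ : Fin g → ℂ} (h : theta τ z₁ ≠ 0) :
    Dense {z | theta τ z ≠ 0} := by
  intro z
  by_contra hz
  rw [mem_closure_iff_frequently, not_frequently] at hz
  refine h (eqOn_zero_of_convex_of_eventually_eq_zero isOpen_univ convex_univ
    (differentiable_theta hτ).differentiableOn (mem_univ z) ?_ z₁ (mem_univ _))
  exact hz.mono fun y hy => by simpa using hy

/-- Each annulus contributes a holomorphic function. The annulus of index `j` lies in `2 ^ j < ‖q‖ <
2 ^ (j + 2)`, so only those with `-2 ≤ j ≤ 0` can come closer than `1 / 2` to the pole; the others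
are dominated by a geometric series. -/
theorem holomorphicResiduallyAt_theta_mul_koebeSum (hτ : τ ∈ siegelSpace g)
    (hw : ∀ z, ∃ t : ℂ, theta τ (z + t • intVec w) ≠ 0) (z₁ : Fin g → ℂ) :
    HolomorphicResiduallyAt (fun z => theta τ z * koebeSum τ w z) z₁ := by
  classical
  obtain ⟨δ, hδ, N, h⟩ := exists_uniform_radius hτ hw
  choose r hr1 hr2 hr using h z₁
  have hrpos : ∀ j, 0 < r j := fun j => (by positivity : (0 : ℝ) < 2 ^ j).trans (hr1 j)
  have hφ := differentiableOn_thetaSlice hτ w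
  obtain ⟨t₁, ht₁⟩ := hw z₁
  have hd : Dense {z | thetaSlice τ w (z, 1) ≠ 0} := by
    simp only [thetaSlice_one]
    exact dense_theta_ne_zero hτ ht₁
  let A : ℤ → Set ℂ := fun j => {q : ℂ | r j < ‖q‖ ∧ ‖q‖ < r (j + 1)}
  have hiso : ∀ j, ∀ z ∈ ball z₁ δ, IsolatedZeros (thetaSlice τ w) {p | p.2 ≠ 0} (A j) z :=
    fun j z hz => isolatedZeros_annulus hτ hw (hrpos j)
      (by rintro q (h | h); exacts [(hr j z hz).1 q h, (hr (j + 1) z hz).1 q h])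
  have hblock : ∀ j, ∃ F' : (Fin g → ℂ) → ℂ, DifferentiableOn ℂ F' (ball z₁ δ) ∧
      ∀ᶠ z in residual (Fin g → ℂ), z ∈ ball z₁ δ → F' z =
        thetaSlice τ w (z, 1) * multipleZeroSum (thetaSlice τ w) (A j) koebe z := fun j =>
    exists_differentiableOn_of_holomorphicResiduallyAt isOpen_ball fun z hz =>
      holomorphicResiduallyAt_mul_multipleZeroSum hφ (isOpen_annulus _ _)
        (isCompact_closure_annulus _ _) hd (hiso j z hz)
  choose F' hF'd hF' using hblock
  have hsub : closedBall z₁ (δ / 2) ⊆ ball z₁ δ := closedBall_subset_ball (by linarith)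
  have hcomp : IsCompact (closedBall z₁ (δ / 2)) := isCompact_closedBall _ _
  obtain ⟨M, hM⟩ := hcomp.exists_bound_of_continuousOn
    (differentiable_theta hτ).continuous.continuousOn
  have hM0 : 0 ≤ M := (norm_nonneg _).trans (hM z₁ (mem_closedBall_self (by positivity)))
  choose C hC using fun j => hcomp.exists_bound_of_continuousOn ((hF'd j).continuousOn.mono hsub)
  let v : ℤ → ℝ := fun j => M * (N * ((4 + 4 / (1 / 2 : ℝ) ^ 2) * (4 * (2 : ℝ) ^ (-|j|))))
  have hbound : ∀ j : ℤ, (j < -2 ∨ 0 < j) → ∀ z ∈ ball z₁ (δ / 2), ‖F' j z‖ ≤ v j := by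
    intro j hj
    have hfar : ∀ q ∈ A j, q ≠ 0 ∧ (2 : ℝ) ^ j ≤ ‖q‖ ∧ ‖q‖ ≤ 2 ^ (j + 2) ∧ 1 / 2 ≤ ‖q - 1‖ := by
      intro q hq
      have h1 : (2 : ℝ) ^ j ≤ ‖q‖ := ((hr1 j).trans hq.1).le
      have h2 : ‖q‖ ≤ (2 : ℝ) ^ (j + 2) := by
        have := hq.2.trans (hr2 (j + 1))
        rw [add_assoc] at this
        exact this.le
      refine ⟨norm_pos_iff.1 ((hrpos j).trans hq.1), h1, h2, ?_⟩
      rcases hj with hj | hj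
      · have h3 : (2 : ℝ) ^ (j + 2) ≤ 2 ^ (-1 : ℤ) := zpow_le_zpow_right₀ one_le_two (by omega)
        have h4 : (1 : ℝ) ≤ ‖q - 1‖ + ‖q‖ := by
          calc (1 : ℝ) = ‖q - (q - 1)‖ := by simp
            _ ≤ _ := by simpa [add_comm] using norm_sub_le q (q - 1)
        norm_num at h3
        linarith
      · have h3 : (2 : ℝ) ^ (1 : ℤ) ≤ 2 ^ j := zpow_le_zpow_right₀ one_le_two (by omega)
        have h4 : ‖q‖ ≤ ‖q - 1‖ + 1 := by
          calc ‖q‖ = ‖(q - 1) + 1‖ := by ring_nf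
            _ ≤ _ := by simpa using norm_add_le (q - 1) 1
        norm_num at h3
        linarith
    have h1 : ∀ z ∈ ball z₁ (δ / 2),
        ‖thetaSlice τ w (z, 1) * multipleZeroSum (thetaSlice τ w) (A j) koebe z‖ ≤ v j := by
      intro z hz
      have hz' : z ∈ ball z₁ δ := hsub (ball_subset_closedBall hz)
      obtain ⟨-, Z, hZ, hmem⟩ := hr j z hz'
      rw [norm_mul, thetaSlice_one]
      refine mul_le_mul (hM z (ball_subset_closedBall hz)) ?_ (norm_nonneg _) hM0
      have hfin : {q | q ∈ A j ∧ thetaSlice τ w (z, q) = 0 ∧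
          deriv (fun q => thetaSlice τ w (z, q)) q = 0}.Finite :=
        Z.finite_toSet.subset fun q hq =>
          hmem q (hfar q hq.1).2.1 (hfar q hq.1).2.2.1 hq.2.1
      rw [multipleZeroSum, finsum_mem_eq_finite_toFinset_sum _ hfin]
      refine (norm_sum_le _ _).trans ((Finset.sum_le_card_nsmul _ _
        ((4 + 4 / (1 / 2 : ℝ) ^ 2) * (4 * (2 : ℝ) ^ (-|j|))) fun q hq => ?_).trans ?_)
      · obtain ⟨h0, h1, h2, h3⟩ := hfar q (hfin.mem_toFinset.1 hq).1
        exact (norm_koebe_le one_half_pos h0 h3).trans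
          (mul_le_mul_of_nonneg_left (min_norm_inv_le h0 h1 h2) (by positivity))
      · rw [nsmul_eq_mul]
        refine mul_le_mul_of_nonneg_right ?_ (by positivity)
        exact_mod_cast (Finset.card_le_card fun q hq => by
          have hq' := hfin.mem_toFinset.1 hq
          exact hmem q (hfar q hq'.1).2.1 (hfar q hq'.1).2.2.1 hq'.2.1).trans hZ
    -- `F' j` equals the estimated product only on a residual set; density and continuity carry the
    -- bound over to every point.
    intro z hz
    by_contra! hlt
    have hop : ∀ᶠ y in 𝓝 z, y ∈ ball z₁ (δ / 2) ∧ v j < ‖F' j y‖ := by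
      refine Eventually.and (isOpen_ball.mem_nhds hz) ?_
      exact continuousAt_const.eventually_lt ((hF'd j).continuousOn.continuousAt
        (isOpen_ball.mem_nhds (hsub (ball_subset_closedBall hz)))).norm hlt
    obtain ⟨y, hy1, hy2⟩ := (dense_of_mem_residual (hF' j)).inter_nhds_nonempty hop
    refine hy2.2.not_ge (le_trans (le_of_eq ?_) (h1 y hy2.1))
    rw [hy1 (hsub (ball_subset_closedBall hy2.1))]
  have hv : Summable v :=
    ((((summable_two_zpow_neg_abs.mul_left _).mul_left _).mul_left _).mul_left _)
  let u : ℤ → ℝ := fun j => if j < -2 ∨ 0 < j then v j else C j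
  have hu : Summable u := by
    refine hv.congr_cofinite ?_
    have : ∀ᶠ j : ℤ in cofinite, j ∉ Finset.Icc (-2 : ℤ) 0 :=
      (Finset.finite_toSet _).compl_mem_cofinite
    filter_upwards [this] with j hj
    rw [Finset.mem_Icc, not_and_or] at hj
    exact (if_pos (by omega)).symm
  refine ⟨δ / 2, by positivity, fun z => ∑' j, F' j z,
    differentiableOn_tsum_of_summable hu
      (fun j => (hF'd j).mono ((ball_subset_closedBall).trans hsub)) fun j z hz => ?_, ?_⟩
  · by_cases hj : j < -2 ∨ 0 < j
    · simpa only [u, if_pos hj] using hbound j hj z hz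
    · simpa only [u, if_neg hj] using hC j z (ball_subset_closedBall hz)
  · filter_upwards [eventually_countable_forall.2 hF'] with z hz hzb
    have hzb' : z ∈ ball z₁ δ := hsub (ball_subset_closedBall hzb)
    have h1 := hasSum_multipleZeroSum hτ hw (z := z) hr1 hr2 fun j => (hr j z hzb').1
    rw [← (h1.mul_left (theta τ z)).tsum_eq]
    refine tsum_congr fun j => ?_
    rw [hz j hzb', thetaSlice_one]

theorem koebeSum_add_intVec (m : Fin g → ℤ) (z : Fin g → ℂ) :
    koebeSum τ w (z + intVec m) = koebeSum τ w z := by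
  rw [koebeSum, multipleZeros_add_intVec, koebeSum]

theorem koebeSum_add_mulVec (hτ : τ ∈ siegelSpace g) (m : Fin g → ℤ) (z : Fin g → ℂ) :
    koebeSum τ w (z + τ *ᵥ intVec m) = koebeSum τ w z := by
  rw [koebeSum, multipleZeros_add_mulVec hτ, koebeSum]

theorem eventually_residual_add {p : (Fin g → ℂ) → Prop} (h : ∀ᶠ z in residual (Fin g → ℂ), p z)
    (v : Fin g → ℂ) : ∀ᶠ z in residual (Fin g → ℂ), p (z + v) :=
  (tendsto_residual_of_isOpenMap (continuous_add_const v) (isOpenMap_add_right v)).eventually h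

/-- The holomorphic extension of `θ · koebeSum` inherits the automorphy of `θ`, first off a meagre
set and then everywhere by continuity. -/
theorem exists_koebeSum_eq_const (hτ : τ ∈ siegelSpace g)
    (hw : ∀ z, ∃ t : ℂ, theta τ (z + t • intVec w) ≠ 0) :
    ∃ c, ∀ᶠ z in residual (Fin g → ℂ), theta τ z ≠ 0 → koebeSum τ w z = c := by
  obtain ⟨F, hFd, hF⟩ := exists_differentiableOn_of_holomorphicResiduallyAt isOpen_univ
    fun z (_ : z ∈ univ) => holomorphicResiduallyAt_theta_mul_koebeSum hτ hw z
  simp only [mem_univ, true_imp_iff] at hF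
  have hFd' : Differentiable ℂ F := differentiableOn_univ.1 hFd
  have hcont := hFd'.continuous
  obtain ⟨c, hc⟩ := exists_eq_const_mul_theta hτ hFd'
    (fun m z => eqOn_of_residual (F := fun z => F (z + intVec m)) (G := F) isOpen_univ
      (by fun_prop) hcont.continuousOn (by
        filter_upwards [hF, eventually_residual_add hF (intVec m)] with z h1 h2 _
        rw [h1, h2, theta_add_intVec, koebeSum_add_intVec]) z (mem_univ z))
    (fun m z => eqOn_of_residual (F := fun z => F (z + τ *ᵥ intVec m))
      (G := fun z => automorphyFactor τ m z * F z) isOpen_univ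
      (by fun_prop) (by
        refine ContinuousOn.mul (Continuous.continuousOn ?_) hcont.continuousOn
        unfold automorphyFactor
        fun_prop) (by
        filter_upwards [hF, eventually_residual_add hF (τ *ᵥ intVec m)] with z h1 h2 _
        rw [h1, h2, theta_add_mulVec hτ.1, koebeSum_add_mulVec hτ, mul_assoc]) z (mem_univ z))
  refine ⟨c, hF.mono fun z hz h0 => ?_⟩
  rw [hc, mul_comm] at hz
  exact (mul_left_cancel₀ h0 hz).symm

end Extension

/-! ### Zeros on nearby parallel lines. -/

section LineZeros

open Metric Set

variable {E : Type*} [NormedAddCommGroup E] [NormedSpace ℂ E]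

theorem differentiable_line {F : E → ℂ} (hF : Differentiable ℂ F) (v : E) :
    DifferentiableOn ℂ (fun p : E × ℂ => F (p.1 + p.2 • v)) univ := by
  have : Differentiable ℂ (fun p : E × ℂ => p.1 + p.2 • v) := by fun_prop
  exact (hF.comp this).differentiableOn

theorem hasDerivAt_line {F : E → ℂ} (hF : Differentiable ℂ F) (v z : E) (t : ℂ) :
    HasDerivAt (fun t => F (z + t • v)) (fderiv ℂ F (z + t • v) v) t := by
  have h7 : HasDerivAt (fun t : ℂ => z + t • v) v t := by
    simpa using ((hasDerivAt_id t).smul_const v).const_add z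
  exact (hF _).hasFDerivAt.comp_hasDerivAt _ h7

theorem analyticAt_line {F : E → ℂ} (hF : Differentiable ℂ F) (v z : E) (t : ℂ) :
    AnalyticAt ℂ (fun t => F (z + t • v)) t :=
  Differentiable.analyticAt (fun t => (hasDerivAt_line hF v z t).differentiableAt) t

theorem analyticOrderNatAt_line_add (F : E → ℂ) (v z : E) (t : ℂ) :
    analyticOrderNatAt (fun s : ℂ => F ((z + t • v) + s • v)) 0 =
      analyticOrderNatAt (fun s : ℂ => F (z + s • v)) t := by
  have h : (fun s : ℂ => F ((z + t • v) + s • v)) = (fun s : ℂ => F (z + s • v)) ∘ fun s => s + t := by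
    ext s
    simp only [Function.comp_apply]
    rw [add_assoc, ← add_smul, add_comm t]
  rw [h, analyticOrderNatAt, analyticOrderNatAt,
    analyticOrderAt_comp_of_deriv_ne_zero (by fun_prop) (by simp)]
  simp

/-- Conservation of the number of zeros on the lines of direction `v`. -/
theorem eventually_exists_line_zeros {F : E → ℂ} (hF : Differentiable ℂ F) {v z₀ : E}
    (h0 : ∀ᶠ t in 𝓝[≠] (0 : ℂ), F (z₀ + t • v) ≠ 0) :
    ∀ᶠ ε in 𝓝[>] (0 : ℝ), ∀ᶠ z in 𝓝 z₀, ∃ Z : Finset ℂ,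
      (∀ t, t ∈ Z ↔ t ∈ ball (0 : ℂ) ε ∧ F (z + t • v) = 0) ∧
      (∀ t ∈ Z, 1 ≤ analyticOrderNatAt (fun s : ℂ => F (z + s • v)) t) ∧
      ∑ t ∈ Z, analyticOrderNatAt (fun s : ℂ => F (z + s • v)) t =
        analyticOrderNatAt (fun s : ℂ => F (z₀ + s • v)) 0 := by
  classical
  obtain ⟨r, hr, hball⟩ := Metric.mem_nhdsWithin_iff.1 h0
  filter_upwards [Ioo_mem_nhdsGT hr] with ε hε
  have hφ := differentiable_line hF v
  have hsub : ∀ {z : E}, ∀ x ∈ closedBall (0 : ℂ) ε, (z, x) ∈ (univ : Set (E × ℂ)) :=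
    fun x _ => mem_univ _
  have hne : ∀ x ∈ sphere (0 : ℂ) ε, F (z₀ + x • v) ≠ 0 := fun x hx =>
    hball ⟨sphere_subset_closedBall.trans (closedBall_subset_ball hε.2) hx,
      ne_of_mem_sphere hx hε.1.ne'⟩
  filter_upwards [eventually_disc isOpen_univ hφ hsub hne,
    eventually_zeroMoment_zero_eq isOpen_univ hφ hε.1 hsub hne] with z hz hmom
  obtain ⟨Z, hZ, hZ1, hZm⟩ := exists_slice_zeros hε.1 isOpen_univ hφ hz.1 hz.2
  obtain ⟨Z₀, hZ₀, hZ₀1, hZ₀m⟩ := exists_slice_zeros (z := z₀) hε.1 isOpen_univ hφ hsub hne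
  refine ⟨Z, hZ, hZ1, ?_⟩
  have h1 : (∑ t ∈ Z, analyticOrderNatAt (fun s : ℂ => F (z + s • v)) t : ℂ) =
      ∑ t ∈ Z₀, (analyticOrderNatAt (fun s : ℂ => F (z₀ + s • v)) t : ℂ) := by
    have h2 := hZm 0
    have h3 := hZ₀m 0
    simp only [pow_zero, mul_one] at h2 h3
    exact h2.symm.trans (hmom.trans h3)
  have h2 : ∑ t ∈ Z, analyticOrderNatAt (fun s : ℂ => F (z + s • v)) t =
      ∑ t ∈ Z₀, analyticOrderNatAt (fun s : ℂ => F (z₀ + s • v)) t := by exact_mod_cast h1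
  rw [h2]
  have hZ₀' : ∀ t ∈ Z₀, t = 0 := by
    intro t ht
    by_contra hne0
    have := (hZ₀ t).1 ht
    exact hball ⟨ball_subset_ball hε.2.le this.1, hne0⟩ this.2
  by_cases hz0 : F z₀ = 0
  · have : Z₀ = {0} := by
      ext t
      rw [Finset.mem_singleton]
      refine ⟨hZ₀' t, ?_⟩
      rintro rfl
      exact (hZ₀ 0).2 ⟨mem_ball_self hε.1, by simpa using hz0⟩
    rw [this, Finset.sum_singleton]
  · have : Z₀ = ∅ := by
      refine Finset.eq_empty_of_forall_notMem fun t ht => hz0 ?_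
      have := (hZ₀ t).1 ht
      rw [hZ₀' t ht] at this
      simpa using this.2
    rw [this, Finset.sum_empty, eq_comm, analyticOrderNatAt_eq_zero_iff (analyticAt_line hF v z₀ 0) h0]
    simpa using hz0

theorem eventually_line_ne_zero_of_fderiv {F : E → ℂ} (hF : Differentiable ℂ F) {v z : E}
    (h : fderiv ℂ F z v ≠ 0) : ∀ᶠ t in 𝓝[≠] (0 : ℂ), F (z + t • v) ≠ 0 := by
  have h1 := hasDerivAt_line hF v z 0
  rw [zero_smul, add_zero] at h1
  exact h1.eventually_ne h

theorem eventually_exists_line_zero {F : E → ℂ} (hF : Differentiable ℂ F) {v z₀ : E}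
    (hz₀ : F z₀ = 0) (h0 : ∀ᶠ t in 𝓝[≠] (0 : ℂ), F (z₀ + t • v) ≠ 0) {ε : ℝ} (hε : 0 < ε) :
    ∀ᶠ z in 𝓝 z₀, ∃ t ∈ ball (0 : ℂ) ε, F (z + t • v) = 0 := by
  obtain ⟨ε', hev, hε'⟩ := ((eventually_exists_line_zeros hF h0).and (Ioo_mem_nhdsGT hε)).exists
  filter_upwards [hev] with z ⟨Z, hZ, _, hZs⟩
  have hord : analyticOrderNatAt (fun s : ℂ => F (z₀ + s • v)) 0 ≠ 0 := fun h => by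
    rw [analyticOrderNatAt_eq_zero_iff (analyticAt_line hF v z₀ 0) h0] at h
    exact h (by simpa using hz₀)
  obtain ⟨t, ht⟩ : Z.Nonempty := by
    by_contra hcon
    rw [Finset.not_nonempty_iff_eq_empty] at hcon
    rw [hcon, Finset.sum_empty] at hZs
    exact hord hZs.symm
  obtain ⟨h1, h2⟩ := (hZ t).1 ht
  exact ⟨t, ball_subset_ball hε'.2.le h1, h2⟩

end LineZeros

/-! ### Reducedness of the theta divisor. -/

section Reducedness

open Metric Set

variable {g : ℕ} {τ : Matrix (Fin g) (Fin g) ℂ}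

theorem eventually_line_ne_zero {F : (Fin g → ℂ) → ℂ} (hF : Differentiable ℂ F) {v z : Fin g → ℂ}
    (h : ∃ t : ℂ, F (z + t • v) ≠ 0) (t : ℂ) : ∀ᶠ s in 𝓝[≠] t, F (z + s • v) ≠ 0 := by
  obtain ⟨t₀, ht₀⟩ := h
  exact eventually_ne_zero_of_preconnected (δ := fun s : ℂ => F (z + s • v)) isOpen_univ
    isPreconnected_univ
    (fun s _ => (hasDerivAt_line hF v z s).differentiableAt.differentiableWithinAt) (mem_univ t₀)
    ht₀ t (mem_univ t)

/-- The theta divisor is reduced. -/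
theorem theta_divisor_reduced (hτ : τ ∈ siegelSpace g) {ρ : (Fin g → ℂ) → ℂ}
    (hρ : Differentiable ℂ ρ) {s : Fin g → ℂ} (hs : ρ s = 0) (hds : fderiv ℂ ρ s ≠ 0)
    (h : ∀ᶠ z in 𝓝 s, ρ z = 0 → theta τ z = 0 ∧ fderiv ℂ (theta τ) z = 0) : False := by
  classical
  obtain ⟨w, hw1, hw⟩ := exists_intVec_apply_ne_zero_and_theta_ne_zero hτ hds
  obtain ⟨c, hc⟩ := exists_koebeSum_eq_const hτ hw
  have hθ := differentiable_theta hτ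
  set v := intVec w
  have hρ1 : ∀ᶠ z in 𝓝 s, fderiv ℂ ρ z v ≠ 0 := by
    have hcont : Continuous fun z => fderiv ℂ ρ z v :=
      ((contDiff_of_differentiable hρ).continuous_fderiv (by simp)).clm_apply continuous_const
    exact hcont.continuousAt.eventually_ne hw1
  obtain ⟨r, hr, hball⟩ := Metric.eventually_nhds_iff_ball.1 (h.and hρ1)
  set S := {z | z ∈ ball s r ∧ ρ z = 0}
  set o : (Fin g → ℂ) → ℕ := fun z => analyticOrderNatAt (fun t : ℂ => theta τ (z + t • v)) 0
  -- A point of the hypersurface where the multiplicity of `θ` in the direction `v` is minimal; this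
  -- will leave a single zero on nearby lines.
  obtain ⟨s₀, hs₀, hmin⟩ : ∃ s₀ ∈ S, ∀ z ∈ S, o s₀ ≤ o z := by
    have hne : (o '' S).Nonempty := ⟨_, s, ⟨mem_ball_self hr, hs⟩, rfl⟩
    obtain ⟨s₀, hs₀, he⟩ := Nat.sInf_mem hne
    exact ⟨s₀, hs₀, fun z hz => he.trans_le (Nat.sInf_le ⟨z, hz, rfl⟩)⟩
  have hiso : ∀ z, ∀ᶠ t in 𝓝[≠] (0 : ℂ), theta τ (z + t • v) ≠ 0 := fun z =>
    eventually_line_ne_zero hθ (hw z) 0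
  obtain ⟨ε, hev, hε⟩ := ((eventually_exists_line_zeros hθ (hiso s₀)).and
    (Ioo_mem_nhdsGT (show (0 : ℝ) < 1 / 4 by norm_num))).exists
  have hlog : ∀ᶠ q in 𝓝 (1 : ℂ),
      Complex.log q / (2 * Real.pi * Complex.I) ∈ ball (0 : ℂ) ε ∧ q ≠ 0 := by
    have h1 : ContinuousAt (fun q => Complex.log q / (2 * Real.pi * Complex.I)) 1 :=
      (continuousAt_clog (by simp)).div_const _
    refine Eventually.and (h1 (ball_mem_nhds _ hε.1 |> fun h => by simpa using h)) (eventually_ne_nhds one_ne_zero)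
  obtain ⟨ε₁, hε₁, hlog'⟩ := Metric.eventually_nhds_iff_ball.1 hlog
  obtain ⟨C, hC⟩ := exists_bound_koebe_away hτ hw hε₁
  -- Near its pole the Koebe function exceeds the generic value `c` plus the bound `C` on the terms
  -- away from `1`.
  have hkinf : ∀ᶠ t in 𝓝[≠] (0 : ℂ),
      ‖c‖ + C < ‖koebe (Complex.exp (2 * Real.pi * Complex.I * t))‖ := by
    have hd : HasDerivAt (fun t : ℂ => Complex.exp (2 * Real.pi * Complex.I * t))
        (2 * Real.pi * Complex.I) 0 := by
      simpa using ((hasDerivAt_id (0 : ℂ)).const_mul (2 * Real.pi * Complex.I : ℂ)).cexp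
    have h1 : ∀ᶠ t in 𝓝[≠] (0 : ℂ), Complex.exp (2 * Real.pi * Complex.I * t) ≠ 1 :=
      hd.eventually_ne Complex.two_pi_I_ne_zero
    have h2 : ContinuousAt (fun t : ℂ => (1 - Complex.exp (2 * Real.pi * Complex.I * t)) ^ 2 /
        Complex.exp (2 * Real.pi * Complex.I * t)) 0 := by
      fun_prop (disch := exact Complex.exp_ne_zero _)
    have hK : 0 < |‖c‖ + C| + 1 := by positivity
    have h3 := h2.norm.eventually_lt continuousAt_const (show _ < (|‖c‖ + C| + 1)⁻¹ by simpa using hK)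
    filter_upwards [h1, eventually_nhdsWithin_of_eventually_nhds h3] with t h4 h5
    have h6 : 0 < ‖(1 - Complex.exp (2 * Real.pi * Complex.I * t)) ^ 2 /
        Complex.exp (2 * Real.pi * Complex.I * t)‖ :=
      norm_pos_iff.2 (div_ne_zero (pow_ne_zero 2 (sub_ne_zero.2 h4.symm)) (Complex.exp_ne_zero _))
    rw [koebe, ← inv_div, norm_inv]
    calc ‖c‖ + C < |‖c‖ + C| + 1 := (le_abs_self _).trans_lt (lt_add_one _)
      _ < _ := by rwa [lt_inv_comm₀ hK h6]
  have hexp : ∀ᶠ t in 𝓝 (0 : ℂ), Complex.exp (2 * Real.pi * Complex.I * t) ∈ ball (1 : ℂ) ε₁ := by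
    have h1 : ContinuousAt (fun t : ℂ => Complex.exp (2 * Real.pi * Complex.I * t)) 0 := by fun_prop
    refine h1 ?_
    simpa using ball_mem_nhds (1 : ℂ) hε₁
  obtain ⟨ε₂, hε₂, hsmall⟩ := Metric.eventually_nhds_iff_ball.1
    (((eventually_nhdsWithin_iff.1 hkinf).and hexp).and (ball_mem_nhds (0 : ℂ) hε.1))
  have hmove : ∀ᶠ z in 𝓝 s₀, ∃ t ∈ ball (0 : ℂ) ε₂, ρ (z + t • v) = 0 ∧ z + t • v ∈ ball s r := by
    have h1 : ∀ᶠ p in 𝓝 (s₀, (0 : ℂ)), p.1 + p.2 • v ∈ ball s r := by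
      have h2 : ContinuousAt (fun p : (Fin g → ℂ) × ℂ => p.1 + p.2 • v) (s₀, 0) := by fun_prop
      refine h2 (isOpen_ball.mem_nhds ?_)
      simpa using hs₀.1
    rw [nhds_prod_eq] at h1
    obtain ⟨p, hp, q, hq, hpq⟩ := eventually_prod_iff.1 h1
    obtain ⟨ε₃, hε₃, hq'⟩ := Metric.eventually_nhds_iff_ball.1 hq
    filter_upwards [hp, eventually_exists_line_zero hρ hs₀.2
      (eventually_line_ne_zero_of_fderiv hρ (hball s₀ hs₀.1).2) (lt_min hε₂ hε₃)] with z hz ⟨t, ht, ht0⟩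
    exact ⟨t, ball_subset_ball (min_le_left _ _) ht, ht0,
      hpq hz (hq' t (ball_subset_ball (min_le_right _ _) ht))⟩
  obtain ⟨t₁, ht₁⟩ := hw s₀
  have hdense : Dense {z | (theta τ z ≠ 0 → koebeSum τ w z = c) ∧ theta τ z ≠ 0} := by
    refine dense_of_mem_residual (Filter.inter_mem hc ?_)
    exact residual_of_dense_open (isOpen_ne_fun hθ.continuous continuous_const)
      (dense_theta_ne_zero hτ ht₁)
  -- A generic `z` near `s₀`: the Koebe sum takes the value `c`, `θ z ≠ 0`, and the line through `z`
  -- meets `ρ = 0` at a small parameter `t`.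
  obtain ⟨z, ⟨hz1, hz2⟩, ⟨Z, hZ, hZ1, hZs⟩, t, ht, htρ, htr⟩ :=
    hdense.inter_nhds_nonempty (hev.and hmove)
  have hzc := hz1 hz2
  set q₀ := Complex.exp (2 * Real.pi * Complex.I * t)
  obtain ⟨hθt, hdθt⟩ := (hball _ htr).1 htρ
  have ht0 : t ≠ 0 := by
    rintro rfl
    rw [zero_smul, add_zero] at hθt
    exact hz2 hθt
  have htZ : t ∈ Z := (hZ t).2 ⟨(hsmall t ht).2, hθt⟩
  -- The total multiplicity in the disc is that of `s₀`, and by minimality the zero at `t` uses all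
  -- of it.
  have hZt : Z = {t} := by
    have h1 : o s₀ ≤ analyticOrderNatAt (fun s : ℂ => theta τ (z + s • v)) t := by
      rw [← analyticOrderNatAt_line_add]
      exact hmin _ ⟨htr, htρ⟩
    have h2 := Finset.sum_erase_add Z (fun t => analyticOrderNatAt (fun s : ℂ => theta τ (z + s • v)) t) htZ
    have h3 : ∑ x ∈ Z.erase t, analyticOrderNatAt (fun s : ℂ => theta τ (z + s • v)) x = 0 := by
      have h4 : ∑ t ∈ Z, analyticOrderNatAt (fun s : ℂ => theta τ (z + s • v)) t = o s₀ := hZs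
      omega
    ext x
    rw [Finset.mem_singleton]
    refine ⟨fun hx => ?_, fun hx => hx ▸ htZ⟩
    by_contra hne
    have h5 := Finset.sum_eq_zero_iff.1 h3 x (Finset.mem_erase.2 ⟨hne, hx⟩)
    have h6 := hZ1 x hx
    omega
  have hslice : HasDerivAt (fun q => thetaSlice τ w (z, q)) 0 q₀ := by
    have h1 := (differentiableAt_thetaSlice_snd hτ w z (Complex.exp_ne_zero
      (2 * Real.pi * Complex.I * t))).hasDerivAt
    have h2 : HasDerivAt (fun t : ℂ => Complex.exp (2 * Real.pi * Complex.I * t))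
        (q₀ * (2 * Real.pi * Complex.I)) t := by
      simpa using ((hasDerivAt_id t).const_mul (2 * Real.pi * Complex.I : ℂ)).cexp
    have h3 := h1.comp t h2
    have h4 : ((fun q => thetaSlice τ w (z, q)) ∘
        fun t : ℂ => Complex.exp (2 * Real.pi * Complex.I * t)) = fun t => theta τ (z + t • v) := by
      ext t
      exact thetaSlice_exp z t
    rw [h4] at h3
    have h5 := h3.unique (hasDerivAt_line hθ v z t)
    rw [hdθt, zero_apply, mul_eq_zero, or_iff_left
      (mul_ne_zero (Complex.exp_ne_zero _) Complex.two_pi_I_ne_zero)] at h5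
    rw [h5] at h1
    exact h1
  have hq₀ : q₀ ∈ multipleZeros τ w z := by
    refine ⟨Complex.exp_ne_zero _, ?_, hslice.deriv⟩
    rw [thetaSlice_exp]
    exact hθt
  -- A multiple zero closer to `1` would have its logarithm in `Z = {t}`, so it would be `q₀`.
  have honly : ∀ q ∈ multipleZeros τ w z, q ≠ q₀ → ε₁ ≤ ‖q - 1‖ := by
    intro q hq hne
    by_contra! hlt
    have h1 := hlog' q (mem_ball_iff_norm.2 hlt)
    set t' := Complex.log q / (2 * Real.pi * Complex.I) with ht'
    have hqt : Complex.exp (2 * Real.pi * Complex.I * t') = q := by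
      rw [ht', mul_div_cancel₀ _ Complex.two_pi_I_ne_zero, Complex.exp_log h1.2]
    have h2 : t' ∈ Z := (hZ t').2 ⟨h1.1, by rw [← thetaSlice_eq hqt]; exact hq.2.1⟩
    rw [hZt, Finset.mem_singleton] at h2
    rw [h2] at hqt
    exact hne hqt.symm
  have hk := ((hsmall t ht).1.1) ht0
  have hsumm := summable_koebe_multipleZeros hτ hw z
  have hsplit := hsumm.tsum_eq_add_tsum_ite q₀
  have hrest : ‖∑' q, if q = q₀ then 0 else (multipleZeros τ w z).indicator koebe q‖ ≤ C := by
    have hfin : ∀ u : Finset ℂ, ∑ q ∈ u,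
        ‖if q = q₀ then 0 else (multipleZeros τ w z).indicator koebe q‖ ≤ C := by
      intro u
      refine le_trans (le_of_eq ?_) (hC z (u.filter fun q => q ∈ multipleZeros τ w z ∧ q ≠ q₀) ?_)
      · rw [Finset.sum_filter]
        refine Finset.sum_congr rfl fun q _ => ?_
        by_cases h1 : q = q₀
        · simp [h1]
        · by_cases h2 : q ∈ multipleZeros τ w z <;> simp [h1, h2]
      · intro q hq
        obtain ⟨-, h1, h2⟩ := Finset.mem_filter.1 hq
        exact ⟨h1, honly q h1 h2⟩
    have hsn := summable_of_sum_le (fun _ => norm_nonneg _) hfin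
    exact (norm_tsum_le_tsum_norm hsn).trans (hsn.tsum_le_of_sum_le hfin)
  rw [← koebeSum, hzc, indicator_of_mem hq₀] at hsplit
  have h1 : koebe q₀ = c - ∑' q, if q = q₀ then 0 else (multipleZeros τ w z).indicator koebe q := by
    rw [hsplit, add_sub_cancel_right]
  have h2 := norm_sub_le c (∑' q, if q = q₀ then 0 else (multipleZeros τ w z).indicator koebe q)
  rw [← h1] at h2
  linarith

end Reducedness

/-! ### Calculus of directional derivatives of entire functions. -/

section DirDeriv

variable {g : ℕ} {F G : (Fin g → ℂ) → ℂ} {u v : Fin g → ℂ}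

theorem dirDeriv_eq_fderiv {F' : Type*} [NormedAddCommGroup F'] [NormedSpace ℂ F']
    {F : (Fin g → ℂ) → F'} (hF : Differentiable ℂ F) (v : Fin g → ℂ) :
    dirDeriv v F = fun z => fderiv ℂ F z v :=
  funext fun z => (hF z).lineDeriv_eq_fderiv

theorem differentiable_dirDeriv (hF : Differentiable ℂ F) (v : Fin g → ℂ) :
    Differentiable ℂ (dirDeriv v F) := by
  rw [dirDeriv_eq_fderiv hF]
  exact differentiableOn_univ.1
    (differentiableOn_fderiv_apply isOpen_univ hF.differentiableOn v)

theorem dirDeriv_comm (hF : Differentiable ℂ F) (u v : Fin g → ℂ) :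
    dirDeriv u (dirDeriv v F) = dirDeriv v (dirDeriv u F) := by
  have h2 : Differentiable ℂ (fderiv ℂ F) :=
    ((contDiff_of_differentiable hF).fderiv_right (m := 1) (by norm_cast)).differentiable (by simp)
  have key : ∀ u v z, dirDeriv u (dirDeriv v F) z = fderiv ℂ (fderiv ℂ F) z u v := by
    intro u v z
    rw [dirDeriv_eq_fderiv (differentiable_dirDeriv hF v), dirDeriv_eq_fderiv hF]
    beta_reduce
    have h3 := ((h2 z).hasFDerivAt.clm_apply (hasFDerivAt_const v z)).fderiv
    rw [h3]
    simp
  ext z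
  rw [key, key]
  have : IsSymmSndFDerivAt ℂ F z :=
    (contDiff_of_differentiable hF).contDiffAt.isSymmSndFDerivAt
      (by
        rw [minSmoothness_of_isRCLikeNormedField]
        exact WithTop.coe_le_coe.2 (le_top (a := (2 : ℕ∞))))
  exact this u v

theorem differentiable_add_const (hF : Differentiable ℂ F) (d : Fin g → ℂ) :
    Differentiable ℂ fun z => F (z + d) :=
  hF.comp (differentiable_id.add_const d)

theorem dirDeriv_add_const (hF : Differentiable ℂ F) (d v : Fin g → ℂ) :
    dirDeriv v (fun z => F (z + d)) = fun z => dirDeriv v F (z + d) := by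
  rw [dirDeriv_eq_fderiv (differentiable_add_const hF d), dirDeriv_eq_fderiv hF]
  ext z
  rw [fderiv_comp_add_right]

/-- `F` is an entire function with directional derivative `F'` in the direction `v`. -/
structure HasDirDeriv (v : Fin g → ℂ) (F F' : (Fin g → ℂ) → ℂ) : Prop where
  differentiable : Differentiable ℂ F
  eq : dirDeriv v F = F'

variable {F' G' : (Fin g → ℂ) → ℂ}

theorem hasDirDeriv (hF : Differentiable ℂ F) (v : Fin g → ℂ) : HasDirDeriv v F (dirDeriv v F) :=
  ⟨hF, rfl⟩

theorem HasDirDeriv.hasDerivAt (h : HasDirDeriv v F F') (z : Fin g → ℂ) (t : ℂ) :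
    HasDerivAt (fun t : ℂ => F (z + t • v)) (F' (z + t • v)) t := by
  rw [← h.eq, dirDeriv_eq_fderiv h.differentiable]
  exact hasDerivAt_line h.differentiable v z t

theorem HasDirDeriv.of_hasDerivAt (hF : Differentiable ℂ F)
    (h : ∀ z, HasDerivAt (fun t : ℂ => F (z + t • v)) (F' z) 0) : HasDirDeriv v F F' :=
  ⟨hF, funext fun z => (h z).deriv⟩

theorem HasDirDeriv.hasDerivAt_zero (h : HasDirDeriv v F F') (z : Fin g → ℂ) :
    HasDerivAt (fun t : ℂ => F (z + t • v)) (F' z) 0 := by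
  simpa using h.hasDerivAt z 0

theorem HasDirDeriv.add (hF : HasDirDeriv v F F') (hG : HasDirDeriv v G G') :
    HasDirDeriv v (fun z => F z + G z) fun z => F' z + G' z :=
  .of_hasDerivAt (hF.differentiable.add hG.differentiable) fun z =>
    (hF.hasDerivAt_zero z).add (hG.hasDerivAt_zero z)

theorem HasDirDeriv.sub (hF : HasDirDeriv v F F') (hG : HasDirDeriv v G G') :
    HasDirDeriv v (fun z => F z - G z) fun z => F' z - G' z :=
  .of_hasDerivAt (hF.differentiable.sub hG.differentiable) fun z =>
    (hF.hasDerivAt_zero z).sub (hG.hasDerivAt_zero z)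

theorem HasDirDeriv.const_mul (hF : HasDirDeriv v F F') (c : ℂ) :
    HasDirDeriv v (fun z => c * F z) fun z => c * F' z :=
  .of_hasDerivAt (hF.differentiable.const_mul c) fun z => (hF.hasDerivAt_zero z).const_mul c

theorem HasDirDeriv.mul (hF : HasDirDeriv v F F') (hG : HasDirDeriv v G G') :
    HasDirDeriv v (fun z => F z * G z) fun z => F' z * G z + F z * G' z :=
  .of_hasDerivAt (hF.differentiable.mul hG.differentiable) fun z => by
    have h := (hF.hasDerivAt_zero z).mul (hG.hasDerivAt_zero z)
    simp only [zero_smul, add_zero] at h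
    exact h

theorem HasDirDeriv.sum {ι : Type*} {s : Finset ι} {F F' : ι → (Fin g → ℂ) → ℂ}
    (h : ∀ i ∈ s, HasDirDeriv v (F i) (F' i)) :
    HasDirDeriv v (fun z => ∑ i ∈ s, F i z) fun z => ∑ i ∈ s, F' i z :=
  .of_hasDerivAt (Differentiable.fun_sum fun i hi => (h i hi).differentiable) fun z =>
    HasDerivAt.fun_sum fun i hi => (h i hi).hasDerivAt_zero z

theorem HasDirDeriv.comp_const_add (hF : HasDirDeriv v F F') (a : Fin g → ℂ) :
    HasDirDeriv v (fun z => F (a + z)) fun z => F' (a + z) :=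
  .of_hasDerivAt (hF.differentiable.comp (differentiable_id.const_add a)) fun z => by
    simpa only [add_assoc] using hF.hasDerivAt_zero (a + z)

theorem HasDirDeriv.comp_const_sub (hF : HasDirDeriv v F F') (a : Fin g → ℂ) :
    HasDirDeriv v (fun z => F (a - z)) fun z => -F' (a - z) :=
  .of_hasDerivAt (hF.differentiable.comp (differentiable_id.const_sub a)) fun z => by
    have h1 : HasDerivAt (fun t : ℂ => F ((a - z) + t • v)) (F' (a - z)) (-0) := by
      simpa using hF.hasDerivAt_zero (a - z)
    have h2 := HasDerivAt.comp (0 : ℂ) h1 (hasDerivAt_neg (0 : ℂ))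
    rw [mul_neg_one] at h2
    refine h2.congr_of_eventuallyEq (Eventually.of_forall fun t => ?_)
    simp only [Function.comp_apply]
    congr 1
    module

theorem HasDirDeriv.unique {F'' : (Fin g → ℂ) → ℂ} (h : HasDirDeriv v F F')
    (h' : HasDirDeriv v F F'') : F' = F'' := h.eq.symm.trans h'.eq

theorem HasDirDeriv.eq_zero (h : HasDirDeriv v F F') (h0 : ∀ z, F z = 0) (z : Fin g → ℂ) :
    F' z = 0 := by
  have h1 := h.hasDerivAt_zero z
  simp only [h0] at h1
  exact h1.unique (hasDerivAt_const _ _)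

theorem HasDirDeriv.neg_of_even (h : HasDirDeriv v F F') (he : ∀ z, F (-z) = F z)
    (z : Fin g → ℂ) : F' (-z) = -F' z := by
  have h1 := h.comp_const_sub 0
  simp only [zero_sub, he] at h1
  rw [congr_fun (h.unique h1) z, neg_neg]

theorem HasDirDeriv.neg_of_odd (h : HasDirDeriv v F F') (he : ∀ z, F (-z) = -F z)
    (z : Fin g → ℂ) : F' (-z) = F' z := by
  have h1 := (h.comp_const_sub 0).const_mul (-1)
  simp only [zero_sub, he, neg_mul_neg, one_mul] at h1
  exact (congr_fun (h.unique h1) z).symm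

end DirDeriv

/-! ### The linear equation and the flex condition as one bilinear equation. -/

section Hirota

variable {g : ℕ} {τ : Matrix (Fin g) (Fin g) ℂ} {U V D : Fin g → ℂ} {p E : ℂ}

/-- The bilinear form of the linear equation. -/
def HirotaEquation (f h : (Fin g → ℂ) → ℂ) (U V : Fin g → ℂ) (p E : ℂ) : Prop :=
  ∀ z, f z * dirDeriv U (dirDeriv U h) z - 2 * dirDeriv U f z * dirDeriv U h z
    + dirDeriv U (dirDeriv U f) z * h z + 2 * p * (f z * dirDeriv U h z - dirDeriv U f z * h z)
    + (p ^ 2 - E) * (f z * h z) - (f z * dirDeriv V h z - dirDeriv V f z * h z) = 0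

theorem exists_theta_ne_zero (hτ : τ ∈ siegelSpace g) : ∃ z, theta τ z ≠ 0 := by
  obtain ⟨b, hb⟩ := exists_forall_exists_theta_ne_zero hτ
  obtain ⟨t, ht⟩ := hb b le_rfl 0
  exact ⟨_, ht⟩

theorem deriv_div_mul_exp {a a' b b' : ℂ → ℂ} {x : ℂ} (ha : HasDerivAt a (a' x) x)
    (hb : HasDerivAt b (b' x) x) (h0 : a x ≠ 0) (p c : ℂ) :
    HasDerivAt (fun s => b s / a s * Complex.exp (p * s + c))
      (((b' x * a x - b x * a' x) / a x ^ 2 + p * (b x / a x)) * Complex.exp (p * x + c)) x := by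
  have h1 : HasDerivAt (fun s => Complex.exp (p * s + c)) (Complex.exp (p * x + c) * p) x := by
    simpa using (((hasDerivAt_id x).const_mul p).add_const c).cexp
  have h2 := (hb.fun_div ha h0).mul h1
  refine h2.congr_deriv ?_
  ring

theorem deriv_logDeriv {a a' a'' : ℂ → ℂ} (ha : ∀ x, HasDerivAt a (a' x) x)
    (ha' : ∀ x, HasDerivAt a' (a'' x) x) {x : ℂ} (h0 : a x ≠ 0) :
    deriv (logDeriv a) x = (a'' x * a x - a' x ^ 2) / a x ^ 2 := by
  have h1 : logDeriv a = fun x => a' x / a x := funext fun x => by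
    rw [logDeriv_apply, (ha x).deriv]
  rw [h1, ((ha' x).fun_div (ha x) h0).deriv, pow_two (a' x)]

theorem iteratedDeriv_two_div_mul_exp {a a' a'' b b' b'' : ℂ → ℂ} (ha : ∀ x, HasDerivAt a (a' x) x)
    (ha' : ∀ x, HasDerivAt a' (a'' x) x) (hb : ∀ x, HasDerivAt b (b' x) x)
    (hb' : ∀ x, HasDerivAt b' (b'' x) x) {x : ℂ} (h0 : a x ≠ 0) (p c : ℂ) :
    iteratedDeriv 2 (fun s => b s / a s * Complex.exp (p * s + c)) x =
      (b'' x / a x - 2 * b' x * a' x / a x ^ 2 - b x * a'' x / a x ^ 2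
        + 2 * b x * a' x ^ 2 / a x ^ 3 + 2 * p * (b' x * a x - b x * a' x) / a x ^ 2
        + p ^ 2 * (b x / a x)) * Complex.exp (p * x + c) := by
  have hne : ∀ᶠ s in 𝓝 x, a s ≠ 0 := (ha x).continuousAt.eventually_ne h0
  have h1 : deriv (fun s => b s / a s * Complex.exp (p * s + c)) =ᶠ[𝓝 x] fun s =>
      ((b' s * a s - b s * a' s) / a s ^ 2 + p * (b s / a s)) * Complex.exp (p * s + c) := by
    filter_upwards [hne] with s hs
    exact (deriv_div_mul_exp (ha s) (hb s) hs p c).deriv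
  rw [iteratedDeriv_succ, iteratedDeriv_one, h1.deriv_eq]
  have h2 : HasDerivAt (fun s => (b' s * a s - b s * a' s + p * (b s * a s)) / (a s ^ 2))
      (((b'' x * a x + b' x * a' x - (b' x * a' x + b x * a'' x) +
        p * (b' x * a x + b x * a' x)) * a x ^ 2 -
        (b' x * a x - b x * a' x + p * (b x * a x)) * (2 * a x * a' x)) / (a x ^ 2) ^ 2) x := by
    have h3 : HasDerivAt (fun s => a s ^ 2) (2 * a x * a' x) x := by
      simpa using (ha x).fun_pow 2
    exact HasDerivAt.fun_div ((((hb' x).mul (ha x)).sub ((hb x).mul (ha' x))).add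
      (((hb x).mul (ha x)).const_mul p)) h3 (pow_ne_zero 2 h0)
  have h4 : HasDerivAt (fun s => Complex.exp (p * s + c)) (Complex.exp (p * x + c) * p) x := by
    simpa using (((hasDerivAt_id x).const_mul p).add_const c).cexp
  have h5 : (fun s => ((b' s * a s - b s * a' s) / a s ^ 2 + p * (b s / a s)) *
      Complex.exp (p * s + c)) =ᶠ[𝓝 x] fun s =>
      (b' s * a s - b s * a' s + p * (b s * a s)) / (a s ^ 2) * Complex.exp (p * s + c) := by
    filter_upwards [hne] with s hs
    congr 1
    field_simp
  rw [h5.deriv_eq, (h2.fun_mul h4).deriv]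
  field_simp
  ring

theorem HasDirDeriv.hasDerivAt_fst {F F' : (Fin g → ℂ) → ℂ} (h : HasDirDeriv U F F')
    (Z : Fin g → ℂ) (x y : ℂ) :
    HasDerivAt (fun s : ℂ => F (s • U + y • V + Z)) (F' (x • U + y • V + Z)) x := by
  have := h.hasDerivAt (y • V + Z) x
  simpa only [add_comm (y • V + Z), ← add_assoc] using this

theorem HasDirDeriv.hasDerivAt_snd {F F' : (Fin g → ℂ) → ℂ} (h : HasDirDeriv V F F')
    (Z : Fin g → ℂ) (x y : ℂ) :
    HasDerivAt (fun t : ℂ => F (x • U + t • V + Z)) (F' (x • U + y • V + Z)) y := by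
  have := h.hasDerivAt (x • U + Z) y
  simpa only [add_right_comm _ Z] using this

theorem linearEquation_iff_hirotaEquation (hτ : τ ∈ siegelSpace g) :
    LinearEquation τ U V D p E ↔ HirotaEquation (theta τ) (fun z => theta τ (z + D)) U V p E := by
  set f := theta τ with hf_def
  set h : (Fin g → ℂ) → ℂ := fun z => f (z + D) with hh_def
  have hf : Differentiable ℂ f := differentiable_theta hτ
  have hh : Differentiable ℂ h := differentiable_add_const hf D
  let B : (Fin g → ℂ) → ℂ := fun z =>
    f z * dirDeriv U (dirDeriv U h) z - 2 * dirDeriv U f z * dirDeriv U h z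
    + dirDeriv U (dirDeriv U f) z * h z + 2 * p * (f z * dirDeriv U h z - dirDeriv U f z * h z)
    + (p ^ 2 - E) * (f z * h z) - (f z * dirDeriv V h z - dirDeriv V f z * h z)
  have hfU := differentiable_dirDeriv hf U
  have hhU := differentiable_dirDeriv hh U
  have hB : Continuous B := by
    have h1 := (differentiable_dirDeriv hfU U).continuous
    have h2 := (differentiable_dirDeriv hhU U).continuous
    have h3 := (differentiable_dirDeriv hf V).continuous
    have h4 := (differentiable_dirDeriv hh V).continuous
    have h5 := hf.continuous
    have h6 := hh.continuous
    have h7 := hfU.continuous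
    have h8 := hhU.continuous
    fun_prop
  have hpsi : ∀ Z x y, psi τ U V D Z p E x y = h (x • U + y • V + Z) / f (x • U + y • V + Z) *
      Complex.exp (p * x + E * y) := fun Z x y => by
    simp only [psi, hh_def, ← hf_def]
    rw [add_right_comm _ D]
  have key : ∀ (Z : Fin g → ℂ) (x y : ℂ), f (x • U + y • V + Z) ≠ 0 →
      (iteratedDeriv 2 (fun s => psi τ U V D Z p E s y) x
        + potential τ U V Z x y * psi τ U V D Z p E x y
        = deriv (fun t => psi τ U V D Z p E x t) y ↔ B (x • U + y • V + Z) = 0) := by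
    intro Z x y h0
    simp only [hpsi, potential, ← hf_def]
    have e1 := iteratedDeriv_two_div_mul_exp (x := x)
      (fun s => (hasDirDeriv hf U).hasDerivAt_fst (V := V) Z s y)
      (fun s => (hasDirDeriv hfU U).hasDerivAt_fst (V := V) Z s y)
      (fun s => (hasDirDeriv hh U).hasDerivAt_fst (V := V) Z s y)
      (fun s => (hasDirDeriv hhU U).hasDerivAt_fst (V := V) Z s y) h0 p (E * y)
    have e2 := deriv_logDeriv (x := x)
      (fun s => (hasDirDeriv hf U).hasDerivAt_fst (V := V) Z s y)
      (fun s => (hasDirDeriv hfU U).hasDerivAt_fst (V := V) Z s y) h0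
    have e3 := (deriv_div_mul_exp (x := y) (a' := fun t => dirDeriv V f (x • U + t • V + Z))
      (b' := fun t => dirDeriv V h (x • U + t • V + Z))
      ((hasDirDeriv hf V).hasDerivAt_snd (U := U) Z x y)
      ((hasDirDeriv hh V).hasDerivAt_snd (U := U) Z x y) h0 E (p * x)).deriv
    simp only [add_comm (E * _)] at e3
    rw [e1, e2, e3]
    simp only [B]
    have hexp := Complex.exp_ne_zero (p * x + E * y)
    set z := x • U + y • V + Z
    set e := Complex.exp (p * x + E * y)
    -- After multiplication by `f ^ 2` and division by the exponential, the remaining terms in `1 /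
    -- f` of `ψ''` and of the potential cancel.
    rw [← sub_eq_zero, ← mul_right_inj' (mul_ne_zero (pow_ne_zero 2 h0) (inv_ne_zero hexp)), mul_zero]
    refine Eq.congr ?_ rfl
    field_simp
    ring
  constructor
  · intro hL
    obtain ⟨z₁, hz₁⟩ := exists_theta_ne_zero hτ
    have h1 : B = fun _ => 0 := by
      refine Continuous.ext_on (dense_theta_ne_zero hτ hz₁) hB continuous_const fun z hz => ?_
      -- The point `x = y = 0` suffices because the translation `Z` is arbitrary.
      have h2 := (key z 0 0 (by simpa using hz)).1 (hL z 0 0 (by simpa using hz))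
      simpa using h2
    exact fun z => congr_fun h1 z
  · intro hH Z x y h0
    exact (key Z x y h0).2 (hH _)

theorem HasDirDeriv.kummer_apply (hτ : τ ∈ siegelSpace g) (v : Fin g → ℂ) (e : Fin g → Fin 2) :
    HasDirDeriv v (fun z => kummer τ z e) fun z => dirDeriv v (kummer τ) z e := by
  refine ⟨differentiable_kummer_apply hτ e, ?_⟩
  rw [dirDeriv_eq_fderiv (differentiable_kummer_apply hτ e), dirDeriv_eq_fderiv (differentiable_kummer hτ)]
  ext z
  have h1 := hasFDerivAt_pi'.1 (differentiable_kummer hτ z).hasFDerivAt e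
  rw [h1.fderiv]
  rfl

theorem dirDeriv_dirDeriv_kummer (hτ : τ ∈ siegelSpace g) (v : Fin g → ℂ) (e : Fin g → Fin 2) :
    HasDirDeriv v (fun z => dirDeriv v (kummer τ) z e)
      fun z => dirDeriv v (dirDeriv v (kummer τ)) z e := by
  have hd : ∀ e, Differentiable ℂ fun z => dirDeriv v (kummer τ) z e := fun e => by
    rw [← (HasDirDeriv.kummer_apply hτ v e).eq]
    exact differentiable_dirDeriv (differentiable_kummer_apply hτ e) v
  have hd' : Differentiable ℂ (dirDeriv v (kummer τ)) := differentiable_pi.2 hd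
  refine ⟨hd e, ?_⟩
  rw [dirDeriv_eq_fderiv (hd e), dirDeriv_eq_fderiv hd']
  ext z
  have h1 := hasFDerivAt_pi'.1 (hd' z).hasFDerivAt e
  rw [h1.fderiv]
  rfl

/-- With `b = D / 2` and `z = a - b`, the Hirota form at `z` is a differential operator in `b`
acting on `θ (a + b) θ (a - b)`. The addition theorem makes it a combination of the `kummer τ a e`
with coefficients `Q e` free of `a`, and independence forces `Q = 0`. -/
theorem hirotaEquation_iff_kummer (hτ : τ ∈ siegelSpace g) :
    HirotaEquation (theta τ) (fun z => theta τ (z + D)) U V p E ↔ FlexEquation τ U V (-D) p E := by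
  set f := theta τ with hf_def
  have hf : Differentiable ℂ f := differentiable_theta hτ
  set b : Fin g → ℂ := (1 / 2 : ℂ) • D with hb
  have hK : ∀ v e, HasDirDeriv v (fun z => kummer τ z e) fun z => dirDeriv v (kummer τ) z e :=
    HasDirDeriv.kummer_apply hτ
  let Q : (Fin g → Fin 2) → ℂ := fun e => dirDeriv U (dirDeriv U (kummer τ)) b e
    + 2 * p * dirDeriv U (kummer τ) b e + (p ^ 2 - E) * kummer τ b e - dirDeriv V (kummer τ) b e
  -- The flex condition is evaluated at `-b`; since `kummer` is even, passing to `b` changes the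
  -- sign of the first derivatives only.
  have hflex : FlexEquation τ U V (-D) p E ↔ Q = 0 := by
    have hneg : (1 / 2 : ℂ) • -D = -b := smul_neg _ _
    have h1 : ∀ v e z, dirDeriv v (kummer τ) (-z) e = -dirDeriv v (kummer τ) z e :=
      fun v e => (hK v e).neg_of_even fun z => by rw [kummer_neg]
    have h2 : ∀ v e z, dirDeriv v (dirDeriv v (kummer τ)) (-z) e =
        dirDeriv v (dirDeriv v (kummer τ)) z e :=
      fun v e => (dirDeriv_dirDeriv_kummer hτ v e).neg_of_odd (h1 v e)
    rw [FlexEquation, hneg, funext_iff, funext_iff]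
    refine forall_congr' fun e => ?_
    simp only [Pi.add_apply, Pi.sub_apply, Pi.smul_apply, Pi.zero_apply, smul_eq_mul, h1, h2,
      kummer_neg, Q]
    refine Eq.congr ?_ rfl
    ring
  have key : ∀ a, f (a - b) * dirDeriv U (dirDeriv U f) (a + b)
      - 2 * dirDeriv U f (a - b) * dirDeriv U f (a + b)
      + dirDeriv U (dirDeriv U f) (a - b) * f (a + b)
      + 2 * p * (f (a - b) * dirDeriv U f (a + b) - dirDeriv U f (a - b) * f (a + b))
      + (p ^ 2 - E) * (f (a - b) * f (a + b))
      - (f (a - b) * dirDeriv V f (a + b) - dirDeriv V f (a - b) * f (a + b)) =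
        ∑ e, Q e * kummer τ a e := by
    intro a
    have hadd := funext fun b => theta_add_mul_theta_sub hτ a b
    have hP : ∀ v, HasDirDeriv v (fun b => f (a + b) * f (a - b)) fun b =>
        dirDeriv v f (a + b) * f (a - b) + f (a + b) * -dirDeriv v f (a - b) := fun v =>
      ((hasDirDeriv hf v).comp_const_add a).mul ((hasDirDeriv hf v).comp_const_sub a)
    have hS : ∀ v, HasDirDeriv v (fun b => f (a + b) * f (a - b)) fun b =>
        ∑ e, kummer τ a e * dirDeriv v (kummer τ) b e := fun v => by
      rw [hf_def, hadd]
      exact HasDirDeriv.sum fun e _ => (hK v e).const_mul _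
    have h1 := (hP U).unique (hS U)
    have hfU := differentiable_dirDeriv hf U
    have hP2 := (((hasDirDeriv hfU U).comp_const_add a).mul ((hasDirDeriv hf U).comp_const_sub a)).sub
      (((hasDirDeriv hf U).comp_const_add a).mul ((hasDirDeriv hfU U).comp_const_sub a))
    have hS2 : HasDirDeriv U (fun b => ∑ e, kummer τ a e * dirDeriv U (kummer τ) b e) fun b =>
        ∑ e, kummer τ a e * dirDeriv U (dirDeriv U (kummer τ)) b e :=
      HasDirDeriv.sum fun e _ => (dirDeriv_dirDeriv_kummer hτ U e).const_mul _
    rw [← h1] at hS2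
    simp only [mul_neg, ← sub_eq_add_neg] at hS2
    have e0 := congr_fun hadd b
    have e1 := congr_fun h1 b
    have e2 := congr_fun (hP2.unique hS2) b
    have e3 := congr_fun ((hP V).unique (hS V)) b
    simp only [← hf_def] at e0 e1 e2 e3
    have hsum : ∑ e, Q e * kummer τ a e =
        ∑ e, kummer τ a e * dirDeriv U (dirDeriv U (kummer τ)) b e
        + 2 * p * ∑ e, kummer τ a e * dirDeriv U (kummer τ) b e
        + (p ^ 2 - E) * ∑ e, kummer τ a e * kummer τ b e
        - ∑ e, kummer τ a e * dirDeriv V (kummer τ) b e := by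
      simp only [Finset.mul_sum, ← Finset.sum_add_distrib, ← Finset.sum_sub_distrib, Q]
      exact Finset.sum_congr rfl fun e _ => by ring
    rw [hsum, ← e0, ← e1, ← e2, ← e3]
    ring
  have hDb : D = b + b := by
    rw [hb, ← add_smul]
    norm_num
  rw [hflex]
  have hH : HirotaEquation f (fun z => f (z + D)) U V p E ↔ ∀ a, ∑ e, Q e * kummer τ a e = 0 := by
    rw [HirotaEquation, dirDeriv_add_const hf, dirDeriv_add_const hf,
      dirDeriv_add_const (differentiable_dirDeriv hf U)]
    simp only [← key]
    have hz : ∀ a : Fin g → ℂ, a - b + D = a + b := fun a => by rw [hDb]; abel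
    refine ⟨fun h a => ?_, fun h z => ?_⟩
    · have := h (a - b)
      simpa only [hz] using this
    · have := h (z + b)
      simpa only [add_sub_cancel_right, add_assoc, ← hDb] using this
  rw [hH]
  refine ⟨fun h => eq_zero_of_sum_mul_kummer_eq_zero hτ h, fun h a => ?_⟩
  simp [h]

end Hirota

/-! ### The cubic relation on the theta divisor. -/

section Divisor

variable {g : ℕ} {τ : Matrix (Fin g) (Fin g) ℂ} {U V D : Fin g → ℂ} {p E : ℂ}

/-- The cubic expression in the derivatives of `f` that vanishes on the theta divisor. -/
noncomputable def cubic (f : (Fin g → ℂ) → ℂ) (U V z : Fin g → ℂ) : ℂ :=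
  ((dirDeriv V f z) ^ 2 - (dirDeriv U (dirDeriv U f) z) ^ 2) * dirDeriv U (dirDeriv U f) z
    + 2 * (dirDeriv U (dirDeriv U f) z * dirDeriv U (dirDeriv U (dirDeriv U f)) z
        - dirDeriv V f z * dirDeriv U (dirDeriv V f) z) * dirDeriv U f z
    + (dirDeriv V (dirDeriv V f) z - dirDeriv U (dirDeriv U (dirDeriv U (dirDeriv U f))) z)
        * (dirDeriv U f z) ^ 2

/-- At a common zero every other term of the Hirota form has a factor `f` or `h`. -/
theorem HirotaEquation.dirDeriv_mul_dirDeriv_eq {f h : (Fin g → ℂ) → ℂ}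
    (H : HirotaEquation f h U V p E) {z : Fin g → ℂ} (hz : f z = 0) (hh : h z = 0) :
    dirDeriv U f z * dirDeriv U h z = 0 := by
  have := H z
  rw [hz, hh] at this
  linear_combination -this / 2

/-- The gauge change `h ↦ h exp (p x + E y)` removes the parameters and replaces `∂_U`, `∂_V`,
acting on the Hirota form, by `∂_U + p`, `∂_V + E`. The form, its `∂_U + p` derivative, and its
`(∂_U + p)² - (∂_V + E)` derivative are linear in the derivatives of `h`; on `f = 0` the closing
combination eliminates all of these except `h` itself. -/
theorem HirotaEquation.mul_cubic_eq_zero {f h : (Fin g → ℂ) → ℂ} (hf : Differentiable ℂ f)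
    (hh : Differentiable ℂ h) (H : HirotaEquation f h U V p E) {z : Fin g → ℂ} (hz : f z = 0) :
    h z * cubic f U V z = 0 := by
  have hfU := differentiable_dirDeriv hf U
  have hfV := differentiable_dirDeriv hf V
  have hfUU := differentiable_dirDeriv hfU U
  have hfUUU := differentiable_dirDeriv hfUU U
  have hfUV := differentiable_dirDeriv hfV U
  have hhU := differentiable_dirDeriv hh U
  have hhV := differentiable_dirDeriv hh V
  have hhUU := differentiable_dirDeriv hhU U
  have hhUV := differentiable_dirDeriv hhV U
  have d : ∀ {F : (Fin g → ℂ) → ℂ}, Differentiable ℂ F → ∀ v, HasDirDeriv v F (dirDeriv v F) :=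
    fun hF v => hasDirDeriv hF v
  have cfVU : dirDeriv V (dirDeriv U f) = dirDeriv U (dirDeriv V f) := dirDeriv_comm hf V U
  have chVU : dirDeriv V (dirDeriv U h) = dirDeriv U (dirDeriv V h) := dirDeriv_comm hh V U
  have cfVUU : dirDeriv V (dirDeriv U (dirDeriv U f)) = dirDeriv U (dirDeriv U (dirDeriv V f)) := by
    rw [dirDeriv_comm hfU V U, cfVU]
  have chVUU : dirDeriv V (dirDeriv U (dirDeriv U h)) = dirDeriv U (dirDeriv U (dirDeriv V h)) := by
    rw [dirDeriv_comm hhU V U, chVU]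
  have hB : ∀ v, HasDirDeriv v _ _ := fun v =>
    ((((((d hf v).mul (d hhUU v)).sub (((d hfU v).const_mul 2).mul (d hhU v))).add
      ((d hfUU v).mul (d hh v))).add
      ((((d hf v).mul (d hhU v)).sub ((d hfU v).mul (d hh v))).const_mul (2 * p))).add
      (((d hf v).mul (d hh v)).const_mul (p ^ 2 - E))).sub
      (((d hf v).mul (d hhV v)).sub ((d hfV v).mul (d hh v)))
  have hBU := (hB U).eq_zero H
  have hBV := (hB V).eq_zero H z
  have hmul : ∀ {A B : (Fin g → ℂ) → ℂ}, Differentiable ℂ A → Differentiable ℂ B →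
      HasDirDeriv U (fun z => dirDeriv U A z * B z + A z * dirDeriv U B z) fun z =>
        (dirDeriv U (dirDeriv U A) z * B z + dirDeriv U A z * dirDeriv U B z)
        + (dirDeriv U A z * dirDeriv U B z + A z * dirDeriv U (dirDeriv U B) z) := fun hA hB =>
    ((d (differentiable_dirDeriv hA U) U).mul (d hB U)).add
      ((d hA U).mul (d (differentiable_dirDeriv hB U) U))
  have hmul2 : HasDirDeriv U (fun z => 2 * dirDeriv U (dirDeriv U f) z * dirDeriv U h z
      + 2 * dirDeriv U f z * dirDeriv U (dirDeriv U h) z) _ :=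
    (((d hfUU U).const_mul 2).mul (d hhU U)).add (((d hfU U).const_mul 2).mul (d hhUU U))
  have hBUU := ((((((hmul hf hhUU).sub hmul2).add (hmul hfUU hh)).add
    (((hmul hf hhU).sub (hmul hfU hh)).const_mul (2 * p))).add
    ((hmul hf hh).const_mul (p ^ 2 - E))).sub
    ((hmul hf hhV).sub (hmul hfV hh))).eq_zero hBU z
  have hB0 := H z
  have hBU0 := hBU z
  simp only [hz, cfVU, chVU, cfVUU, chVUU] at hB0 hBU0 hBV hBUU
  rw [cubic]
  set f1 := dirDeriv U f z
  set f2 := dirDeriv U (dirDeriv U f) z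
  set f3 := dirDeriv U (dirDeriv U (dirDeriv U f)) z
  set f4 := dirDeriv U (dirDeriv U (dirDeriv U (dirDeriv U f))) z
  set fy := dirDeriv V f z
  set fxy := dirDeriv U (dirDeriv V f) z
  set fyy := dirDeriv V (dirDeriv V f) z
  linear_combination -f1 ^ 2 * (hBUU + 2 * p * hBU0 + p ^ 2 * hB0 - hBV - E * hB0)
    + 2 * f1 * f2 * (hBU0 + p * hB0) - (2 * fxy * f1 - f2 * (fy - f2)) * hB0

/-- The implicit function theorem parametrises `f = 0` near `z` by the kernel of `df`; since `h`
vanishes along the parametrisation, `dh` vanishes on that kernel. -/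
theorem fderiv_apply_eq_zero_of_vanishing {f h : (Fin g → ℂ) → ℂ} (hf : Differentiable ℂ f)
    (hh : Differentiable ℂ h) {z : Fin g → ℂ} (hz : f z = 0) (hdf : fderiv ℂ f z ≠ 0)
    (hv : ∀ᶠ z' in 𝓝 z, f z' = 0 → h z' = 0) {v : Fin g → ℂ} (hker : fderiv ℂ f z v = 0) :
    fderiv ℂ h z v = 0 := by
  have hs : HasStrictFDerivAt f (fderiv ℂ f z) z :=
    (contDiff_of_differentiable hf).contDiffAt.hasStrictFDerivAt (by simp)
  have hrange : (fderiv ℂ f z).range = ⊤ := by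
    refine LinearMap.range_eq_top.2 (LinearMap.surjective fun h0 => hdf ?_)
    ext1 x
    exact LinearMap.congr_fun h0 x
  set φ := hs.implicitFunction f (fderiv ℂ f z) hrange with hφ
  have h1 : HasStrictFDerivAt (φ (f z)) (fderiv ℂ f z).ker.subtypeL 0 :=
    hs.to_implicitFunction hrange
  have h2 : ∀ᶠ p in 𝓝 (f z, (0 : (fderiv ℂ f z).ker)), f (φ p.1 p.2) = p.1 :=
    hs.map_implicitFunction_eq hrange
  have h3 : ∀ᶠ k in 𝓝 (0 : (fderiv ℂ f z).ker), f (φ (f z) k) = f z :=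
    (Continuous.prodMk_right (f z)).continuousAt.eventually h2
  have h4 : φ (f z) 0 = z := hs.implicitFunction_apply_image hrange
  have h5 : ∀ᶠ k in 𝓝 (0 : (fderiv ℂ f z).ker), h (φ (f z) k) = 0 := by
    have h6 : Tendsto (φ (f z)) (𝓝 0) (𝓝 z) := by
      simpa only [ContinuousAt, h4] using h1.continuousAt
    filter_upwards [h3, h6.eventually hv] with k hk1 hk2
    exact hk2 (hk1.trans hz)
  have h7 : HasFDerivAt (fun k => h (φ (f z) k)) ((fderiv ℂ h z).comp (fderiv ℂ f z).ker.subtypeL) 0 := by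
    have h8 : HasFDerivAt h (fderiv ℂ h z) (φ (f z) 0) := by
      rw [h4]
      exact (hh z).hasFDerivAt
    exact h8.comp 0 h1.hasFDerivAt
  have h10 : (fun k => h (φ (f z) k)) =ᶠ[𝓝 0] fun _ => (0 : ℂ) := h5
  have h9 := (h7.congr_of_eventuallyEq h10.symm).unique (hasFDerivAt_const (0 : ℂ) 0)
  exact DFunLike.congr_fun h9 ⟨v, hker⟩

/-- `dh` is a multiple of `df`, and its value on the transverse vector `U` decides which. -/
theorem fderiv_eq_zero_of_vanishing {f h : (Fin g → ℂ) → ℂ} (hf : Differentiable ℂ f)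
    (hh : Differentiable ℂ h) {z : Fin g → ℂ} (hz : f z = 0) (hU : dirDeriv U f z ≠ 0)
    (hv : ∀ᶠ z' in 𝓝 z, f z' = 0 → h z' = 0) (hhU : dirDeriv U h z = 0) :
    fderiv ℂ h z = 0 := by
  rw [dirDeriv_eq_fderiv hf] at hU
  rw [dirDeriv_eq_fderiv hh] at hhU
  beta_reduce at hU hhU
  have hdf : fderiv ℂ f z ≠ 0 := fun h0 => hU (by rw [h0, zero_apply])
  ext1 v
  have h1 := fderiv_apply_eq_zero_of_vanishing hf hh hz hdf hv
    (v := v - (fderiv ℂ f z v / fderiv ℂ f z U) • U)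
    (by rw [map_sub, map_smul, smul_eq_mul, div_mul_cancel₀ _ hU, sub_self])
  rw [map_sub, map_smul, hhU, smul_zero, sub_zero] at h1
  rw [h1, zero_apply]

theorem differentiable_cubic {f : (Fin g → ℂ) → ℂ} (hf : Differentiable ℂ f) :
    Differentiable ℂ (cubic f U V) := by
  have hfU := differentiable_dirDeriv hf U
  have hfV := differentiable_dirDeriv hf V
  have hfUU := differentiable_dirDeriv hfU U
  have hfUUU := differentiable_dirDeriv hfUU U
  have hfUUUU := differentiable_dirDeriv hfUUU U
  have hfUV := differentiable_dirDeriv hfV U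
  have hfVV := differentiable_dirDeriv hfV V
  unfold cubic
  fun_prop

/-- Otherwise the divisor is smooth near `z₀` and `h` vanishes on it, so the Hirota equation gives
`D_U h = 0` there and hence `dh = 0`. Thus `θ` is singular along the smooth hypersurface `θ (· - D)
= 0` near `z₀ + D`, against reducedness. -/
theorem dirDeriv_eq_zero_of_cubic_ne_zero (hτ : τ ∈ siegelSpace g)
    (H : HirotaEquation (theta τ) (fun z => theta τ (z + D)) U V p E) {z₀ : Fin g → ℂ}
    (hz₀ : theta τ z₀ = 0) (hT : cubic (theta τ) U V z₀ ≠ 0) : dirDeriv U (theta τ) z₀ = 0 := by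
  by_contra hU
  have hf := differentiable_theta hτ
  have hh := differentiable_add_const hf D
  have hev : ∀ᶠ z in 𝓝 z₀, cubic (theta τ) U V z ≠ 0 ∧ dirDeriv U (theta τ) z ≠ 0 :=
    ((differentiable_cubic hf).continuous.continuousAt.eventually_ne hT).and
      ((differentiable_dirDeriv hf U).continuous.continuousAt.eventually_ne hU)
  have hvan : ∀ᶠ z in 𝓝 z₀, theta τ z = 0 → theta τ (z + D) = 0 := by
    filter_upwards [hev] with z hz h0
    exact (mul_eq_zero.1 (H.mul_cubic_eq_zero hf hh h0)).resolve_right hz.1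
  have hfd : ∀ᶠ z in 𝓝 z₀, theta τ z = 0 →
      theta τ (z + D) = 0 ∧ fderiv ℂ (theta τ) (z + D) = 0 := by
    filter_upwards [hev, hvan.eventually_nhds] with z hz h1 h0
    have h2 := h1.self_of_nhds h0
    refine ⟨h2, ?_⟩
    rw [← fderiv_comp_add_right]
    exact fderiv_eq_zero_of_vanishing hf hh h0 hz.2 h1
      ((mul_eq_zero.1 (H.dirDeriv_mul_dirDeriv_eq h0 h2)).resolve_left hz.2)
  refine theta_divisor_reduced hτ (ρ := fun z => theta τ (z + -D)) (s := z₀ + D)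
    (differentiable_add_const hf (-D)) (by simpa using hz₀) (fun h0 => hU ?_) ?_
  · rw [fderiv_comp_add_right, add_neg_cancel_right] at h0
    rw [dirDeriv_eq_fderiv hf]
    beta_reduce
    rw [h0, zero_apply]
  · have htend : Tendsto (fun z => z + -D) (𝓝 (z₀ + D)) (𝓝 z₀) := by
      have : ContinuousAt (fun z => z + -D) (z₀ + D) := by fun_prop
      simpa only [ContinuousAt, add_neg_cancel_right] using this
    filter_upwards [htend.eventually hfd] with z hz h0
    simpa only [neg_add_cancel_right] using hz h0

/-- Let `ρ = D_U θ`. If the cubic is nonzero at `z₀`, the divisor lies in `ρ = 0` nearby, and the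
terms of the cubic left when `ρ z₀ = 0` show `D_U ρ ≠ 0`. Each nearby line of direction `U` then has
at most one zero of `ρ` close to `z₀`, and it does meet the divisor, so the two hypersurfaces
coincide. Along them `θ` and `D_U θ` vanish, hence `dθ = 0`, against reducedness. -/
theorem cubic_eq_zero (hτ : τ ∈ siegelSpace g)
    (H : HirotaEquation (theta τ) (fun z => theta τ (z + D)) U V p E) {z₀ : Fin g → ℂ}
    (hz₀ : theta τ z₀ = 0) : cubic (theta τ) U V z₀ = 0 := by
  classical
  by_contra hT
  have hf := differentiable_theta hτ
  set f := theta τ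
  set ρ := dirDeriv U f with hρ_def
  have hρ : Differentiable ℂ ρ := differentiable_dirDeriv hf U
  have hU0 : ρ z₀ = 0 := dirDeriv_eq_zero_of_cubic_ne_zero hτ H hz₀ hT
  have hUU : dirDeriv U ρ z₀ ≠ 0 := by
    intro h0
    refine hT ?_
    rw [cubic, ← hρ_def, hU0, h0]
    ring
  have hUU' : fderiv ℂ ρ z₀ U ≠ 0 := by rwa [dirDeriv_eq_fderiv hρ] at hUU
  have hev : ∀ᶠ z in 𝓝 z₀, (f z = 0 → ρ z = 0) ∧ dirDeriv U ρ z ≠ 0 := by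
    filter_upwards [(differentiable_cubic hf).continuous.continuousAt.eventually_ne hT,
      (differentiable_dirDeriv hρ U).continuous.continuousAt.eventually_ne hUU] with z h1 h2
    exact ⟨fun h0 => dirDeriv_eq_zero_of_cubic_ne_zero hτ H h0 h1, h2⟩
  have hρiso := eventually_line_ne_zero_of_fderiv hρ hUU'
  have hρord : analyticOrderNatAt (fun s : ℂ => ρ (z₀ + s • U)) 0 = 1 := by
    have han := analyticAt_line hρ U z₀ 0
    have h1 : analyticOrderNatAt (fun s : ℂ => ρ (z₀ + s • U)) 0 ≠ 0 := fun h =>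
      (analyticOrderNatAt_eq_zero_iff han hρiso).1 h (by simpa using hU0)
    have h2 : ¬2 ≤ analyticOrderNatAt (fun s : ℂ => ρ (z₀ + s • U)) 0 := fun h => by
      have h3 := ((two_le_analyticOrderNatAt_iff han hρiso).1 h).2
      rw [(hasDerivAt_line hρ U z₀ 0).deriv] at h3
      exact hUU' (by simpa using h3)
    omega
  -- If `f` vanished identically near `0` on this line, so would its derivative `ρ`, whose zero is
  -- isolated.
  have hfiso : ∀ᶠ t in 𝓝[≠] (0 : ℂ), f (z₀ + t • U) ≠ 0 := by
    refine (analyticAt_line hf U z₀ 0).eventually_eq_zero_or_eventually_ne_zero.resolve_left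
      fun h0 => ?_
    have h1 : ∀ᶠ t in 𝓝 (0 : ℂ), ρ (z₀ + t • U) = 0 := by
      filter_upwards [h0.eventually_nhds] with t ht
      have h2 : (fun t : ℂ => f (z₀ + t • U)) =ᶠ[𝓝 t] fun _ => 0 := ht
      exact ((hasDirDeriv hf U).hasDerivAt z₀ t).deriv.symm.trans
        (h2.deriv_eq.trans (deriv_const _ _))
    obtain ⟨t, h2, h3⟩ := ((eventually_nhdsWithin_of_eventually_nhds h1).and hρiso).exists
    exact h3 h2
  have hkey : ∀ᶠ z in 𝓝 z₀, ρ z = 0 → f z = 0 := by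
    have h1 : ∀ᶠ q in 𝓝 (z₀, (0 : ℂ)), (f (q.1 + q.2 • U) = 0 → ρ (q.1 + q.2 • U) = 0) := by
      have h2 : ContinuousAt (fun q : (Fin g → ℂ) × ℂ => q.1 + q.2 • U) (z₀, 0) := by fun_prop
      have h3 : Tendsto (fun q : (Fin g → ℂ) × ℂ => q.1 + q.2 • U) (𝓝 (z₀, 0)) (𝓝 z₀) := by
        simpa only [ContinuousAt, zero_smul, add_zero] using h2
      exact h3.eventually (p := fun z => f z = 0 → ρ z = 0) (hev.mono fun z hz => hz.1)
    rw [nhds_prod_eq] at h1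
    obtain ⟨P, hP, Q, hQ, hPQ⟩ := eventually_prod_iff.1 h1
    obtain ⟨r, hr, hQ'⟩ := Metric.eventually_nhds_iff_ball.1 hQ
    obtain ⟨ε, hε, hε'⟩ := ((eventually_exists_line_zeros hρ hρiso).and (Ioo_mem_nhdsGT hr)).exists
    filter_upwards [hP, hε, eventually_exists_line_zero hf hz₀ hfiso hε'.1] with z hz
      ⟨Z, hZ, hZ1, hZs⟩ ⟨t, ht, ht0⟩ h0
    have h2 : t ∈ Z := (hZ t).2 ⟨ht, hPQ hz (hQ' t (Metric.ball_subset_ball hε'.2.le ht)) ht0⟩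
    have h3 : (0 : ℂ) ∈ Z := (hZ 0).2 ⟨Metric.mem_ball_self hε'.1, by simpa using h0⟩
    have h4 : Z.card ≤ 1 := by
      rw [← hρord, ← hZs, Finset.card_eq_sum_ones]
      exact Finset.sum_le_sum hZ1
    have h5 : t = 0 := Finset.card_le_one.1 h4 t h2 0 h3
    simpa [h5] using ht0
  refine theta_divisor_reduced hτ hρ hU0 (fun h0 => hUU' (by rw [h0, zero_apply])) ?_
  filter_upwards [hev, hkey.eventually_nhds] with z h1 h2 h0
  exact ⟨h2.self_of_nhds h0, fderiv_eq_zero_of_vanishing hρ hf h0 h1.2 h2 h0⟩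

end Divisor

/-! ### Motion of the simple zeros. -/

section ZeroMotion

variable {g : ℕ} {τ : Matrix (Fin g) (Fin g) ℂ} {U V : Fin g → ℂ}

theorem differentiable_deriv {F : ℂ → ℂ} (hF : Differentiable ℂ F) : Differentiable ℂ (deriv F) :=
  differentiableOn_univ.1 (hF.differentiableOn.deriv isOpen_univ)

/-- The expansion of the second logarithmic derivative at a simple zero. -/
theorem deriv_logDeriv_isLittleO {F F1 F2 F3 F4 : ℂ → ℂ} (h1 : ∀ x, HasDerivAt F (F1 x) x)
    (h2 : ∀ x, HasDerivAt F1 (F2 x) x) (h3 : ∀ x, HasDerivAt F2 (F3 x) x)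
    (h4 : ∀ x, HasDerivAt F3 (F4 x) x) {a : ℂ} (ha : F a = 0) (ha1 : F1 a ≠ 0) :
    ∃ v, (fun x => 2 * deriv (logDeriv F) x - (-2 / (x - a) ^ 2 + v +
      (F4 a / (2 * F1 a) - F2 a * F3 a / F1 a ^ 2 + F2 a ^ 3 / (2 * F1 a ^ 3)) * (x - a)))
      =o[𝓝[≠] a] fun x => x - a := by
  have hF : Differentiable ℂ F := fun x => (h1 x).differentiableAt
  -- With `F = (x - a) G`, the second logarithmic derivative is `-1 / (x - a)²` plus that of `G`,
  -- which is differentiable at `a`; twice its value and twice its derivative there are the two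
  -- coefficients.
  set G := dslope F a
  have hG : Differentiable ℂ G := differentiableOn_univ.1
    ((Complex.differentiableOn_dslope Filter.univ_mem).2 hF.differentiableOn)
  have hG1 := differentiable_deriv hG
  have hG2 := differentiable_deriv hG1
  have hG3 := differentiable_deriv hG2
  set G1 := deriv G
  set G2 := deriv G1
  set G3 := deriv G2
  have dG : ∀ x, HasDerivAt G (G1 x) x := fun x => (hG x).hasDerivAt
  have dG1 : ∀ x, HasDerivAt G1 (G2 x) x := fun x => (hG1 x).hasDerivAt
  have dG2 : ∀ x, HasDerivAt G2 (G3 x) x := fun x => (hG2 x).hasDerivAt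
  have dG3 : ∀ x, HasDerivAt G3 (deriv G3 x) x := fun x => (hG3 x).hasDerivAt
  have hX : ∀ x : ℂ, HasDerivAt (fun x => x - a) 1 x := fun x => (hasDerivAt_id x).sub_const a
  have e0 : F = fun x => (x - a) * G x := funext fun x => by
    have := sub_smul_dslope F a x
    rw [ha, sub_zero, smul_eq_mul] at this
    exact this.symm
  have e1 : F1 = fun x => G x + (x - a) * G1 x := funext fun x => by
    have := (hX x).fun_mul (dG x)
    rw [← e0, one_mul] at this
    exact (h1 x).unique this
  have e2 : F2 = fun x => 2 * G1 x + (x - a) * G2 x := funext fun x => by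
    have := (dG x).fun_add ((hX x).fun_mul (dG1 x))
    rw [← e1] at this
    rw [(h2 x).unique this]
    ring
  have e3 : F3 = fun x => 3 * G2 x + (x - a) * G3 x := funext fun x => by
    have := ((dG1 x).const_mul 2).fun_add ((hX x).fun_mul (dG2 x))
    rw [← e2] at this
    rw [(h3 x).unique this]
    ring
  have e4 : F4 a = 4 * G3 a := by
    have := ((dG2 a).const_mul 3).fun_add ((hX a).fun_mul (dG3 a))
    rw [← e3] at this
    rw [(h4 a).unique this]
    ring
  have a1 : F1 a = G a := by simp [e1]
  have a2 : F2 a = 2 * G1 a := by simp [e2]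
  have a3 : F3 a = 3 * G2 a := by simp [e3]
  have hGa : G a ≠ 0 := a1 ▸ ha1
  have hk : HasDerivAt (fun x => (G2 x * G x - G1 x ^ 2) / G x ^ 2)
      (((G3 a * G a + G2 a * G1 a - 2 * G1 a * G2 a) * G a ^ 2
        - (G2 a * G a - G1 a ^ 2) * (2 * G a * G1 a)) / (G a ^ 2) ^ 2) a := by
    have b1 : HasDerivAt (fun x => G1 x ^ 2) (2 * G1 a * G2 a) a := by
      simpa using (dG1 a).fun_pow 2
    have b2 : HasDerivAt (fun x => G x ^ 2) (2 * G a * G1 a) a := by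
      simpa using (dG a).fun_pow 2
    exact (((dG2 a).fun_mul (dG a)).fun_sub b1).fun_div b2 (pow_ne_zero 2 hGa)
  refine ⟨2 * ((G2 a * G a - G1 a ^ 2) / G a ^ 2), ?_⟩
  have hlo := (hasDerivAt_iff_isLittleO.1 hk).mono (nhdsWithin_le_nhds (s := {a}ᶜ))
  refine (hlo.const_mul_left 2).congr' ?_ EventuallyEq.rfl
  have hne : ∀ᶠ x in 𝓝[≠] a, G x ≠ 0 :=
    eventually_nhdsWithin_of_eventually_nhds ((dG a).continuousAt.eventually_ne hGa)
  filter_upwards [hne, self_mem_nhdsWithin] with x hx hxa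
  have hxa' : x - a ≠ 0 := sub_ne_zero.2 hxa
  have hFx : F x ≠ 0 := by
    rw [e0]
    exact mul_ne_zero hxa' hx
  rw [deriv_logDeriv h1 h2 hFx, a1, a2, a3, e4, e0, e1, e2]
  simp only [smul_eq_mul]
  set X := x - a
  field_simp
  ring

theorem hasDerivAt_comp_curve {F : (Fin g → ℂ) → ℂ} (hF : Differentiable ℂ F) {ξ : ℂ → ℂ} {ξ' y : ℂ}
    (hξ : HasDerivAt ξ ξ' y) (Z : Fin g → ℂ) :
    HasDerivAt (fun y => F (ξ y • U + y • V + Z))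
      (ξ' * dirDeriv U F (ξ y • U + y • V + Z) + dirDeriv V F (ξ y • U + y • V + Z)) y := by
  have h1 : HasDerivAt (fun y => ξ y • U + y • V + Z) (ξ' • U + V) y := by
    have := ((hξ.smul_const U).fun_add ((hasDerivAt_id y).smul_const V)).add_const Z
    simpa using this
  have h2 := (hF (ξ y • U + y • V + Z)).hasFDerivAt.comp_hasDerivAt y h1
  rw [map_add, map_smul, smul_eq_mul] at h2
  rw [dirDeriv_eq_fderiv hF, dirDeriv_eq_fderiv hF]
  exact h2

/-- Differentiation of `θ (ξ U + y V + Z) = 0` gives `D_V θ = -ξ' D_U θ`, and a second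
differentiation gives `ξ''`. With these substitutions the cubic relation becomes `ξ'' = -2 w`
multiplied by `(D_U θ)³`. -/
theorem ThetaDivisorRelation.zeroDynamics (hτ : τ ∈ siegelSpace g)
    (H : ThetaDivisorRelation τ U V) : ZeroDynamics τ U V := by
  intro Z ξ y₀ hξ hzero hne
  have hf := differentiable_theta hτ
  set f := theta τ with hf_def
  have hfU := differentiable_dirDeriv hf U
  have hfV := differentiable_dirDeriv hf V
  have hfUU := differentiable_dirDeriv hfU U
  have hfUUU := differentiable_dirDeriv hfUU U
  set z₀ := ξ y₀ • U + y₀ • V + Z with hz₀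
  have hz0 : f z₀ = 0 := hzero.self_of_nhds
  obtain ⟨v, hv⟩ := deriv_logDeriv_isLittleO
    (fun x => (hasDirDeriv hf U).hasDerivAt_fst (V := V) Z x y₀)
    (fun x => (hasDirDeriv hfU U).hasDerivAt_fst (V := V) Z x y₀)
    (fun x => (hasDirDeriv hfUU U).hasDerivAt_fst (V := V) Z x y₀)
    (fun x => (hasDirDeriv hfUUU U).hasDerivAt_fst (V := V) Z x y₀) hz0 hne
  refine ⟨v, _, hv, ?_⟩
  have hξd : ∀ᶠ y in 𝓝 y₀, HasDerivAt ξ (deriv ξ y) y :=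
    hξ.eventually_analyticAt.mono fun y hy => hy.differentiableAt.hasDerivAt
  have h1 : ∀ᶠ y in 𝓝 y₀, deriv ξ y * dirDeriv U f (ξ y • U + y • V + Z)
      + dirDeriv V f (ξ y • U + y • V + Z) = 0 := by
    filter_upwards [hξd, hzero.eventually_nhds] with y hy h0
    have h2 : (fun y => f (ξ y • U + y • V + Z)) =ᶠ[𝓝 y] fun _ => 0 := h0
    exact (hasDerivAt_comp_curve hf hy Z).deriv.symm.trans (h2.deriv_eq.trans (deriv_const _ _))
  have hξ2 : HasDerivAt (deriv ξ) (deriv (deriv ξ) y₀) y₀ := hξ.deriv.differentiableAt.hasDerivAt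
  have h2 := (hξ2.fun_mul (hasDerivAt_comp_curve (U := U) (V := V) hfU hξd.self_of_nhds Z)).fun_add
    (hasDerivAt_comp_curve (U := U) (V := V) hfV hξd.self_of_nhds Z)
  have h3 : (fun y => deriv ξ y * dirDeriv U f (ξ y • U + y • V + Z)
      + dirDeriv V f (ξ y • U + y • V + Z)) =ᶠ[𝓝 y₀] fun _ => 0 := h1
  have h4 := h2.deriv.symm.trans (h3.deriv_eq.trans (deriv_const _ _))
  have h5 := h1.self_of_nhds
  have hT := H z₀ hz0
  rw [← hz₀, dirDeriv_comm hf V U] at h4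
  rw [← hz₀] at h5
  rw [← hf_def] at hT
  rw [iteratedDeriv_succ, iteratedDeriv_one]
  set f1 := dirDeriv U f z₀
  set f2 := dirDeriv U (dirDeriv U f) z₀
  set f3 := dirDeriv U (dirDeriv U (dirDeriv U f)) z₀
  set f4 := dirDeriv U (dirDeriv U (dirDeriv U (dirDeriv U f))) z₀
  set fy := dirDeriv V f z₀
  set fxy := dirDeriv U (dirDeriv V f) z₀
  set fyy := dirDeriv V (dirDeriv V f) z₀
  have h6 : fy = -(deriv ξ y₀ * f1) := by linear_combination h5
  rw [← mul_left_inj' (pow_ne_zero 3 hne)]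
  field_simp
  rw [h6] at hT
  linear_combination f1 ^ 2 * h4 - hT

end ZeroMotion

end FlexTheta

theorem mainTheorem5 (g : ℕ) (τ : Matrix (Fin g) (Fin g) ℂ) (hτ : τ ∈ FlexTheta.siegelSpace g)
    (U V D : Fin g → ℂ) (p E : ℂ) :
    (FlexTheta.LinearEquation τ U V D p E ↔ FlexTheta.FlexEquation τ U V (-D) p E) ∧
    (FlexTheta.LinearEquation τ U V D p E →
      FlexTheta.ThetaDivisorRelation τ U V ∧ FlexTheta.ZeroDynamics τ U V) ∧
    (FlexTheta.FlexEquation τ U V (-D) p E →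
      FlexTheta.ThetaDivisorRelation τ U V ∧ FlexTheta.ZeroDynamics τ U V) := by
  have h1 := FlexTheta.linearEquation_iff_hirotaEquation (U := U) (V := V) (D := D) (p := p)
    (E := E) hτ
  have h2 := FlexTheta.hirotaEquation_iff_kummer (U := U) (V := V) (D := D) (p := p) (E := E) hτ
  have h3 : FlexTheta.LinearEquation τ U V D p E →
      FlexTheta.ThetaDivisorRelation τ U V ∧ FlexTheta.ZeroDynamics τ U V := fun h => by
    have h4 : FlexTheta.ThetaDivisorRelation τ U V := fun z hz =>
      FlexTheta.cubic_eq_zero hτ (h1.1 h) hz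
    exact ⟨h4, h4.zeroDynamics hτ⟩
  exact ⟨h1.trans h2, h3, fun h => h3 ((h1.trans h2).2 h)⟩
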